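/- Call an algorithm randomized if it may flip fair coins; its running time on an input is its expected number of steps on that input (worst-case running times are a special case). Let $\mathcal G(n,\tfrac12)$ be the uniform distribution on graphs with vertex set $[n]$, and let $\mathcal G(n,\tfrac12,\kappa)$ be the distribution of $G$ with a clique added on an independent, uniformly random set of $\kappa$ vertices, where $G\sim\mathcal G(n,\tfrac12)$. The Strongish Planted Clique Hypothesis (SPCH) states: there is a constant $\delta\in(0,\tfrac12)$ such that no randomized algorithm $\mathcal A$ with running time $n^{o(\log n)}$ on every $n$-vertex graph satisfies, for all sufficiently large $n$, both $$\Pr_{G\sim\mathcal G(n,\frac12,\lceil n^\delta\rceil)}[\mathcal A(G)=1]\ge \tfrac23\qquad\text{and}\qquad \Pr_{G\sim\mathcal G(n,\frac12)}[\mathcal A(G)=1]\le\tfrac13 ,$$ the probabilities being over $G$ and the coins of $\mathcal A$. In Densest $k$-Subgraph the input is an $n$-vertex graph $G$ and an integer $1\le k\le n$, and the goal is to output a set $S$ of $k$ vertices that induces as many edges as possible. An algorithm approximates the problem within a factor $g(k)$ if, on every input, with probability at least $\tfrac23$ it outputs a $k$-set $S$ such that every $k$-set of vertices of $G$ induces at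 most $g(k)\cdot e(S)$ edges, where $e(S)$ is the number of edges induced by $S$. **Theorem.** Assume SPCH. Then for every function $f:\mathbb N\to\mathbb N$, every constant $c$ and every function $g$ with $g(k)=o(k)$, there is no randomized algorithm with running time at most $f(k)\cdot n^{c}$ that approximates Densest $k$-Subgraph on $n$-vertex graphs within the factor $g(k)$. This holds even in the perfect completeness case, where the running time and the approximation guarantee are required only on inputs $(G,k)$ such that $G$ contains a $k$-clique. -/

import Mathlib

open scoped ENNReal

namespace DkS

/-! ### Machine model: randomized WHILE programs over binary trees

The data are binary trees, a program uses finitely many variables, and every elementary command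
(one `cons`, `head`, `tail`, copy, test or coin flip) costs one time step. This is the WHILE
language of N. Jones with fair coin flips; its time measure is polynomially equivalent to that of
probabilistic Turing machines and random access machines. -/

/-- Data values: binary trees. -/
inductive Val : Type
  | nil : Val
  | cons : Val → Val → Val

namespace Val

/-- First component (`nil` has components `nil`). -/
def head : Val → Val
  | nil => nil
  | cons a _ => a

/-- Second component (`nil` has components `nil`). -/
def tail : Val → Val
  | nil => nil
  | cons _ b => b

/-- `false` is `nil`, `true` is `cons nil nil`. -/
def ofBool : Bool → Val
  | false => nil
  | true => cons nil nil

/-- Lists in the usual nil/cons form. -/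
def ofList : List Val → Val
  | [] => nil
  | a :: l => cons a (ofList l)

/-- Natural numbers in unary, as lists of `nil`s. -/
def ofNat (k : ℕ) : Val := ofList (List.replicate k nil)

end Val

/-- Programs; variables are indexed by natural numbers. -/
inductive Cmd : Type
  /-- `x := nil` -/
  | clear (x : ℕ) : Cmd
  /-- `x := y` -/
  | copy (x y : ℕ) : Cmd
  /-- `x := cons y z` -/
  | cons (x y z : ℕ) : Cmd
  /-- `x := head y` -/
  | head (x y : ℕ) : Cmd
  /-- `x := tail y` -/
  | tail (x y : ℕ) : Cmd
  /-- `x :=` a fresh fair random bit -/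
  | flip (x : ℕ) : Cmd
  /-- `p; q` -/
  | seq (p q : Cmd) : Cmd
  /-- `if x ≠ nil then p else q` -/
  | ite (x : ℕ) (p q : Cmd) : Cmd
  /-- `while x ≠ nil do p` -/
  | loop (x : ℕ) (p : Cmd) : Cmd

/-- Contents of the variables. -/
abbrev Store : Type := ℕ → Val

/-- The commands still to be executed and the current store; halted iff no command is left. -/
abbrev Config : Type := List Cmd × Store

noncomputable section

/-- One time step. Halted configurations do not change. -/
def step : Config → PMF Config
  | ([], s) => PMF.pure ([], s)
  | (Cmd.clear x :: K, s) => PMF.pure (K, Function.update s x Val.nil)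
  | (Cmd.copy x y :: K, s) => PMF.pure (K, Function.update s x (s y))
  | (Cmd.cons x y z :: K, s) => PMF.pure (K, Function.update s x (Val.cons (s y) (s z)))
  | (Cmd.head x y :: K, s) => PMF.pure (K, Function.update s x (s y).head)
  | (Cmd.tail x y :: K, s) => PMF.pure (K, Function.update s x (s y).tail)
  | (Cmd.flip x :: K, s) =>
      (PMF.uniformOfFintype Bool).map fun b => (K, Function.update s x (Val.ofBool b))
  | (Cmd.seq p q :: K, s) => PMF.pure (p :: q :: K, s)
  | (Cmd.ite x p q :: K, s) =>
      match s x with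
      | Val.nil => PMF.pure (q :: K, s)
      | Val.cons _ _ => PMF.pure (p :: K, s)
  | (Cmd.loop x p :: K, s) =>
      match s x with
      | Val.nil => PMF.pure (K, s)
      | Val.cons _ _ => PMF.pure (p :: Cmd.loop x p :: K, s)

/-- Distribution of the configuration after `t` steps. -/
def run : ℕ → Config → PMF Config
  | 0, c => PMF.pure c
  | t + 1, c => (step c).bind (run t)

/-- Initially variable `0` holds the input and all other variables are `nil`. -/
def start (P : Cmd) (input : Val) : Config :=
  ([P], Function.update (fun _ => Val.nil) 0 input)

/-- The probability, over the coins of `P`, that `P` halts on `input` with an output in `X`;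
the output is the final value of variable `0`. -/
def outputProb (P : Cmd) (input : Val) (X : Set Val) : ℝ≥0∞ :=
  ⨆ t : ℕ, (run t (start P input)).toOuterMeasure {c | c.1 = [] ∧ c.2 0 ∈ X}

/-- The expected number of steps of `P` on `input`, i.e. `∑ t, Pr[P runs for more than t steps]`. -/
def expectedTime (P : Cmd) (input : Val) : ℝ≥0∞ :=
  ∑' t : ℕ, (run t (start P input)).toOuterMeasure {c | c.1 ≠ []}

/-! ### Graphs as inputs -/

open Classical in
/-- Adjacency matrix, as the list of its rows. -/
def encodeGraph {n : ℕ} (G : SimpleGraph (Fin n)) : Val :=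
  Val.ofList (List.ofFn fun i : Fin n =>
    Val.ofList (List.ofFn fun j : Fin n => Val.ofBool (decide (G.Adj i j))))

/-- Vertex sets as characteristic vectors. -/
def encodeSet {n : ℕ} (S : Finset (Fin n)) : Val :=
  Val.ofList (List.ofFn fun i : Fin n => Val.ofBool (decide (i ∈ S)))

/-- The input `(G, k)`. -/
def encodeInstance {n : ℕ} (G : SimpleGraph (Fin n)) (k : ℕ) : Val :=
  Val.cons (encodeGraph G) (Val.ofNat k)

/-! ### Planted clique -/

/-- The Erdős–Rényi distribution with edge probability `1/2`: a uniformly random graph. -/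
def erdosRenyi (n : ℕ) : PMF (SimpleGraph (Fin n)) :=
  PMF.uniformOfFintype (SimpleGraph (Fin n))

/-- The graph whose edges are exactly the pairs of distinct elements of `S`. -/
def cliqueOn {n : ℕ} (S : Finset (Fin n)) : SimpleGraph (Fin n) :=
  SimpleGraph.fromRel fun u v => u ∈ S ∧ v ∈ S

/-- A uniformly random vertex set of size `κ` (of size `n` if `κ > n`). -/
def randomSubset (n κ : ℕ) : PMF (Finset (Fin n)) :=
  PMF.uniformOfFinset (Finset.powersetCard (min κ n) Finset.univ)
    (Finset.powersetCard_nonempty.2 (by simp))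

/-- The Erdős–Rényi distribution with edge probability `1/2` and a clique planted on an independent
uniformly random set of `κ` vertices. -/
def plantedClique (n κ : ℕ) : PMF (SimpleGraph (Fin n)) :=
  (erdosRenyi n).bind fun G => (randomSubset n κ).map fun S => G ⊔ cliqueOn S

/-- The probability that `P` outputs `1`, over an input graph drawn from `D` and the coins of `P`. -/
def acceptProb (P : Cmd) {n : ℕ} (D : PMF (SimpleGraph (Fin n))) : ℝ≥0∞ :=
  ∑' G : SimpleGraph (Fin n), D G * outputProb P (encodeGraph G) {Val.ofBool true}

/-- `P` is a (randomized) `n^{o(log n)}`-time algorithm on `n`-vertex graphs. -/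
def RunsInSubquasipolyTime (P : Cmd) : Prop :=
  ∃ h : ℕ → ℝ, (h =o[Filter.atTop] fun n : ℕ => Real.log n) ∧
    ∀ᶠ n : ℕ in Filter.atTop, ∀ G : SimpleGraph (Fin n),
      expectedTime P (encodeGraph G) ≤ ENNReal.ofReal ((n : ℝ) ^ h n)

/-- The Strongish Planted Clique Hypothesis. An algorithm is refuted as soon as it fails for
infinitely many `n` (for `n = 1` the two distributions coincide). -/
def SPCH : Prop :=
  ∃ δ : ℝ, 0 < δ ∧ δ < 1 / 2 ∧
    ¬ ∃ P : Cmd, RunsInSubquasipolyTime P ∧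
      ∀ᶠ n : ℕ in Filter.atTop,
        2 / 3 ≤ acceptProb P (plantedClique n ⌈(n : ℝ) ^ δ⌉₊) ∧
        acceptProb P (erdosRenyi n) ≤ 1 / 3

/-! ### Densest `k`-Subgraph -/

/-- Number of edges of the subgraph induced by `S`. -/
def inducedEdges {n : ℕ} (G : SimpleGraph (Fin n)) (S : Finset (Fin n)) : ℕ :=
  (G.induce (S : Set (Fin n))).edgeSet.ncard

/-- `S` is an `α`-approximate solution of the instance `(G, k)`. -/
def IsApproxSolution {n : ℕ} (G : SimpleGraph (Fin n)) (k : ℕ) (α : ℝ) (S : Finset (Fin n)) :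
    Prop :=
  S.card = k ∧ ∀ S' : Finset (Fin n), S'.card = k →
    (inducedEdges G S' : ℝ) ≤ α * (inducedEdges G S : ℝ)

/-- On all instances `(G, k)` with `1 ≤ k ≤ n` that satisfy the promise, the program `P` has
expected running time at most `f k * n ^ c` and outputs a `g k`-approximate solution of
Densest `k`-Subgraph with probability at least `2/3`. -/
def ApproximatesDkS (promise : ∀ n : ℕ, SimpleGraph (Fin n) → ℕ → Prop)
    (P : Cmd) (g : ℕ → ℝ) (f : ℕ → ℕ) (c : ℕ) : Prop :=
  ∀ (n k : ℕ) (G : SimpleGraph (Fin n)), 1 ≤ k → k ≤ n → promise n G k →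
    expectedTime P (encodeInstance G k) ≤ ((f k * n ^ c : ℕ) : ℝ≥0∞) ∧
    2 / 3 ≤ outputProb P (encodeInstance G k)
      {v | ∃ S : Finset (Fin n), IsApproxSolution G k (g k) S ∧ v = encodeSet S}

/-- No promise. -/
def noPromise (n : ℕ) (_ : SimpleGraph (Fin n)) (_ : ℕ) : Prop := True

/-- Perfect completeness: the graph contains a `k`-clique. -/
def hasClique (n : ℕ) (G : SimpleGraph (Fin n)) (k : ℕ) : Prop :=
  ∃ S : Finset (Fin n), G.IsNClique k S

end

end DkS

/-! Let `P` approximate Densest `k`-Subgraph within a factor `g(k) = o(k)` on graphs with a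
`k`-clique. Cliques planted on at least `n^{1/q}` vertices are then detected through a randomized
graph product. Draw `N` random vertex sets of `G`, ignore those without exactly `ℓ` elements, and
join two sets if all pairs between them are edges (`blowGraph`). A large clique of `G` is split into
`k` disjoint parts. For suitable `N` each part contains one of the sets (`expect_missing_le`), and
these form a `k`-clique of the product (`exists_clique_blowGraph`). If `g(k) * Θ ≤ k`, a
`g(k)`-approximate solution spans `e` edges of the product with `2 * e ≥ (k - 1) * Θ`. The random
sets also expand with good probability (`expect_not_expanding_le`). By Hall's theorem the `ℓ`-sets
in the solution then contain pairwise disjoint subsets of size `lam`, so `e` edges of the product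
force `2 * e * lam ^ 2` ordered pairs of adjacent vertices of `G` (`Expanding.card_marked_ge`).

This is a certificate: it exceeds four times the number `k * ℓ * a + k * k` of bits that describe
the chosen sets and the complete pairs among them, where `n ≤ 2 ^ a`. A union bound over all
descriptions shows that a uniformly random graph has no certificate with probability at least `2/3`
once `n ≥ 9` (`expect_hasCert_le`). The test is one-sided, since without a certificate nothing is
ever accepted (`detect_eq_zero`).

With `a` about `log n`, `lam` about `a / E` and `ℓ = 8 * q * lam`, one attempt costs `2 ^ O(a² /
E)`. Here `E` may be any constant, but `k` and `Θ` depend on it, whereas SPCH is contradicted only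
by a single algorithm of time `n ^ o(log n)`. Hence the parameters are guessed. A `trial` draws `k`,
`ℓ`, `a`, `log N` and the logarithm of the time bound from geometric distributions so steep that its
expected cost is polynomial (`RComp.trial`). For every fixed `s` its success probability on graphs
with a large clique is eventually at least `2 ^ (-a² / s)` (`eventually_le_trial`).

It remains to know when to stop, as the success probability is not computable from the input. A
`race` samples its own graph with a planted clique, counts the failures until a trial succeeds
there, and grants the input one trial more. The law of a trial is invariant under relabeling
(`trial_comp`), so on planted inputs both waiting times have the same law (`planted_waiting`). Two
races are both lost only if the waiting time of the input is the strict maximum of three independent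
copies, which has probability at most `1/3` (`expect_detect_false_le`). The expected time is
polynomial in `n` divided by the success probability on sampled graphs, for every input
(`RComp.detect`). Running races for all `κ` with `n ≤ κ ^ q` makes it unnecessary to compute `n ^
δ`.

For the machine model, `val` measures steps and final payoff at once, and `RComp` states an upper
bound on it for every continuation. Such bounds compose, and they suffice even for lower bounds on
output probabilities, because programs of finite expected time halt almost surely. -/

namespace DkS

/-! ### Expected payoffs of program configurations -/

noncomputable section

/-! ### Expectations with respect to discrete distributions -/

/-- The expectation of `U` under `μ`. -/
def expect {α : Type*} (μ : PMF α) (U : α → ℝ≥0∞) : ℝ≥0∞ := ∑' x, μ x * U x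

section expect

variable {α β : Type*}

@[simp] lemma expect_pure (a : α) (U : α → ℝ≥0∞) : expect (PMF.pure a) U = U a := by
  classical
  unfold expect
  rw [tsum_eq_single a]
  · simp
  · intro b hb; simp [hb]

lemma expect_bind (μ : PMF α) (f : α → PMF β) (U : β → ℝ≥0∞) :
    expect (μ.bind f) U = expect μ fun a => expect (f a) U := by
  unfold expect
  simp only [PMF.bind_apply, ← ENNReal.tsum_mul_right, ← ENNReal.tsum_mul_left]
  rw [ENNReal.tsum_comm]
  simp only [mul_assoc]

lemma expect_map (μ : PMF α) (f : α → β) (U : β → ℝ≥0∞) :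
    expect (μ.map f) U = expect μ fun a => U (f a) := by
  rw [← PMF.bind_pure_comp, expect_bind]
  simp

lemma expect_mono_support {μ : PMF α} {U W : α → ℝ≥0∞} (h : ∀ x ∈ μ.support, U x ≤ W x) :
    expect μ U ≤ expect μ W := by
  refine ENNReal.tsum_le_tsum fun x => ?_
  by_cases hx : μ x = 0
  · simp [hx]
  · exact mul_le_mul_right (h x hx) _

lemma expect_mono {μ : PMF α} {U W : α → ℝ≥0∞} (h : ∀ x, U x ≤ W x) :
    expect μ U ≤ expect μ W := expect_mono_support fun x _ => h x

@[simp] lemma expect_const (μ : PMF α) (c : ℝ≥0∞) : expect μ (fun _ => c) = c := by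
  unfold expect
  rw [ENNReal.tsum_mul_right, PMF.tsum_coe, one_mul]

lemma expect_add (μ : PMF α) (U W : α → ℝ≥0∞) :
    expect μ (fun x => U x + W x) = expect μ U + expect μ W := by
  unfold expect
  simp only [mul_add, ENNReal.tsum_add]

lemma expect_mul_left (μ : PMF α) (c : ℝ≥0∞) (U : α → ℝ≥0∞) :
    expect μ (fun x => c * U x) = c * expect μ U := by
  unfold expect
  rw [← ENNReal.tsum_mul_left]
  exact tsum_congr fun x => by ring

lemma expect_le_of_support {μ : PMF α} {U : α → ℝ≥0∞} {c : ℝ≥0∞}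
    (h : ∀ x ∈ μ.support, U x ≤ c) : expect μ U ≤ c :=
  (expect_mono_support h).trans (expect_const μ c).le

lemma expect_comm (μ : PMF α) (ν : PMF β) (U : α → β → ℝ≥0∞) :
    expect μ (fun a => expect ν fun b => U a b) = expect ν fun b => expect μ fun a => U a b := by
  unfold expect
  simp only [← ENNReal.tsum_mul_left]
  rw [ENNReal.tsum_comm]
  exact tsum_congr fun b => tsum_congr fun a => by ring

lemma expect_bool (μ : PMF Bool) (U : Bool → ℝ≥0∞) :
    expect μ U = μ true * U true + μ false * U false := by
  unfold expect
  rw [tsum_bool, add_comm]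

lemma bool_add (μ : PMF Bool) : μ true + μ false = 1 := by
  have h := μ.tsum_coe
  rwa [tsum_bool, add_comm] at h

lemma expect_fintype [Fintype α] (μ : PMF α) (U : α → ℝ≥0∞) :
    expect μ U = ∑ x, μ x * U x := tsum_fintype _

end expect

/-! ### Expected payoffs of configurations -/

/-- Expected value of `w` per executed step plus `Θ` of the final store, truncated after `t`
steps. -/
def val (w : ℝ≥0∞) (Θ : Store → ℝ≥0∞) : ℕ → Config → ℝ≥0∞
  | 0, ([], s) => Θ s
  | 0, (_ :: _, _) => 0
  | _ + 1, ([], s) => Θ s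
  | t + 1, (c :: K, s) => w + expect (step (c :: K, s)) (val w Θ t)

section val

variable {w : ℝ≥0∞} {Θ : Store → ℝ≥0∞}

@[simp] lemma val_nil (t : ℕ) (s : Store) : val w Θ t ([], s) = Θ s := by
  cases t <;> rfl

@[simp] lemma val_zero_cons (c : Cmd) (K : List Cmd) (s : Store) : val w Θ 0 (c :: K, s) = 0 := rfl

lemma val_succ_cons (t : ℕ) (c : Cmd) (K : List Cmd) (s : Store) :
    val w Θ (t + 1) (c :: K, s) = w + expect (step (c :: K, s)) (val w Θ t) := rfl

lemma val_le_succ (t : ℕ) (c : Config) : val w Θ t c ≤ val w Θ (t + 1) c := by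
  induction t generalizing c with
  | zero =>
    obtain ⟨_ | ⟨c, K⟩, s⟩ := c <;> simp
  | succ t ih =>
    obtain ⟨_ | ⟨c, K⟩, s⟩ := c
    · simp
    · rw [val_succ_cons, val_succ_cons]
      exact add_le_add le_rfl (expect_mono ih)

lemma val_mono {t t' : ℕ} (h : t ≤ t') (c : Config) : val w Θ t c ≤ val w Θ t' c :=
  monotone_nat_of_le_succ (f := fun t => val w Θ t c) (fun t => val_le_succ t c) h

/-- One step of unfolding, as an upper bound. -/
lemma val_cons_le (t : ℕ) (c : Cmd) (K : List Cmd) (s : Store) :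
    val w Θ t (c :: K, s) ≤ w + expect (step (c :: K, s)) (val w Θ t) := by
  cases t with
  | zero => simp
  | succ t =>
    rw [val_succ_cons]
    exact add_le_add le_rfl (expect_mono fun c => val_le_succ t c)

variable (t : ℕ) (K : List Cmd) (s : Store)

lemma val_clear (x : ℕ) : val w Θ t (Cmd.clear x :: K, s) ≤
    w + val w Θ t (K, Function.update s x Val.nil) :=
  (val_cons_le t _ K s).trans (by simp [step])

lemma val_copy (x y : ℕ) : val w Θ t (Cmd.copy x y :: K, s) ≤
    w + val w Θ t (K, Function.update s x (s y)) :=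
  (val_cons_le t _ K s).trans (by simp [step])

lemma val_consCmd (x y z : ℕ) : val w Θ t (Cmd.cons x y z :: K, s) ≤
    w + val w Θ t (K, Function.update s x (Val.cons (s y) (s z))) :=
  (val_cons_le t _ K s).trans (by simp [step])

lemma val_head (x y : ℕ) : val w Θ t (Cmd.head x y :: K, s) ≤
    w + val w Θ t (K, Function.update s x (s y).head) :=
  (val_cons_le t _ K s).trans (by simp [step])

lemma val_tail (x y : ℕ) : val w Θ t (Cmd.tail x y :: K, s) ≤
    w + val w Θ t (K, Function.update s x (s y).tail) :=
  (val_cons_le t _ K s).trans (by simp [step])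

lemma val_flip (x : ℕ) : val w Θ t (Cmd.flip x :: K, s) ≤
    w + expect (PMF.uniformOfFintype Bool)
      fun b => val w Θ t (K, Function.update s x (Val.ofBool b)) :=
  (val_cons_le t _ K s).trans (by simp [step, expect_map])

lemma val_seq (p q : Cmd) : val w Θ t (Cmd.seq p q :: K, s) ≤
    w + val w Θ t (p :: q :: K, s) :=
  (val_cons_le t _ K s).trans (by simp [step])

lemma val_ite_nil {x : ℕ} (p q : Cmd) (h : s x = Val.nil) :
    val w Θ t (Cmd.ite x p q :: K, s) ≤ w + val w Θ t (q :: K, s) :=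
  (val_cons_le t _ K s).trans (by simp [step, h])

lemma val_ite_cons {x : ℕ} (p q : Cmd) (h : s x ≠ Val.nil) :
    val w Θ t (Cmd.ite x p q :: K, s) ≤ w + val w Θ t (p :: K, s) :=
  (val_cons_le t _ K s).trans (by
    cases hx : s x with
    | nil => exact absurd hx h
    | cons a b => simp [step, hx])

lemma val_loop_nil {x : ℕ} (p : Cmd) (h : s x = Val.nil) :
    val w Θ t (Cmd.loop x p :: K, s) ≤ w + val w Θ t (K, s) :=
  (val_cons_le t _ K s).trans (by simp [step, h])

lemma val_loop_cons {x : ℕ} (p : Cmd) (h : s x ≠ Val.nil) :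
    val w Θ t (Cmd.loop x p :: K, s) ≤ w + val w Θ t (p :: Cmd.loop x p :: K, s) :=
  (val_cons_le t _ K s).trans (by
    cases hx : s x with
    | nil => exact absurd hx h
    | cons a b => simp [step, hx])

lemma val_succ_loop_cons {x : ℕ} (p : Cmd) (h : s x ≠ Val.nil) :
    val w Θ (t + 1) (Cmd.loop x p :: K, s) = w + val w Θ t (p :: Cmd.loop x p :: K, s) := by
  rw [val_succ_cons]
  cases hx : s x with
  | nil => exact absurd hx h
  | cons a b => simp [step, hx]

end val

lemma run_nil (t : ℕ) (s : Store) : run t ([], s) = PMF.pure ([], s) := by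
  induction t with
  | zero => rfl
  | succ t ih => simp [run, step, ih]

/-- Free steps (`w = 0`) and an indicator as final payoff turn `val` into the probability of having
halted in `X` within `t` steps. -/
lemma toOuterMeasure_halted_eq_val (X : Set Store) (t : ℕ) (c : Config) :
    (run t c).toOuterMeasure {c | c.1 = [] ∧ c.2 ∈ X} = val 0 (X.indicator 1) t c := by
  classical
  induction t generalizing c with
  | zero =>
    obtain ⟨_ | ⟨c, K⟩, s⟩ := c
    · by_cases h : s ∈ X <;> simp [run, PMF.toOuterMeasure_pure_apply, h]
    · simp [run, PMF.toOuterMeasure_pure_apply]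
  | succ t ih =>
    obtain ⟨_ | ⟨c, K⟩, s⟩ := c
    · by_cases h : s ∈ X <;> simp [run_nil, PMF.toOuterMeasure_pure_apply, h]
    · simp only [run, PMF.toOuterMeasure_bind_apply, val_succ_cons, ih, zero_add]
      rfl

/-- Unit price per step and no final payoff turn `val` into the truncated expected running time. -/
lemma sum_running_eq_val (t : ℕ) (c : Config) :
    ∑ i ∈ Finset.range t, (run i c).toOuterMeasure {c | c.1 ≠ []} = val 1 0 t c := by
  classical
  induction t generalizing c with
  | zero =>
    obtain ⟨_ | ⟨c, K⟩, s⟩ := c <;> simp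
  | succ t ih =>
    obtain ⟨_ | ⟨c, K⟩, s⟩ := c
    · simp [run_nil, PMF.toOuterMeasure_pure_apply]
    · rw [Finset.sum_range_succ', val_succ_cons, add_comm]
      congr 1
      · simp [run, PMF.toOuterMeasure_pure_apply]
      · simp only [run, PMF.toOuterMeasure_bind_apply]
        rw [← Summable.tsum_finsetSum (fun _ _ => ENNReal.summable)]
        simp only [← Finset.mul_sum, ih]
        rfl

lemma expectedTime_le {P : Cmd} {v : Val} {T : ℝ≥0∞}
    (h : ∀ t, val 1 0 t (start P v) ≤ T) : expectedTime P v ≤ T := by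
  unfold expectedTime
  rw [ENNReal.tsum_eq_iSup_nat]
  exact iSup_le fun t => (sum_running_eq_val t _).le.trans (h t)

/-- The calculus yields only upper bounds. Lower bounds on output probabilities are obtained by
applying this to the complementary outputs and using `one_le_outputProb_add_compl`. -/
lemma outputProb_le {P : Cmd} {v : Val} {X : Set Val} {q : ℝ≥0∞}
    (h : ∀ t, val 0 ({s : Store | s 0 ∈ X}.indicator 1) t (start P v) ≤ q) :
    outputProb P v X ≤ q :=
  iSup_le fun t => (toOuterMeasure_halted_eq_val {s : Store | s 0 ∈ X} t _).le.trans (h t)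

/-- A program of finite expected running time halts almost surely. -/
lemma one_le_outputProb_add_compl {P : Cmd} {v : Val} (X : Set Val)
    (h : expectedTime P v ≠ ∞) : 1 ≤ outputProb P v X + outputProb P v Xᶜ := by
  classical
  set r : ℕ → ℝ≥0∞ := fun t => (run t (start P v)).toOuterMeasure {c | c.1 ≠ []} with hr
  have h0 : Filter.Tendsto r Filter.atTop (nhds 0) := ENNReal.tendsto_atTop_zero_of_tsum_ne_top h
  have h1 : ∀ t, 1 ≤ outputProb P v X + outputProb P v Xᶜ + r t := by
    intro t
    have hu : (1 : ℝ≥0∞) = (run t (start P v)).toOuterMeasure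
        (({c | c.1 = [] ∧ c.2 0 ∈ X} ∪ {c | c.1 = [] ∧ c.2 0 ∈ Xᶜ}) ∪ {c | c.1 ≠ []}) := by
      rw [eq_comm, PMF.toOuterMeasure_apply_eq_one_iff]
      intro c _
      by_cases h1 : c.1 = [] <;> by_cases h2 : c.2 0 ∈ X <;> simp [h1, h2]
    rw [hu]
    refine (MeasureTheory.measure_union_le _ _).trans (add_le_add ?_ le_rfl)
    refine (MeasureTheory.measure_union_le _ _).trans (add_le_add ?_ ?_)
    · exact le_iSup (fun t => (run t (start P v)).toOuterMeasure {c | c.1 = [] ∧ c.2 0 ∈ X}) t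
    · exact le_iSup (fun t => (run t (start P v)).toOuterMeasure {c | c.1 = [] ∧ c.2 0 ∈ Xᶜ}) t
  have h2 : Filter.Tendsto (fun t => outputProb P v X + outputProb P v Xᶜ + r t) Filter.atTop
      (nhds (outputProb P v X + outputProb P v Xᶜ + 0)) := tendsto_const_nhds.add h0
  rw [add_zero] at h2
  exact ge_of_tendsto' h2 h1

end

end DkS

/-! ### Compositional cost bounds for randomized functions -/

namespace DkS

noncomputable section

/-! ### Typed data -/

/-- Types whose elements are represented by values, with a size measure. -/
class Enc (α : Type) where
  enc : α → Val
  sz : α → ℕ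
  one_le_sz : ∀ a, 1 ≤ sz a

open Enc (enc sz one_le_sz)

/-- Raw values are opaque: they have size one. -/
instance : Enc Val := ⟨id, fun _ => 1, fun _ => le_rfl⟩

instance : Enc Bool := ⟨Val.ofBool, fun _ => 1, fun _ => le_rfl⟩

instance : Enc ℕ := ⟨Val.ofNat, fun n => n + 1, fun _ => Nat.le_add_left 1 _⟩

instance {α : Type} [Enc α] : Enc (List α) :=
  ⟨fun l => Val.ofList (l.map enc), fun l => (l.map fun a => sz a + 1).sum + 1,
    fun _ => Nat.le_add_left 1 _⟩

instance {α β : Type} [Enc α] [Enc β] : Enc (α × β) :=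
  ⟨fun p => Val.cons (enc p.1) (enc p.2), fun p => sz p.1 + sz p.2 + 1,
    fun _ => Nat.le_add_left 1 _⟩

section enc

variable {α β : Type} [Enc α] [Enc β]

lemma enc_val (v : Val) : enc v = v := rfl
lemma enc_pair (a : α) (b : β) : enc (a, b) = Val.cons (enc a) (enc b) := rfl
lemma enc_list_nil : enc ([] : List α) = Val.nil := rfl
lemma enc_list_cons (a : α) (l : List α) : enc (a :: l) = Val.cons (enc a) (enc l) := rfl
lemma enc_nat_zero : enc (0 : ℕ) = Val.nil := rfl
lemma enc_nat_succ (n : ℕ) : enc (n + 1) = Val.cons Val.nil (enc n) := rfl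
lemma enc_false : enc false = Val.nil := rfl
lemma enc_true : enc true = Val.cons Val.nil Val.nil := rfl

lemma sz_val (v : Val) : sz v = 1 := rfl
lemma sz_bool (b : Bool) : sz b = 1 := rfl
lemma sz_nat (n : ℕ) : sz n = n + 1 := rfl
lemma sz_prod (p : α × β) : sz p = sz p.1 + sz p.2 + 1 := rfl
lemma sz_pair (a : α) (b : β) : sz (a, b) = sz a + sz b + 1 := rfl
lemma sz_list_nil : sz ([] : List α) = 1 := rfl
lemma sz_list_cons (a : α) (l : List α) : sz (a :: l) = sz a + 1 + sz l := by
  change ((a :: l).map _).sum + 1 = _ + ((l.map _).sum + 1)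
  simp [add_assoc]

lemma length_le_sz (l : List α) : l.length ≤ sz l := by
  induction l with
  | nil => simp
  | cons a l ih => rw [sz_list_cons, List.length_cons]; have := one_le_sz a; omega

lemma sz_le_of_mem {a : α} {l : List α} (h : a ∈ l) : sz a ≤ sz l := by
  induction l with
  | nil => simp at h
  | cons b l ih =>
    rw [sz_list_cons]
    rcases List.mem_cons.1 h with rfl | h
    · omega
    · have := ih h; omega

end enc

/-! ### Randomized functions computed by programs -/

variable {α β γ σ : Type} [Enc α] [Enc β] [Enc γ] [Enc σ]

/-- The randomized function `f` is computed in expected time `T`, in place in any register `b`,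
without changing the registers below `b`. -/
def RComp (f : α → PMF β) (T : α → ℝ≥0∞) : Prop :=
  ∀ b : ℕ, ∃ p : Cmd, ∀ (w : ℝ≥0∞) (Θ : Store → ℝ≥0∞) (t : ℕ) (K : List Cmd) (s : Store) (a : α)
    (U : β → ℝ≥0∞), s b = enc a →
    (∀ x s', s' b = enc x → (∀ i < b, s' i = s i) → val w Θ t (K, s') ≤ U x) →
    val w Θ t (p :: K, s) ≤ w * T a + expect (f a) U

/-- The bookkeeping of one executed command. Chains of this lemma walk through straight-line code
and leave the step count as a sum of ones, which `ring` evaluates; `add_expect_le` plays the same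
role for a subprogram. -/
lemma add_step_le {w A A' B n : ℝ≥0∞} (h : A ≤ w + A') (h' : A' ≤ w * n + B) :
    A ≤ w * (n + 1) + B := by
  refine h.trans ((add_le_add le_rfl h').trans (le_of_eq ?_))
  ring

lemma add_expect_le {ι : Type*} {w A T : ℝ≥0∞} {μ : PMF ι} {W R V : ι → ℝ≥0∞}
    (h : A ≤ w * T + expect μ W) (h' : ∀ x, W x ≤ w * R x + V x) :
    A ≤ w * (T + expect μ R) + expect μ V := by
  refine h.trans ((add_le_add le_rfl (expect_mono h')).trans (le_of_eq ?_))
  rw [expect_add, expect_mul_left]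
  ring

namespace RComp

lemma mono {f : α → PMF β} {T T' : α → ℝ≥0∞} (h : RComp f T) (hT : ∀ a, T a ≤ T' a) :
    RComp f T' := by
  intro b
  obtain ⟨p, hp⟩ := h b
  refine ⟨p, fun w Θ t K s a U hs hU => (hp w Θ t K s a U hs hU).trans ?_⟩
  gcongr
  exact hT a

lemma congr {f g : α → PMF β} {T : α → ℝ≥0∞} (h : RComp f T) (hg : ∀ a, f a = g a) :
    RComp g T := by
  have : f = g := funext hg
  exact this ▸ h

lemma recode {f : α → β} (h : ∀ a, enc (f a) = enc a) :
    RComp (fun a => PMF.pure (f a)) fun _ => 1 := by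
  intro b
  refine ⟨Cmd.copy b b, fun w Θ t K s a U hs hU => ?_⟩
  rw [expect_pure, mul_one]
  refine (val_copy t K s b b).trans (add_le_add le_rfl (hU _ _ ?_ ?_))
  · simp [hs, h]
  · intro i _; simp

lemma headVal {f : α → β} (h : ∀ a, enc (f a) = (enc a).head) :
    RComp (fun a => PMF.pure (f a)) fun _ => 1 := by
  intro b
  refine ⟨Cmd.head b b, fun w Θ t K s a U hs hU => ?_⟩
  rw [expect_pure, mul_one]
  refine (val_head t K s b b).trans (add_le_add le_rfl (hU _ _ ?_ ?_))
  · simp [hs, h]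
  · intro i hi; simp [hi.ne]

lemma tailVal {f : α → β} (h : ∀ a, enc (f a) = (enc a).tail) :
    RComp (fun a => PMF.pure (f a)) fun _ => 1 := by
  intro b
  refine ⟨Cmd.tail b b, fun w Θ t K s a U hs hU => ?_⟩
  rw [expect_pure, mul_one]
  refine (val_tail t K s b b).trans (add_le_add le_rfl (hU _ _ ?_ ?_))
  · simp [hs, h]
  · intro i hi; simp [hi.ne]

lemma clearVal {f : α → β} (h : ∀ a, enc (f a) = Val.nil) :
    RComp (fun a => PMF.pure (f a)) fun _ => 1 := by
  intro b
  refine ⟨Cmd.clear b, fun w Θ t K s a U hs hU => ?_⟩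
  rw [expect_pure, mul_one]
  refine (val_clear t K s b).trans (add_le_add le_rfl (hU _ _ ?_ ?_))
  · simp [h]
  · intro i hi; simp [hi.ne]

lemma coin : RComp (fun _ : α => PMF.uniformOfFintype Bool) fun _ => 1 := by
  intro b
  refine ⟨Cmd.flip b, fun w Θ t K s a U hs hU => ?_⟩
  rw [mul_one]
  refine (val_flip t K s b).trans (add_le_add le_rfl (expect_mono fun x => hU _ _ ?_ ?_))
  · simp; rfl
  · intro i hi; simp [hi.ne]

lemma comp {f : α → PMF β} {g : β → PMF γ} {Tf : α → ℝ≥0∞} {Tg : β → ℝ≥0∞}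
    (hf : RComp f Tf) (hg : RComp g Tg) :
    RComp (fun a => (f a).bind g) fun a => Tf a + expect (f a) Tg + 1 := by
  intro b
  obtain ⟨p, hp⟩ := hf b
  obtain ⟨q, hq⟩ := hg b
  refine ⟨Cmd.seq p q, fun w Θ t K s a U hs hU => ?_⟩
  rw [expect_bind]
  refine add_step_le (val_seq t K s p q) ?_
  refine add_expect_le (hp w Θ t (q :: K) s a (fun x => w * Tg x + expect (g x) U) hs ?_)
    fun x => le_rfl
  intro x s' hs' hlow
  exact hq w Θ t K s' x U hs' fun y s'' h1 h2 =>
    hU y s'' h1 fun i hi => (h2 i hi).trans (hlow i hi)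

/-- The argument stays in `b` while `f` works on a copy in `b + 1` and `g` on a copy in `b + 2`;
neither touches the registers below its own. The constant counts four `seq`, two `copy` and one
`cons`. -/
lemma pair {f : α → PMF β} {g : α → PMF γ} {Tf Tg : α → ℝ≥0∞}
    (hf : RComp f Tf) (hg : RComp g Tg) :
    RComp (fun a => (f a).bind fun x => (g a).map fun y => (x, y))
      fun a => Tf a + Tg a + 7 := by
  intro b
  obtain ⟨p, hp⟩ := hf (b + 1)
  obtain ⟨q, hq⟩ := hg (b + 2)
  refine ⟨Cmd.seq (Cmd.copy (b + 1) b) (Cmd.seq p (Cmd.seq (Cmd.copy (b + 2) b)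
    (Cmd.seq q (Cmd.cons b (b + 1) (b + 2))))), fun w Θ t K s a U hs hU => ?_⟩
  have key : val w Θ t (Cmd.seq (Cmd.copy (b + 1) b) (Cmd.seq p (Cmd.seq (Cmd.copy (b + 2) b)
      (Cmd.seq q (Cmd.cons b (b + 1) (b + 2))))) :: K, s) ≤
      w * (Tf a + expect (f a) (fun _ => Tg a + expect (g a) (fun _ => 0 + 1) + 1 + 1 + 1)
        + 1 + 1 + 1) + expect (f a) fun x => expect (g a) fun y => U (x, y) := by
    refine add_step_le (val_seq t _ _ _ _) (add_step_le (val_copy t _ _ _ _)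
      (add_step_le (val_seq t _ _ _ _) ?_))
    refine add_expect_le (hp w Θ t _ _ a (fun x => w * (Tg a +
      expect (g a) (fun _ => 0 + 1) + 1 + 1 + 1) + expect (g a) fun y => U (x, y)) ?_ ?_)
      fun x => le_rfl
    · simp [hs]
    · intro x s1 h1 h1'
      refine add_step_le (val_seq t _ _ _ _) (add_step_le (val_copy t _ _ _ _)
        (add_step_le (val_seq t _ _ _ _) ?_))
      refine add_expect_le (hq w Θ t _ _ a (fun y => w * (0 + 1) + U (x, y)) ?_ ?_)
        fun y => le_rfl
      · have : s1 b = s b := by rw [h1' b (by omega)]; simp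
        simp [this, hs]
      · intro y s2 h2 h2'
        refine add_step_le (val_consCmd t _ _ _ _ _) ?_
        rw [mul_zero, zero_add]
        refine hU (x, y) _ ?_ ?_
        · have : s2 (b + 1) = enc x := by
            rw [h2' (b + 1) (by omega)]; simp [h1]
          simp [this, h2, enc_pair]
        · intro i hi
          have e1 : s2 i = s1 i := by
            rw [h2' i (by omega), Function.update_of_ne (by omega)]
          have e2 : s1 i = s i := by
            rw [h1' i (by omega), Function.update_of_ne (by omega)]
          rw [Function.update_of_ne (by omega), e1, e2]
  rw [expect_bind]
  simp only [expect_map]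
  refine key.trans (add_le_add (mul_le_mul_right (le_of_eq ?_) _) le_rfl)
  simp only [expect_const, zero_add]
  ring

lemma cond {c : α → Bool} {f g : α → PMF β} {Tc Tf Tg : α → ℝ≥0∞}
    (hc : RComp (fun a => PMF.pure (c a)) Tc) (hf : RComp f Tf) (hg : RComp g Tg) :
    RComp (fun a => if c a then f a else g a)
      fun a => Tc a + (if c a then Tf a else Tg a) + 4 := by
  intro b
  obtain ⟨r, hr⟩ := hc (b + 1)
  obtain ⟨p, hp⟩ := hf b
  obtain ⟨q, hq⟩ := hg b
  refine ⟨Cmd.seq (Cmd.copy (b + 1) b) (Cmd.seq r (Cmd.ite (b + 1) p q)),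
    fun w Θ t K s a U hs hU => ?_⟩
  have key : val w Θ t (Cmd.seq (Cmd.copy (b + 1) b) (Cmd.seq r (Cmd.ite (b + 1) p q)) :: K, s) ≤
      w * (Tc a + ((if c a then Tf a else Tg a) + 1) + 1 + 1 + 1) +
        expect (if c a then f a else g a) U := by
    refine add_step_le (val_seq t _ _ _ _) (add_step_le (val_copy t _ _ _ _)
      (add_step_le (val_seq t _ _ _ _) ?_))
    have h := hr w Θ t (Cmd.ite (b + 1) p q :: K) (Function.update s (b + 1) (s b)) a
      (fun x => w * ((if x then Tf a else Tg a) + 1) +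
        expect (if x then f a else g a) U) (by simp [hs]) ?_
    · rw [expect_pure] at h
      refine h.trans (le_of_eq ?_)
      ring
    · intro x s1 h1 h1'
      have hs1 : s1 b = enc a := by rw [h1' b (by omega)]; simp [hs]
      have hlow : ∀ i < b, s1 i = s i := fun i hi => by
        rw [h1' i (by omega), Function.update_of_ne (by omega)]
      cases x with
      | true =>
        refine add_step_le (val_ite_cons t _ _ _ _ (by rw [h1, enc_true]; simp)) ?_
        exact hp w Θ t K s1 a U hs1 fun y s' h2 h2' =>
          hU y s' h2 fun i hi => (h2' i hi).trans (hlow i hi)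
      | false =>
        refine add_step_le (val_ite_nil t _ _ _ _ (by rw [h1, enc_false])) ?_
        exact hq w Θ t K s1 a U hs1 fun y s' h2 h2' =>
          hU y s' h2 fun i hi => (h2' i hi).trans (hlow i hi)
  refine key.trans (add_le_add (mul_le_mul_right (le_of_eq ?_) _) le_rfl)
  ring

end RComp

/-- Monadic left fold. -/
def foldP {σ ι : Type*} (f : σ → ι → PMF σ) : σ → List ι → PMF σ
  | s, [] => PMF.pure s
  | s, x :: l => (f s x).bind fun s' => foldP f s' l

/-- Expected accumulated cost of a monadic left fold. -/
def foldCost {σ ι : Type*} (f : σ → ι → PMF σ) (T : σ → ι → ℝ≥0∞) : σ → List ι → ℝ≥0∞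
  | _, [] => 0
  | s, x :: l => T s x + expect (f s x) fun s' => foldCost f T s' l

lemma foldP_pure {σ ι : Type*} (f : σ → ι → σ) (s : σ) (l : List ι) :
    foldP (fun s x => PMF.pure (f s x)) s l = PMF.pure (l.foldl f s) := by
  induction l generalizing s with
  | nil => rfl
  | cons x l ih => simp [foldP, ih]

/-- Register `b` keeps the argument, `b + 1` the rest of the list, `b + 2` the state, and `b + 3` is
the work space of the step function. A pass of the loop costs eleven steps besides the step
function, and nine steps are spent outside the passes, including the final loop test. -/
lemma RComp.fold {l : α → List β} {s₀ : α → σ} {f : α × (σ × β) → PMF σ}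
    {Tl Ts : α → ℝ≥0∞} {Tf : α × (σ × β) → ℝ≥0∞}
    (hl : RComp (fun a => PMF.pure (l a)) Tl) (hs₀ : RComp (fun a => PMF.pure (s₀ a)) Ts)
    (hf : RComp f Tf) :
    RComp (fun a => foldP (fun s x => f (a, (s, x))) (s₀ a) (l a))
      fun a => Tl a + Ts a +
        foldCost (fun s x => f (a, (s, x))) (fun s x => Tf (a, (s, x)) + 11) (s₀ a) (l a) + 9 := by
  intro b
  obtain ⟨pl, hpl⟩ := hl (b + 1)
  obtain ⟨ps, hps⟩ := hs₀ (b + 2)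
  obtain ⟨pf, hpf⟩ := hf (b + 3)
  set body : Cmd := Cmd.seq (Cmd.head (b + 3) (b + 1)) (Cmd.seq (Cmd.cons (b + 3) (b + 2) (b + 3))
    (Cmd.seq (Cmd.cons (b + 3) b (b + 3)) (Cmd.seq pf (Cmd.seq (Cmd.copy (b + 2) (b + 3))
      (Cmd.tail (b + 1) (b + 1)))))) with hbody
  refine ⟨Cmd.seq (Cmd.copy (b + 1) b) (Cmd.seq pl (Cmd.seq (Cmd.copy (b + 2) b) (Cmd.seq ps
    (Cmd.seq (Cmd.loop (b + 1) body) (Cmd.copy b (b + 2)))))), fun w Θ t K s a U hs hU => ?_⟩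
  -- Each pass of the loop begins with a genuine step, so induction on the truncation time works. At
  -- the exit, `val_mono` returns to the original truncation `t`, for which the continuation bound
  -- is known.
  have loopB : ∀ (t' : ℕ), t' ≤ t → ∀ (L : List β) (st : σ) (S : Store), S b = enc a →
      S (b + 1) = enc L → S (b + 2) = enc st → (∀ i < b, S i = s i) →
      val w Θ t' (Cmd.loop (b + 1) body :: Cmd.copy b (b + 2) :: K, S) ≤
        w * (foldCost (fun s x => f (a, (s, x))) (fun s x => Tf (a, (s, x)) + 11) st L + 2) +
          expect (foldP (fun s x => f (a, (s, x))) st L) U := by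
    intro t'
    induction t' with
    | zero => intros; simp
    | succ t' ih =>
      intro ht L st S hb h1 h2 hlow
      cases L with
      | nil =>
        refine (add_step_le (n := 0 + 1) (val_loop_nil _ _ _ _ h1)
          (add_step_le (val_copy _ _ _ _ _) (B := U st) ?_)).trans (le_of_eq ?_)
        · rw [mul_zero, zero_add]
          refine (val_mono ht _).trans (hU st _ (by simp [h2]) fun i hi => ?_)
          rw [Function.update_of_ne (by omega), hlow i hi]
        · simp only [foldCost, foldP, expect_pure]; ring_nf
      | cons x L =>
        rw [val_succ_loop_cons _ _ _ _ (by rw [h1, enc_list_cons]; simp)]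
        have key : val w Θ t' (body :: Cmd.loop (b + 1) body :: Cmd.copy b (b + 2) :: K, S) ≤
            w * (Tf (a, (st, x)) + expect (f (a, (st, x))) (fun st' =>
              (foldCost (fun s x => f (a, (s, x))) (fun s x => Tf (a, (s, x)) + 11) st' L + 2)
                + 1 + 1 + 1) + 1 + 1 + 1 + 1 + 1 + 1 + 1) +
            expect (f (a, (st, x))) (fun st' =>
              expect (foldP (fun s x => f (a, (s, x))) st' L) U) := by
          rw [hbody]
          refine add_step_le (val_seq _ _ _ _ _) (add_step_le (val_head _ _ _ _ _)
            (add_step_le (val_seq _ _ _ _ _) (add_step_le (val_consCmd _ _ _ _ _ _)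
            (add_step_le (val_seq _ _ _ _ _) (add_step_le (val_consCmd _ _ _ _ _ _)
            (add_step_le (val_seq _ _ _ _ _) ?_))))))
          refine add_expect_le (hpf w Θ t' _ _ (a, (st, x)) (fun st' => w *
            ((foldCost (fun s x => f (a, (s, x))) (fun s x => Tf (a, (s, x)) + 11) st' L + 2)
                + 1 + 1 + 1) + expect (foldP (fun s x => f (a, (s, x))) st' L) U) ?_ ?_)
            fun st' => le_rfl
          · simp [h1, h2, hb, enc_pair, enc_list_cons, Val.head]
          · intro st' S' hS' hlow'
            refine add_step_le (val_seq _ _ _ _ _) (add_step_le (val_copy _ _ _ _ _)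
              (add_step_le (val_tail _ _ _ _ _) ?_))
            have hlow'' : ∀ i < b + 3, S' i = S i := fun i hi => by
              rw [hlow' i hi]
              rw [Function.update_of_ne (by omega), Function.update_of_ne (by omega),
                Function.update_of_ne (by omega)]
            refine ih (by omega) L st' _ ?_ ?_ ?_ ?_
            · simp [hlow'' b (by omega), hb]
            · simp [hlow'' (b + 1) (by omega), h1, enc_list_cons, Val.tail]
            · simp [hS']
            · intro i hi
              rw [Function.update_of_ne (by omega), Function.update_of_ne (by omega),
                hlow'' i (by omega), hlow i hi]
        refine (add_step_le le_rfl key).trans (le_of_eq ?_)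
        simp only [foldCost, foldP, expect_bind, expect_add, expect_const]
        ring
  have key : val w Θ t (Cmd.seq (Cmd.copy (b + 1) b) (Cmd.seq pl (Cmd.seq (Cmd.copy (b + 2) b)
      (Cmd.seq ps (Cmd.seq (Cmd.loop (b + 1) body) (Cmd.copy b (b + 2)))))) :: K, s) ≤
      w * (Tl a + expect (PMF.pure (l a)) (fun L => Ts a + expect (PMF.pure (s₀ a)) (fun st =>
        (foldCost (fun s x => f (a, (s, x))) (fun s x => Tf (a, (s, x)) + 11) st L + 2) + 1)
        + 1 + 1 + 1) + 1 + 1 + 1) +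
      expect (PMF.pure (l a)) fun L => expect (PMF.pure (s₀ a)) fun st =>
        expect (foldP (fun s x => f (a, (s, x))) st L) U := by
    refine add_step_le (val_seq _ _ _ _ _) (add_step_le (val_copy _ _ _ _ _)
      (add_step_le (val_seq _ _ _ _ _) ?_))
    refine add_expect_le (hpl w Θ t _ _ a (fun L => w * (Ts a + expect (PMF.pure (s₀ a)) (fun st =>
        (foldCost (fun s x => f (a, (s, x))) (fun s x => Tf (a, (s, x)) + 11) st L + 2) + 1)
        + 1 + 1 + 1) + expect (PMF.pure (s₀ a)) fun st =>
        expect (foldP (fun s x => f (a, (s, x))) st L) U) ?_ ?_) fun L => le_rfl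
    · simp [hs]
    intro L s1 h1 h1'
    have hs1 : s1 b = enc a := by rw [h1' b (by omega)]; simp [hs]
    refine add_step_le (val_seq _ _ _ _ _) (add_step_le (val_copy _ _ _ _ _)
      (add_step_le (val_seq _ _ _ _ _) ?_))
    refine add_expect_le (hps w Θ t _ _ a (fun st => w *
        ((foldCost (fun s x => f (a, (s, x))) (fun s x => Tf (a, (s, x)) + 11) st L + 2) + 1) +
        expect (foldP (fun s x => f (a, (s, x))) st L) U) ?_ ?_) fun L => le_rfl
    · simp [hs1]
    intro st s2 h2 h2'
    refine add_step_le (val_seq _ _ _ _ _) ?_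
    refine loopB t le_rfl L st s2 ?_ ?_ h2 ?_
    · rw [h2' b (by omega)]; simp [hs1]
    · rw [h2' (b + 1) (by omega)]; simp [h1]
    · intro i hi
      rw [h2' i (by omega), Function.update_of_ne (by omega), h1' i (by omega),
        Function.update_of_ne (by omega)]
  simp only [expect_pure] at key
  refine key.trans (add_le_add (mul_le_mul_right (le_of_eq ?_) _) le_rfl)
  ring

/-- The number of failures before the first success in independent trials with outcome
distribution `μ`, when success is possible. -/
def geometric (μ : PMF Bool) (h : μ true ≠ 0) : PMF ℕ :=
  ⟨fun m => μ false ^ m * μ true, by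
    have h1 : μ true = 1 - μ false :=
      ENNReal.eq_sub_of_add_eq (μ.apply_ne_top _) (bool_add μ)
    have h2 : ∑' m : ℕ, μ false ^ m * μ true = 1 := by
      rw [ENNReal.tsum_mul_right, ENNReal.tsum_geometric, ← h1]
      exact ENNReal.inv_mul_cancel h (μ.apply_ne_top _)
    exact h2 ▸ ENNReal.summable.hasSum⟩

open Classical in
/-- The number of failures before the first success in independent trials with outcome
distribution `μ`; constantly `0` if success is impossible. -/
def failures (μ : PMF Bool) : PMF ℕ :=
  if h : μ true ≠ 0 then geometric μ h else PMF.pure 0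

lemma failures_apply {μ : PMF Bool} (h : μ true ≠ 0) (m : ℕ) :
    failures μ m = μ false ^ m * μ true := by
  unfold failures
  rw [dif_pos h]
  rfl

lemma expect_failures_unfold {μ : PMF Bool} (h : μ true ≠ 0) (U : ℕ → ℝ≥0∞) :
    expect (failures μ) U = μ true * U 0 + μ false * expect (failures μ) fun m => U (m + 1) := by
  unfold expect
  rw [tsum_eq_zero_add' ENNReal.summable, ← ENNReal.tsum_mul_left]
  congr 1
  · simp [failures_apply h]
  · refine tsum_congr fun m => ?_
    rw [failures_apply h, failures_apply h, pow_succ]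
    ring

/-- Repeating a trial until it succeeds, and counting the failures. -/
lemma RComp.failures {f : α → PMF Bool} {T : α → ℝ≥0∞} (hf : RComp f T) :
    RComp (fun a => failures (f a)) fun a => (T a + 12) / f a true + 8 := by
  intro b
  obtain ⟨p, hp⟩ := hf (b + 3)
  set body : Cmd := Cmd.seq (Cmd.copy (b + 3) b) (Cmd.seq p (Cmd.ite (b + 3) (Cmd.clear (b + 2))
    (Cmd.cons (b + 1) (b + 3) (b + 1)))) with hbody
  refine ⟨Cmd.seq (Cmd.clear (b + 1)) (Cmd.seq (Cmd.cons (b + 2) (b + 1) (b + 1))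
    (Cmd.seq (Cmd.loop (b + 2) body) (Cmd.copy b (b + 1)))), fun w Θ t K s a U hs hU => ?_⟩
  set p₁ := f a true with hp₁
  set p₀ := f a false with hp₀
  have hsum : p₁ + p₀ = 1 := bool_add (f a)
  have hdone : ∀ (t' : ℕ), t' ≤ t → ∀ (m : ℕ) (S : Store),
      S (b + 1) = enc m → S (b + 2) = Val.nil → (∀ i < b, S i = s i) →
      val w Θ t' (Cmd.loop (b + 2) body :: Cmd.copy b (b + 1) :: K, S) ≤ w * (0 + 1 + 1) + U m := by
    intro t' ht m S h1 h2 hlow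
    refine add_step_le (val_loop_nil _ _ _ _ h2) (add_step_le (val_copy _ _ _ _ _) ?_)
    rw [mul_zero, zero_add]
    refine (val_mono ht _).trans (hU m _ (by simp [h1]) fun i hi => ?_)
    rw [Function.update_of_ne (by omega), hlow i hi]
  -- `Q` bounds the remaining cost and `W m` the remaining payoff when `m` failures have been
  -- counted. Only their one-step inequalities matter, so the same loop analysis serves for possible
  -- and for impossible success. Induction on the truncation time replaces a bound on the number of
  -- passes, which does not exist.
  have loopB : ∀ (Q : ℝ≥0∞) (W : ℕ → ℝ≥0∞),
      (∀ m, W m = p₁ * U m + p₀ * W (m + 1)) → (w * (T a + 10) + p₀ * Q ≤ Q) →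
      ∀ (t' : ℕ), t' ≤ t → ∀ (m : ℕ) (S : Store), S b = enc a →
      S (b + 1) = enc m → S (b + 2) ≠ Val.nil → (∀ i < b, S i = s i) →
      val w Θ t' (Cmd.loop (b + 2) body :: Cmd.copy b (b + 1) :: K, S) ≤ Q + W m := by
    intro Q W hW hQ t'
    induction t' with
    | zero => intros; simp
    | succ t' ih =>
      intro ht m S hb h1 h2 hlow
      rw [val_succ_loop_cons _ _ _ _ h2]
      have key : val w Θ t' (body :: Cmd.loop (b + 2) body :: Cmd.copy b (b + 1) :: K, S) ≤
          w * (T a + 1 + 1 + 1) + expect (f a) (fun x =>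
            if x then w * (0 + 1 + 1 + 1 + 1) + U m else w + (w + (Q + W (m + 1)))) := by
        rw [hbody]
        refine add_step_le (val_seq _ _ _ _ _) (add_step_le (val_copy _ _ _ _ _)
          (add_step_le (val_seq _ _ _ _ _) ?_))
        refine hp w Θ t' _ _ a _ (by simp [hb]) ?_
        intro x S' hS' hlow'
        have hlow'' : ∀ i < b + 3, S' i = S i := fun i hi => by
          rw [hlow' i hi, Function.update_of_ne (by omega)]
        cases x with
        | true =>
          refine add_step_le (val_ite_cons _ _ _ _ _ (by rw [hS', enc_true]; simp))
            (add_step_le (val_clear _ _ _ _) ?_)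
          refine hdone t' (by omega) m _ ?_ (by simp) ?_
          · simp [hlow'' (b + 1) (by omega), h1]
          · intro i hi
            rw [Function.update_of_ne (by omega), hlow'' i (by omega), hlow i hi]
        | false =>
          refine (val_ite_nil _ _ _ _ _ (by rw [hS', enc_false])).trans (add_le_add le_rfl ?_)
          -- After a failure register `b + 3` holds the code `nil` of `false`, so consing it onto
          -- the counter is the unary successor.
          refine (val_consCmd _ _ _ _ _ _).trans (add_le_add le_rfl ?_)
          refine ih (by omega) (m + 1) _ ?_ ?_ ?_ ?_
          · simp [hlow'' b (by omega), hb]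
          · simp [hlow'' (b + 1) (by omega), h1, hS', enc_nat_succ, enc_false]
          · simpa [hlow'' (b + 2) (by omega)] using h2
          · intro i hi
            rw [Function.update_of_ne (by omega), hlow'' i (by omega), hlow i hi]
      rw [expect_bool] at key
      simp only [if_true, Bool.false_eq_true, if_false] at key
      calc _ ≤ w + (w * (T a + 1 + 1 + 1) + (p₁ * (w * (0 + 1 + 1 + 1 + 1) + U m) +
              p₀ * (w + (w + (Q + W (m + 1)))))) := add_le_add le_rfl key
        _ ≤ w + (w * (T a + 1 + 1 + 1) + (p₁ * (w * (0 + 1 + 1 + 1 + 1) + U m) +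
              p₀ * (w * 4 + (Q + W (m + 1))))) := by
            refine add_le_add le_rfl (add_le_add le_rfl (add_le_add le_rfl
              (mul_le_mul_right ?_ _)))
            calc w + (w + (Q + W (m + 1))) = w * 2 + (Q + W (m + 1)) := by ring
              _ ≤ w * 4 + (Q + W (m + 1)) := by gcongr; norm_num
        _ = (w * (T a + 4 + 4 * (p₁ + p₀)) + p₀ * Q) + (p₁ * U m + p₀ * W (m + 1)) := by ring
        _ = (w * (T a + 8) + p₀ * Q) + W m := by rw [hsum, ← hW]; ring
        _ ≤ (w * (T a + 10) + p₀ * Q) + W m := by gcongr; norm_num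
        _ ≤ Q + W m := by gcongr
  have start : ∀ B : ℝ≥0∞, (∀ S : Store, S b = enc a → S (b + 1) = enc 0 →
      S (b + 2) ≠ Val.nil → (∀ i < b, S i = s i) →
      val w Θ t (Cmd.loop (b + 2) body :: Cmd.copy b (b + 1) :: K, S) ≤ B) →
      val w Θ t (Cmd.seq (Cmd.clear (b + 1)) (Cmd.seq (Cmd.cons (b + 2) (b + 1) (b + 1))
        (Cmd.seq (Cmd.loop (b + 2) body) (Cmd.copy b (b + 1)))) :: K, s) ≤
        w * (0 + 1 + 1 + 1 + 1 + 1) + B := by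
    intro B hB
    refine add_step_le (val_seq _ _ _ _ _) (add_step_le (val_clear _ _ _ _)
      (add_step_le (val_seq _ _ _ _ _) (add_step_le (val_consCmd _ _ _ _ _ _)
      (add_step_le (val_seq _ _ _ _ _) ?_))))
    rw [mul_zero, zero_add]
    refine hB _ ?_ ?_ ?_ ?_
    · simp [hs]
    · simp; rfl
    · simp
    · intro i hi
      rw [Function.update_of_ne (by omega), Function.update_of_ne (by omega)]
  -- If success is impossible the loop never ends. For `w ≠ 0` the claimed time is infinite; for `w
  -- = 0` the truncated payoff is `0`, below any claimed value.
  by_cases h0 : p₁ = 0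
  · by_cases hw : w = 0
    · refine (start 0 fun S hb h1 h2 hlow => ?_).trans (by simp [hw])
      have hp0 : p₀ = 1 := by rw [← hsum, h0, zero_add]
      refine (loopB 0 (fun _ => 0) (fun m => ?_) ?_ t le_rfl 0 S hb h1 h2 hlow).trans (by simp)
      · simp [h0]
      · simp [hw]
    · have : (T a + 12) / p₁ = ∞ := by
        rw [h0]; exact ENNReal.div_zero (by simp)
      change _ ≤ w * ((T a + 12) / p₁ + 8) + _
      rw [this]
      simp [hw, ENNReal.mul_top]
  · have hp1top : p₁ ≠ ∞ := (f a).apply_ne_top _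
    have hdiv : (T a + 10) / p₁ = (T a + 10) + p₀ * ((T a + 10) / p₁) := by
      calc (T a + 10) / p₁ = (p₁ + p₀) * ((T a + 10) / p₁) := by rw [hsum, one_mul]
        _ = _ := by rw [add_mul, ENNReal.mul_div_cancel h0 hp1top]
    refine (start _ (loopB (w * ((T a + 10) / p₁))
      (fun m => expect (DkS.failures (f a)) fun j => U (m + j)) (fun m => ?_) ?_ t le_rfl 0)).trans ?_
    · rw [expect_failures_unfold h0]
      simp only [add_zero, add_assoc, add_comm 1]
      rfl
    · refine le_of_eq ?_
      conv_rhs => rw [hdiv]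
      ring
    · simp only [zero_add]
      rw [← add_assoc]
      refine add_le_add ?_ le_rfl
      rw [← mul_add, add_comm]
      gcongr
      · norm_num
      · norm_num

/-- Reading off the behaviour of the program of a randomized function. -/
lemma RComp.exists_program {f : α → PMF Bool} {T : α → ℝ≥0∞} (h : RComp f T) :
    ∃ P : Cmd, ∀ a, expectedTime P (enc a) ≤ T a ∧
      outputProb P (enc a) {Val.ofBool true} ≤ f a true ∧
      (T a ≠ ∞ → f a true ≤ outputProb P (enc a) {Val.ofBool true}) := by
  classical
  obtain ⟨P, hP⟩ := h 0
  have hout : ∀ a (X : Set Val) (U : Bool → ℝ≥0∞), (∀ x, Val.ofBool x ∈ X → 1 ≤ U x) →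
      outputProb P (enc a) X ≤ expect (f a) U := by
    intro a X U hU
    refine outputProb_le fun t => ?_
    have := hP 0 ({s : Store | s 0 ∈ X}.indicator 1) t []
      (Function.update (fun _ => Val.nil) 0 (enc a)) a U (by simp) ?_
    · simpa [start] using this
    · intro x s' hs' _
      rw [val_nil]
      by_cases hx : s' 0 ∈ X
      · simpa [hx] using hU x (by rw [hs'] at hx; exact hx)
      · simp [hx]
  refine ⟨P, fun a => ?_⟩
  have htime : expectedTime P (enc a) ≤ T a := by
    refine expectedTime_le fun t => ?_
    have := hP 1 0 t [] (Function.update (fun _ => Val.nil) 0 (enc a)) a (fun _ => 0) (by simp) ?_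
    · simpa [start] using this
    · intro x s' _ _; simp
  refine ⟨htime, ?_, fun hT => ?_⟩
  · refine (hout a {Val.ofBool true} (fun x => if x then 1 else 0) ?_).trans ?_
    · intro x; cases x <;> simp [Val.ofBool]
    · simp [expect_bool]
  -- Finite expected time forces halting. The outputs other than `true` have probability at most `f
  -- a false`, which leaves at least `f a true` for the output `true`.
  · have h1 := one_le_outputProb_add_compl (P := P) (v := enc a) {Val.ofBool true}
      (ne_top_of_le_ne_top hT htime)
    have h2 : outputProb P (enc a) {Val.ofBool true}ᶜ ≤ f a false := by
      refine (hout a _ (fun x => if x then 0 else 1) ?_).trans ?_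
      · intro x; cases x <;> simp [Val.ofBool]
      · simp [expect_bool]
    have h3 : f a true = 1 - f a false :=
      ENNReal.eq_sub_of_add_eq ((f a).apply_ne_top _) (bool_add (f a))
    rw [h3]
    exact tsub_le_iff_right.2 (h1.trans (add_le_add le_rfl h2))

end

end DkS

/-! ### Simulation of a program under a step budget -/

namespace DkS

noncomputable section

open Enc (enc sz one_le_sz)

/-! ### Clocked execution -/

/-- A strict upper bound for the variables of a program. -/
def Cmd.varBound : Cmd → ℕ
  | Cmd.clear x => x + 1
  | Cmd.copy x y => max (x + 1) (y + 1)
  | Cmd.cons x y z => max (x + 1) (max (y + 1) (z + 1))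
  | Cmd.head x y => max (x + 1) (y + 1)
  | Cmd.tail x y => max (x + 1) (y + 1)
  | Cmd.flip x => x + 1
  | Cmd.seq p q => max p.varBound q.varBound
  | Cmd.ite x p q => max (x + 1) (max p.varBound q.varBound)
  | Cmd.loop x p => max (x + 1) p.varBound

/-- Time in which the clocked version of a program terminates when the budget is exhausted. -/
def Cmd.drainTime : Cmd → ℕ
  | Cmd.seq p q => p.drainTime + q.drainTime + 3
  | Cmd.ite _ p q => p.drainTime + q.drainTime + 3
  | Cmd.loop _ p => p.drainTime + 6
  | _ => 2

section clock

variable (β y o : ℕ)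

/-- Decrease the budget. -/
def tick : Cmd := Cmd.tail β β

/-- Execute a command if the budget is not exhausted, and decrease the budget. -/
def guarded (c : Cmd) : Cmd := Cmd.ite β (Cmd.seq (tick β) c) (tick β)

/-- Set the loop variable `y` to `x`, or to `nil` if the budget is exhausted. -/
def setLoopVar (x : ℕ) : Cmd := Cmd.ite β (Cmd.copy y (o + x)) (Cmd.clear y)

/-- The version of a program that uses the variables from `o` on, and stops when the budget in
`β` is exhausted. -/
def clocked : Cmd → Cmd
  | Cmd.clear x => guarded β (Cmd.clear (o + x))
  | Cmd.copy x z => guarded β (Cmd.copy (o + x) (o + z))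
  | Cmd.cons x z z' => guarded β (Cmd.cons (o + x) (o + z) (o + z'))
  | Cmd.head x z => guarded β (Cmd.head (o + x) (o + z))
  | Cmd.tail x z => guarded β (Cmd.tail (o + x) (o + z))
  | Cmd.flip x => guarded β (Cmd.flip (o + x))
  | Cmd.seq p q => Cmd.seq (tick β) (Cmd.seq (clocked p) (clocked q))
  | Cmd.ite x p q => Cmd.seq (tick β) (Cmd.ite (o + x) (clocked p) (clocked q))
  | Cmd.loop x p => Cmd.seq (setLoopVar β y o x)
      (Cmd.seq (Cmd.loop y (Cmd.seq (tick β) (Cmd.seq (clocked p) (setLoopVar β y o x)))) (tick β))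

/-- Stacks of the clocked execution that correspond to a stack of the original one. -/
inductive Represents (K₀ : List Cmd) : List Cmd → List Cmd → Prop
  | nil : Represents K₀ [] K₀
  | cons {K A : List Cmd} (c : Cmd) (h : Represents K₀ K A) :
      Represents K₀ (c :: K) (clocked β y o c :: A)
  | loop {K A : List Cmd} (x : ℕ) (p : Cmd) (h : Represents K₀ K A) :
      Represents K₀ (Cmd.loop x p :: K) (setLoopVar β y o x ::
        Cmd.loop y (Cmd.seq (tick β) (Cmd.seq (clocked β y o p) (setLoopVar β y o x))) ::
        tick β :: A)

/-- Total drain time of a stack. -/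
def stackDrainTime (K : List Cmd) : ℕ := (K.map Cmd.drainTime).sum

variable {β y o} {w : ℝ≥0∞} {Θ : Store → ℝ≥0∞} {t : ℕ} {K₀ : List Cmd} {s₀ : Store}

lemma tick_drain {K : List Cmd} {S : Store} {X : ℝ≥0∞} (hS : S β = Val.nil)
    (hl : ∀ i < β, S i = s₀ i)
    (h : ∀ S', S' β = Val.nil → (∀ i < β, S' i = s₀ i) → val w Θ t (K, S') ≤ X) :
    val w Θ t (tick β :: K, S) ≤ w * 1 + X := by
  rw [mul_one]
  refine (val_tail _ _ _ _ _).trans (add_le_add le_rfl (h _ ?_ ?_))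
  · simp [hS, Val.tail]
  · intro i hi; rw [Function.update_of_ne (by omega), hl i hi]

lemma setLoopVar_drain (hy : β < y) {K : List Cmd} {S : Store} {X : ℝ≥0∞} {x : ℕ}
    (hS : S β = Val.nil) (hl : ∀ i < β, S i = s₀ i)
    (h : ∀ S', S' β = Val.nil → S' y = Val.nil → (∀ i < β, S' i = s₀ i) →
      val w Θ t (K, S') ≤ X) :
    val w Θ t (setLoopVar β y o x :: K, S) ≤ w * 2 + X := by
  refine (add_step_le (n := 0 + 1) (B := X) (val_ite_nil _ _ _ _ _ hS)
    (add_step_le (val_clear _ _ _ _) ?_)).trans (le_of_eq (by ring))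
  rw [mul_zero, zero_add]
  refine h _ ?_ (by simp) ?_
  · rw [Function.update_of_ne (by omega), hS]
  · intro i hi; rw [Function.update_of_ne (by omega), hl i hi]

lemma guarded_drain {c : Cmd} {K : List Cmd} {S : Store} {X : ℝ≥0∞} (hS : S β = Val.nil)
    (hl : ∀ i < β, S i = s₀ i)
    (h : ∀ S', S' β = Val.nil → (∀ i < β, S' i = s₀ i) → val w Θ t (K, S') ≤ X) :
    val w Θ t (guarded β c :: K, S) ≤ w * (2 : ℕ) + X := by
  refine (add_step_le (val_ite_nil _ _ _ _ _ hS) (tick_drain hS hl h)).trans (le_of_eq ?_)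
  push_cast; ring

/-- With an empty budget a guarded command does nothing but tick, and `setLoopVar` clears the loop
variable so that every loop exits at once. The remaining time is therefore a structural constant,
independent of the data. -/
lemma clocked_drain (hy : β < y) (c : Cmd) {K : List Cmd} {S : Store} {X : ℝ≥0∞}
    (hS : S β = Val.nil) (hl : ∀ i < β, S i = s₀ i)
    (h : ∀ S', S' β = Val.nil → (∀ i < β, S' i = s₀ i) → val w Θ t (K, S') ≤ X) :
    val w Θ t (clocked β y o c :: K, S) ≤ w * c.drainTime + X := by
  induction c generalizing K S X with
  | clear | copy | cons | head | tail | flip => exact guarded_drain hS hl h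
  | seq p q ihp ihq =>
    have := add_step_le (val_seq (w := w) (Θ := Θ) t _ _ _ _)
      (tick_drain (X := w * (p.drainTime + q.drainTime + 1) + X)
      (K := Cmd.seq (clocked β y o p) (clocked β y o q) :: K) hS hl ?_)
    · refine this.trans (le_of_eq ?_)
      simp only [Cmd.drainTime]; push_cast; ring
    · intro S1 h1 h1'
      refine add_step_le (val_seq _ _ _ _ _) ?_
      exact (ihp (X := w * q.drainTime + X) h1 h1' fun S2 h2 h2' => ihq h2 h2' h).trans
        (le_of_eq (by ring))
  | ite x p q ihp ihq =>
    have := add_step_le (val_seq (w := w) (Θ := Θ) t _ _ _ _)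
      (tick_drain (X := w * (p.drainTime + q.drainTime + 1) + X)
      (K := Cmd.ite (o + x) (clocked β y o p) (clocked β y o q) :: K) hS hl ?_)
    · refine this.trans (le_of_eq ?_)
      simp only [Cmd.drainTime]; push_cast; ring
    · intro S1 h1 h1'
      by_cases hx : S1 (o + x) = Val.nil
      · refine add_step_le (val_ite_nil _ _ _ _ _ hx) ((ihq h1 h1' h).trans ?_)
        gcongr; exact le_add_self
      · refine add_step_le (val_ite_cons _ _ _ _ _ hx) ((ihp h1 h1' h).trans ?_)
        gcongr; exact le_self_add
  | loop x p ihp =>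
    have := add_step_le (val_seq (w := w) (Θ := Θ) t _ _ _ _)
      (setLoopVar_drain (o := o) (x := x) hy (X := w * 3 + X)
      (K := Cmd.seq (Cmd.loop y (Cmd.seq (tick β) (Cmd.seq (clocked β y o p)
        (setLoopVar β y o x)))) (tick β) :: K) hS hl ?_)
    · refine this.trans ?_
      simp only [Cmd.drainTime]; push_cast
      calc w * (2 + 1) + (w * 3 + X) = w * 6 + X := by ring
        _ ≤ _ := by gcongr; exact le_add_self
    · intro S1 h1 hy1 h1'
      refine (add_step_le (val_seq _ _ _ _ _) (add_step_le (val_loop_nil _ _ _ _ hy1)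
        (tick_drain h1 h1' h))).trans (le_of_eq (by ring))

lemma represents_drain (hy : β < y) {K A : List Cmd} (hA : Represents β y o K₀ K A) {S : Store}
    {X : ℝ≥0∞} (hS : S β = Val.nil) (hl : ∀ i < β, S i = s₀ i)
    (h : ∀ S', S' β = Val.nil → (∀ i < β, S' i = s₀ i) → val w Θ t (K₀, S') ≤ X) :
    val w Θ t (A, S) ≤ w * stackDrainTime K + X := by
  induction hA generalizing S with
  | nil => simpa [stackDrainTime] using h S hS hl
  | cons c hA ih =>
    refine (clocked_drain hy c hS hl fun S' h1 h2 => ih h1 h2).trans (le_of_eq ?_)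
    simp only [stackDrainTime, List.map_cons, List.sum_cons]; push_cast; ring
  | loop x p hA ih =>
    refine (setLoopVar_drain hy hS hl fun S1 h1 hy1 h1' =>
      add_step_le (val_loop_nil _ _ _ _ hy1)
        (tick_drain h1 h1' fun S' h2 h2' => ih h2 h2')).trans ?_
    simp only [stackDrainTime, List.map_cons, List.sum_cons, Cmd.drainTime]
    have aux : ∀ n d : ℕ, w * 2 + (w * (1 + 1) + (w * n + X)) ≤ w * ((d + 6 + n : ℕ)) + X := by
      intro n d
      calc w * 2 + (w * (1 + 1) + (w * n + X)) = w * ((4 + n : ℕ)) + X := by push_cast; ring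
        _ ≤ _ := by gcongr; omega
    exact aux _ _

/-- The registers from `o` on hold the variables of the original program. -/
def Matches (o m : ℕ) (σ S : Store) : Prop := ∀ i < m, S (o + i) = σ i

lemma Matches.update {m : ℕ} {σ S : Store} (h : Matches o m σ S) (x : ℕ) (v : Val) :
    Matches o m (Function.update σ x v) (Function.update S (o + x) v) := by
  intro i hi
  by_cases hx : i = x
  · subst hx; simp
  · rw [Function.update_of_ne hx, Function.update_of_ne (by omega), h i hi]

lemma Matches.update_low {m r : ℕ} {σ S : Store} (h : Matches o m σ S) (hr : r < o) (v : Val) :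
    Matches o m σ (Function.update S r v) := by
  intro i hi
  rw [Function.update_of_ne (by omega), h i hi]

/-- All commands of the stack use variables below `m` and have drain time at most `D`. -/
def StackBound (m D : ℕ) (K : List Cmd) : Prop :=
  ∀ c ∈ K, c.varBound ≤ m ∧ c.drainTime ≤ D

lemma guarded_step {B : ℕ} {c : Cmd} {K : List Cmd} {S : Store} {X : ℝ≥0∞}
    (hS : S β = enc (B + 1))
    (h : val w Θ t (c :: K, Function.update S β (enc B)) ≤ X) :
    val w Θ t (guarded β c :: K, S) ≤ w * 3 + X := by
  refine (add_step_le (n := 0 + 1 + 1) (B := X) (val_ite_cons _ _ _ _ _ (by rw [hS]; simp [enc_nat_succ]))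
    (add_step_le (val_seq _ _ _ _ _) (add_step_le (val_tail _ _ _ _ _) ?_))).trans
    (le_of_eq (by ring))
  rw [mul_zero, zero_add]
  simpa [hS, enc_nat_succ, Val.tail] using h

/-- The clocked execution simulates one step. -/
lemma clocked_step (hβ : β < y) (hy : y < o) {m D B : ℕ} {c : Cmd} {K A : List Cmd} {σ S : Store}
    (hA : Represents β y o K₀ (c :: K) A) (hK : StackBound m D (c :: K)) (hσ : Matches o m σ S)
    (hS : S β = enc (B + 1)) (hl : ∀ i < β, S i = s₀ i) {W : Config → ℝ≥0∞}
    (h : ∀ K' σ' A' S', Represents β y o K₀ K' A' → StackBound m D K' → Matches o m σ' S' →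
      S' β = enc B → (∀ i < β, S' i = s₀ i) →
      stackDrainTime K' ≤ stackDrainTime (c :: K) + D → val w Θ t (A', S') ≤ W (K', σ')) :
    val w Θ t (A, S) ≤ w * 8 + expect (step (c :: K, σ)) W := by
  have hK' : StackBound m D K := fun c' hc' => hK c' (List.mem_cons_of_mem _ hc')
  obtain ⟨hvb, hdr⟩ := hK c List.mem_cons_self
  have hpot : stackDrainTime K ≤ stackDrainTime (c :: K) + D := by
    simp only [stackDrainTime, List.map_cons, List.sum_cons]; omega
  have hβ1 : ∀ r, o ≤ r → ∀ v, Function.update (Function.update S β (enc B)) r v β = enc B := by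
    intro r hr v
    rw [Function.update_of_ne (by omega)]; simp
  have hl1 : ∀ r, o ≤ r → ∀ v, ∀ i < β,
      Function.update (Function.update S β (enc B)) r v i = s₀ i := by
    intro r hr v i hi
    rw [Function.update_of_ne (by omega), Function.update_of_ne (by omega), hl i hi]
  have hσ1 : Matches o m σ (Function.update S β (enc B)) := hσ.update_low (by omega) _
  have hw : ∀ n : ℝ≥0∞, n ≤ 8 → ∀ X, w * n + X ≤ w * 8 + X := by
    intro n hn X; gcongr
  have hget : ∀ i, i + 1 ≤ m → Function.update S β (enc B) (o + i) = σ i := fun i hi => hσ1 i hi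
  have atom : ∀ (A₁ : List Cmd) (x : ℕ) (v : Val) (c' : Cmd), Represents β y o K₀ K A₁ →
      (val w Θ t (c' :: A₁, Function.update S β (enc B)) ≤
        w + val w Θ t (A₁, Function.update (Function.update S β (enc B)) (o + x) v)) →
      val w Θ t (guarded β c' :: A₁, S) ≤ w * 8 + W (K, Function.update σ x v) := by
    intro A₁ x v c' hA₁ h1
    refine (guarded_step hS (h1.trans (add_le_add le_rfl (h K _ _ _ hA₁ hK' (hσ1.update x v)
      (hβ1 _ (by omega) _) (hl1 _ (by omega) _) hpot)))).trans ?_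
    calc w * 3 + (w + W (K, Function.update σ x v))
        = w * 4 + W (K, Function.update σ x v) := by ring
      _ ≤ _ := hw 4 (by norm_num) _
  -- A loop occurs on the stack either untouched or between two passes. Once the loop variable `y`
  -- has been refreshed both forms agree, and this common situation is treated here. One unit of
  -- budget is spent per loop test: inside the pass if there is one, and after the loop otherwise.
  have hloop : ∀ (A₁ : List Cmd) (x : ℕ) (p : Cmd), Represents β y o K₀ K A₁ → c = Cmd.loop x p →
      ∀ S₁ : Store, S₁ y = σ x → S₁ β = enc (B + 1) → Matches o m σ S₁ →
      (∀ i < β, S₁ i = s₀ i) →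
      val w Θ t (Cmd.loop y (Cmd.seq (tick β) (Cmd.seq (clocked β y o p) (setLoopVar β y o x))) ::
        tick β :: A₁, S₁) ≤ w * 4 + expect (step (c :: K, σ)) W := by
    intro A₁ x p hA₁ hc S₁ hy1 hβ1 hm1 hl1
    subst hc
    have htail : ∀ i < β, Function.update S₁ β (S₁ β).tail i = s₀ i := fun i hi => by
      rw [Function.update_of_ne (by omega), hl1 i hi]
    have hv : Function.update S₁ β (S₁ β).tail β = enc B := by
      simp [hβ1, enc_nat_succ, Val.tail]
    have hm2 : Matches o m σ (Function.update S₁ β (S₁ β).tail) := hm1.update_low (by omega) _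
    cases hx : σ x with
    | nil =>
      have : step (Cmd.loop x p :: K, σ) = PMF.pure (K, σ) := by simp [step, hx]
      rw [this, expect_pure]
      refine (add_step_le (n := 0 + 1) (B := W (K, σ)) (val_loop_nil _ _ _ _ (hy1.trans hx))
        (add_step_le (val_tail _ _ _ _ _) ?_)).trans ?_
      · rw [mul_zero, zero_add]
        exact h K σ A₁ _ hA₁ hK' hm2 hv htail hpot
      · gcongr; norm_num
    | cons u v =>
      have : step (Cmd.loop x p :: K, σ) = PMF.pure (p :: Cmd.loop x p :: K, σ) := by
        simp [step, hx]
      rw [this, expect_pure]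
      simp only [Cmd.varBound, Cmd.drainTime, max_le_iff] at hvb hdr
      refine (add_step_le (n := 0 + 1 + 1 + 1) (B := W (p :: Cmd.loop x p :: K, σ)) (val_loop_cons _ _ _ _ (by rw [hy1, hx]; simp))
        (add_step_le (val_seq _ _ _ _ _) (add_step_le (val_tail _ _ _ _ _)
        (add_step_le (val_seq _ _ _ _ _) ?_)))).trans (le_of_eq (by ring))
      rw [mul_zero, zero_add]
      refine h _ σ _ _ (Represents.cons p (Represents.loop x p hA₁)) ?_ hm2 hv htail ?_
      · intro c' hc'
        rcases List.mem_cons.1 hc' with rfl | hc'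
        · exact ⟨hvb.2, by omega⟩
        · exact hK c' hc'
      · simp only [stackDrainTime, List.map_cons, List.sum_cons, Cmd.drainTime]; omega
  have hset : ∀ (A₁ : List Cmd) (x : ℕ) (X : ℝ≥0∞), x + 1 ≤ m →
      (∀ S₁ : Store, S₁ y = σ x → S₁ β = enc (B + 1) → Matches o m σ S₁ →
      (∀ i < β, S₁ i = s₀ i) → val w Θ t (A₁, S₁) ≤ X) →
      val w Θ t (setLoopVar β y o x :: A₁, S) ≤ w * 2 + X := by
    intro A₁ x X hxm hX
    refine (add_step_le (n := 0 + 1) (B := X)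
      (val_ite_cons _ _ _ _ _ (by rw [hS]; simp [enc_nat_succ]))
      (add_step_le (val_copy _ _ _ _ _) ?_)).trans (le_of_eq (by ring))
    rw [mul_zero, zero_add]
    refine hX _ ?_ ?_ (hσ.update_low (by omega) _) ?_
    · simp [hσ x hxm]
    · rw [Function.update_of_ne (by omega), hS]
    · intro i hi; rw [Function.update_of_ne (by omega), hl i hi]
  have htick : ∀ (A₁ : List Cmd) (X : ℝ≥0∞),
      val w Θ t (A₁, Function.update S β (enc B)) ≤ X → val w Θ t (tick β :: A₁, S) ≤ w + X := by
    intro A₁ X hX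
    refine (val_tail _ _ _ _ _).trans (add_le_add le_rfl ?_)
    simpa [hS, enc_nat_succ, Val.tail] using hX
  have hβ0 : Function.update S β (enc B) β = enc B := by simp
  have hl0 : ∀ i < β, Function.update S β (enc B) i = s₀ i := fun i hi => by
    rw [Function.update_of_ne (by omega), hl i hi]
  cases hA with
  | loop x p hA =>
    have hx : x + 1 ≤ m := by simp only [Cmd.varBound, max_le_iff] at hvb; exact hvb.1
    refine (hset _ x _ hx (hloop _ x p hA rfl)).trans ?_
    calc w * 2 + (w * 4 + expect (step (Cmd.loop x p :: K, σ)) W)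
        = w * 6 + expect (step (Cmd.loop x p :: K, σ)) W := by ring
      _ ≤ _ := hw 6 (by norm_num) _
  | cons c hA =>
    cases c with
    | clear x =>
      simp only [step, expect_pure]
      exact atom _ x Val.nil _ hA (val_clear _ _ _ _)
    | copy x z =>
      simp only [step, expect_pure]
      simp only [Cmd.varBound, max_le_iff] at hvb
      refine atom _ x _ _ hA ((val_copy _ _ _ _ _).trans (le_of_eq ?_))
      rw [hget z (by omega)]
    | cons x z z' =>
      simp only [step, expect_pure]
      simp only [Cmd.varBound, max_le_iff] at hvb
      refine atom _ x _ _ hA ((val_consCmd _ _ _ _ _ _).trans (le_of_eq ?_))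
      rw [hget z (by omega), hget z' (by omega)]
    | head x z =>
      simp only [step, expect_pure]
      simp only [Cmd.varBound, max_le_iff] at hvb
      refine atom _ x _ _ hA ((val_head _ _ _ _ _).trans (le_of_eq ?_))
      rw [hget z (by omega)]
    | tail x z =>
      simp only [step, expect_pure]
      simp only [Cmd.varBound, max_le_iff] at hvb
      refine atom _ x _ _ hA ((val_tail _ _ _ _ _).trans (le_of_eq ?_))
      rw [hget z (by omega)]
    | flip x =>
      simp only [step, expect_map]
      refine (guarded_step (X := w + expect (PMF.uniformOfFintype Bool) fun b =>
        W (K, Function.update σ x (Val.ofBool b))) hS ((val_flip _ _ _ _).trans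
        (add_le_add le_rfl (expect_mono fun b => h K _ _ _ hA hK' (hσ1.update x _)
          (hβ1 _ (by omega) _) (hl1 _ (by omega) _) hpot)))).trans ?_
      calc w * 3 + (w + expect (PMF.uniformOfFintype Bool) fun b =>
            W (K, Function.update σ x (Val.ofBool b)))
          = w * 4 + expect (PMF.uniformOfFintype Bool) fun b =>
            W (K, Function.update σ x (Val.ofBool b)) := by ring
        _ ≤ _ := hw 4 (by norm_num) _
    | seq p q =>
      simp only [step, expect_pure]
      simp only [Cmd.varBound, max_le_iff, Cmd.drainTime] at hvb hdr
      refine ((val_seq _ _ _ _ _).trans (add_le_add le_rfl (htick _ _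
        ((val_seq _ _ _ _ _).trans (add_le_add le_rfl (h _ σ _ _
          (Represents.cons p (Represents.cons q hA)) ?_ hσ1 hβ0 hl0 ?_)))))).trans ?_
      · intro c' hc'
        simp only [List.mem_cons] at hc'
        rcases hc' with rfl | rfl | hc'
        · exact ⟨hvb.1, by omega⟩
        · exact ⟨hvb.2, by omega⟩
        · exact hK' c' hc'
      · simp only [stackDrainTime, List.map_cons, List.sum_cons, Cmd.drainTime]; omega
      · calc w + (w + (w + W (p :: q :: K, σ))) = w * 3 + W (p :: q :: K, σ) := by ring
          _ ≤ _ := hw 3 (by norm_num) _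
    | ite x p q =>
      simp only [Cmd.varBound, max_le_iff, Cmd.drainTime] at hvb hdr
      have hx1 := hget x hvb.1
      have fin : ∀ X : ℝ≥0∞, w + (w + (w + X)) ≤ w * 8 + X := fun X => by
        calc w + (w + (w + X)) = w * 3 + X := by ring
          _ ≤ _ := hw 3 (by norm_num) _
      cases hx : σ x with
      | nil =>
        have : step (Cmd.ite x p q :: K, σ) = PMF.pure (q :: K, σ) := by simp [step, hx]
        rw [this, expect_pure]
        refine ((val_seq _ _ _ _ _).trans (add_le_add le_rfl (htick _ _
          ((val_ite_nil _ _ _ _ _ (hx1.trans hx)).trans (add_le_add le_rfl (h _ σ _ _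
            (Represents.cons q hA) ?_ hσ1 hβ0 hl0 ?_)))))).trans (fin _)
        · intro c' hc'
          rcases List.mem_cons.1 hc' with rfl | hc'
          · exact ⟨hvb.2.2, by omega⟩
          · exact hK' c' hc'
        · simp only [stackDrainTime, List.map_cons, List.sum_cons, Cmd.drainTime]; omega
      | cons u v =>
        have : step (Cmd.ite x p q :: K, σ) = PMF.pure (p :: K, σ) := by simp [step, hx]
        rw [this, expect_pure]
        refine ((val_seq _ _ _ _ _).trans (add_le_add le_rfl (htick _ _
          ((val_ite_cons _ _ _ _ _ (by rw [hx1, hx]; simp)).trans (add_le_add le_rfl (h _ σ _ _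
            (Represents.cons p hA) ?_ hσ1 hβ0 hl0 ?_)))))).trans (fin _)
        · intro c' hc'
          rcases List.mem_cons.1 hc' with rfl | hc'
          · exact ⟨hvb.2.1, by omega⟩
          · exact hK' c' hc'
        · simp only [stackDrainTime, List.map_cons, List.sum_cons, Cmd.drainTime]; omega
    | loop x p =>
      have hx : x + 1 ≤ m := by simp only [Cmd.varBound, max_le_iff] at hvb; exact hvb.1
      refine ((val_seq _ _ _ _ _).trans (add_le_add le_rfl (hset _ x _ hx
        fun S₁ h1 h2 h3 h4 => (val_seq _ _ _ _ _).trans (add_le_add le_rfl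
          (hloop _ x p hA rfl S₁ h1 h2 h3 h4))))).trans (le_of_eq (by ring))

/-- The clocked execution with budget `B + 1` simulates `B` steps. -/
lemma clocked_run (hβ : β < y) (hy : y < o) {m D B : ℕ} {K A : List Cmd} {σ S : Store}
    (hA : Represents β y o K₀ K A) (hK : StackBound m D K) (hσ : Matches o m σ S)
    (hS : S β = enc (B + 1)) (hl : ∀ i < β, S i = s₀ i) {U : Config → ℝ≥0∞}
    (hU : ∀ c S', (c.1 = [] → S' β ≠ Val.nil ∧ Matches o m c.2 S') → (c.1 ≠ [] → S' β = Val.nil) →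
      (∀ i < β, S' i = s₀ i) → val w Θ t (K₀, S') ≤ U c) :
    val w Θ t (A, S) ≤ w * (((D + 8) * (B + 1) + stackDrainTime K : ℕ) : ℝ≥0∞) +
      expect (run B (K, σ)) U := by
  induction B generalizing K A σ S with
  | zero =>
    cases K with
    | nil =>
      cases hA
      simp only [run, expect_pure]
      refine le_add_left (hU _ _ (fun _ => ⟨by rw [hS]; simp [enc_nat_succ], hσ⟩) ?_ hl)
      simp
    | cons c K =>
      -- Commands are left but only one unit of budget: the next simulated step uses it up and the
      -- rest drains. This is why an empty budget at the end means exactly that the program had not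
      -- halted.
      refine (clocked_step hβ hy hA hK hσ hS hl
        (W := fun _ => w * ((stackDrainTime (c :: K) + D : ℕ) : ℝ≥0∞) + U (c :: K, σ)) ?_).trans ?_
      · intro K' σ' A' S' hA' _ _ hS' hl' hpot
        refine (represents_drain hβ hA' hS' hl' (X := U (c :: K, σ)) ?_).trans ?_
        · intro S'' h1 h2
          exact hU _ _ (by simp) (fun _ => h1) h2
        · gcongr
      · simp only [run, expect_pure, expect_const]
        refine le_of_eq ?_
        push_cast; ring
  | succ B ih =>
    cases K with
    | nil =>
      cases hA
      simp only [run_nil, expect_pure]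
      refine le_add_left (hU _ _ (fun _ => ⟨by rw [hS]; simp [enc_nat_succ], hσ⟩) ?_ hl)
      simp
    | cons c K =>
      refine (clocked_step hβ hy hA hK hσ hS hl
        (W := fun c' => w * (((D + 8) * (B + 1) + (stackDrainTime (c :: K) + D) : ℕ) : ℝ≥0∞) +
          expect (run B c') U) ?_).trans ?_
      · intro K' σ' A' S' hA' hK' hσ' hS' hl' hpot
        refine (ih hA' hK' hσ' hS' hl').trans ?_
        gcongr
      · simp only [run, expect_bind, expect_add, expect_const]
        refine le_of_eq ?_
        push_cast; ring

end clock

/-- Clear `m` registers from `o` on. -/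
def clearFrom (o : ℕ) : ℕ → Cmd
  | 0 => Cmd.copy o o
  | m + 1 => Cmd.seq (clearFrom o m) (Cmd.clear (o + m))

/-- The simulated program expects `nil` in its variables, while `RComp` promises nothing about the
registers above `b`. They have to be cleared first. -/
lemma val_clearFrom {w : ℝ≥0∞} {Θ : Store → ℝ≥0∞} {t : ℕ} {o m : ℕ} {K : List Cmd} {S : Store}
    {X : ℝ≥0∞} (h : ∀ S', Matches o m (fun _ => Val.nil) S' → (∀ i < o, S' i = S i) →
      val w Θ t (K, S') ≤ X) :
    val w Θ t (clearFrom o m :: K, S) ≤ w * (2 * m + 1 : ℕ) + X := by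
  induction m generalizing K S X with
  | zero =>
    refine (val_copy _ _ _ _ _).trans ?_
    simp only [mul_zero, zero_add, Nat.cast_one, mul_one]
    exact add_le_add le_rfl (h _ (fun i hi => by omega) fun i hi => by simp)
  | succ m ih =>
    refine (add_step_le (B := w + X) (val_seq _ _ _ _ _) (ih ?_)).trans (le_of_eq ?_)
    · intro S' h1 h2
      refine (val_clear _ _ _ _).trans (add_le_add le_rfl (h _ ?_ ?_))
      · intro i hi
        by_cases him : i = m
        · subst him; simp
        · rw [Function.update_of_ne (by omega), h1 i (by omega)]
      · intro i hi
        rw [Function.update_of_ne (by omega), h2 i hi]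
    · push_cast; ring

/-- What can be read off after running a program for a bounded time: whether it has halted, and
its output. -/
def readOutput (c : Config) : Bool × Val := if c.1 = [] then (true, c.2 0) else (false, Val.nil)

/-- Running a fixed program for a bounded number of steps. -/
lemma RComp.runFor (P : Cmd) : ∃ C : ℕ,
    RComp (fun a : Val × ℕ => (run a.2 (start P a.1)).map readOutput)
      fun a => ((C * (a.2 + 1) : ℕ) : ℝ≥0∞) := by
  set m := max P.varBound 1 with hm
  set D := P.drainTime with hD
  refine ⟨D + 8 + D + 2 * m + 1 + 20, fun b => ?_⟩
  set β := b + 1 with hβ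
  set y := b + 2 with hy
  set o := b + 3 with ho
  set fin : Cmd := Cmd.ite β (Cmd.seq (Cmd.clear y) (Cmd.seq (Cmd.cons y y y) (Cmd.cons b y o)))
    (Cmd.seq (Cmd.clear y) (Cmd.cons b y y)) with hfin
  -- The `cons` on `β` raises the budget to `B + 1`, so that a program halting in exactly `B` steps
  -- still leaves one unit, which `fin` then recognizes.
  refine ⟨Cmd.seq (clearFrom o m) (Cmd.seq (Cmd.head o b) (Cmd.seq (Cmd.clear y)
    (Cmd.seq (Cmd.tail β b) (Cmd.seq (Cmd.cons β y β) (Cmd.seq (clocked β y o P) fin))))), ?_⟩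
  intro w Θ t K s a U hs hU
  obtain ⟨v, B⟩ := a
  have hend : ∀ c S', (c.1 = [] → S' β ≠ Val.nil ∧ Matches o m c.2 S') →
      (c.1 ≠ [] → S' β = Val.nil) → (∀ i < β, S' i = s i) →
      val w Θ t (fin :: K, S') ≤ w * 6 + U (readOutput c) := by
    intro c S' h1 h2 h3
    by_cases hc : c.1 = []
    · obtain ⟨h4, h5⟩ := h1 hc
      refine (add_step_le (n := 0 + 1 + 1 + 1 + 1 + 1) (B := U (readOutput c))
        (val_ite_cons _ _ _ _ _ h4) (add_step_le (val_seq _ _ _ _ _)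
        (add_step_le (val_clear _ _ _ _) (add_step_le (val_seq _ _ _ _ _)
        (add_step_le (val_consCmd _ _ _ _ _ _) (add_step_le (val_consCmd _ _ _ _ _ _) ?_)))))).trans
        (le_of_eq (by ring))
      rw [mul_zero, zero_add]
      have h6 : S' o = c.2 0 := h5 0 (by omega)
      refine hU _ _ ?_ ?_
      · simp [readOutput, hc, enc_pair, enc_true, enc_val, hy, ho] at h6 ⊢
        exact h6
      · intro i hi
        rw [Function.update_of_ne (by omega), Function.update_of_ne (by omega),
          Function.update_of_ne (by omega), h3 i (by omega)]
    · refine (add_step_le (n := 0 + 1 + 1 + 1) (B := U (readOutput c))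
        (val_ite_nil _ _ _ _ _ (h2 hc)) (add_step_le (val_seq _ _ _ _ _)
        (add_step_le (val_clear _ _ _ _) (add_step_le (val_consCmd _ _ _ _ _ _) ?_)))).trans ?_
      · rw [mul_zero, zero_add]
        refine hU _ _ ?_ ?_
        · simp [readOutput, hc, enc_pair, enc_false, enc_val]
        · intro i hi
          rw [Function.update_of_ne (by omega), Function.update_of_ne (by omega), h3 i (by omega)]
      · gcongr; norm_num
  have key : ∀ S, Matches o m (fun _ => Val.nil) S → (∀ i < o, S i = s i) →
      val w Θ t (Cmd.seq (Cmd.head o b) (Cmd.seq (Cmd.clear y)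
    (Cmd.seq (Cmd.tail β b) (Cmd.seq (Cmd.cons β y β) (Cmd.seq (clocked β y o P) fin)))) :: K, S) ≤
      w * ((((D + 8) * (B + 1) + D : ℕ) : ℝ≥0∞) + 6 + 1 + 1 + 1 + 1 + 1 + 1 + 1 + 1 + 1) +
      expect (run B (start P v)) fun c => U (readOutput c) := by
    intro S hS hlow
    refine add_step_le (val_seq _ _ _ _ _) (add_step_le (val_head _ _ _ _ _)
      (add_step_le (val_seq _ _ _ _ _) (add_step_le (val_clear _ _ _ _)
      (add_step_le (val_seq _ _ _ _ _) (add_step_le (val_tail _ _ _ _ _)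
      (add_step_le (val_seq _ _ _ _ _) (add_step_le (val_consCmd _ _ _ _ _ _)
      (add_step_le (val_seq _ _ _ _ _) ?_))))))))
    refine (clocked_run (β := β) (y := y) (o := o) (K₀ := fin :: K) (s₀ := s) (m := m) (D := D)
      (B := B) (K := [P]) (σ := Function.update (fun _ => Val.nil) 0 v)
      (by omega) (by omega) (Represents.cons P Represents.nil) ?_ ?_ ?_ ?_ hend).trans
      (le_of_eq ?_)
    · intro c hc
      rw [List.mem_singleton] at hc
      subst hc
      exact ⟨le_max_left _ _, le_rfl⟩
    · refine (((Matches.update_low ?_ (by omega) _).update_low (by omega) _).update_low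
        (by omega) _)
      have h0 := hS.update 0 (S b).head
      have : (S b).head = v := by
        rw [hlow b (by omega), hs]; rfl
      rwa [this] at h0 ⊢
    · have : S b = enc (v, B) := by rw [hlow b (by omega), hs]
      simp [this, enc_pair, Val.tail, hβ, hy, ho, enc_nat_succ]
    · intro i hi
      rw [Function.update_of_ne (by omega), Function.update_of_ne (by omega),
        Function.update_of_ne (by omega), Function.update_of_ne (by omega), hlow i (by omega)]
    · rw [expect_add, expect_const]
      simp only [stackDrainTime, List.map_cons, List.map_nil, List.sum_cons, List.sum_nil, start]
      push_cast; ring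
  refine (add_step_le (val_seq _ _ _ _ _) (val_clearFrom key)).trans ?_
  rw [expect_map, ← add_assoc, ← mul_add]
  refine add_le_add (mul_le_mul_right ?_ _) le_rfl
  change _ ≤ (((D + 8 + D + 2 * m + 1 + 20) * (B + 1) : ℕ) : ℝ≥0∞)
  norm_cast
  nlinarith [Nat.zero_le (m * B), Nat.zero_le (D * B)]

end

end DkS

/-! ### Closure properties of randomized polynomial time -/

namespace DkS

noncomputable section

open Enc (enc sz one_le_sz)

variable {α β γ σ : Type} [Enc α] [Enc β] [Enc γ] [Enc σ]

/-! ### Polynomially bounded functions -/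

/-- Bounded by a fixed power of `X`. -/
def PowBdd {ι : Type*} (X u : ι → ℕ) : Prop := ∃ C : ℕ, ∀ i, u i ≤ X i ^ C

namespace PowBdd

variable {ι : Type*} {X u v : ι → ℕ}

lemma mono (hv : PowBdd X v) (h : ∀ a, u a ≤ v a) : PowBdd X u :=
  hv.imp fun _ hC a => (h a).trans (hC a)

lemma self : PowBdd X X := ⟨1, fun a => by simp⟩

lemma const (hX : ∀ i, 2 ≤ X i) (n : ℕ) : PowBdd X fun _ => n :=
  ⟨n, fun a => (Nat.lt_two_pow_self).le.trans (Nat.pow_le_pow_left (hX a) n)⟩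

lemma add (hX : ∀ i, 2 ≤ X i) (hu : PowBdd X u) (hv : PowBdd X v) :
    PowBdd X fun a => u a + v a := by
  obtain ⟨C, hC⟩ := hu
  obtain ⟨D, hD⟩ := hv
  refine ⟨C + D + 1, fun a => ?_⟩
  have h1 := hX a
  have h2 : 1 ≤ X a ^ C := Nat.one_le_pow _ _ (by omega)
  have h3 : 1 ≤ X a ^ D := Nat.one_le_pow _ _ (by omega)
  calc u a + v a ≤ X a ^ C + X a ^ D := add_le_add (hC a) (hD a)
    _ ≤ (X a ^ C * X a ^ D) * 2 := by nlinarith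
    _ ≤ (X a ^ C * X a ^ D) * X a := by gcongr
    _ = _ := by ring

lemma mul (hu : PowBdd X u) (hv : PowBdd X v) : PowBdd X fun a => u a * v a := by
  obtain ⟨C, hC⟩ := hu
  obtain ⟨D, hD⟩ := hv
  exact ⟨C + D, fun a => (Nat.mul_le_mul (hC a) (hD a)).trans (by rw [pow_add])⟩

lemma pow (hu : PowBdd X u) (n : ℕ) : PowBdd X fun a => u a ^ n := by
  obtain ⟨C, hC⟩ := hu
  exact ⟨C * n, fun a => (Nat.pow_le_pow_left (hC a) n).trans (by rw [pow_mul])⟩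

end PowBdd

/-- Bounded by a power of the size plus one. -/
def PolyBdd (u : α → ℕ) : Prop := ∃ C : ℕ, ∀ a, u a ≤ (sz a + 1) ^ C

namespace PolyBdd

lemma two_le (a : α) : 2 ≤ sz a + 1 := by have := one_le_sz a; omega

lemma mono {u v : α → ℕ} (hv : PolyBdd v) (h : ∀ a, u a ≤ v a) : PolyBdd u := PowBdd.mono (X := fun a : α => sz a + 1) hv h

lemma const (n : ℕ) : PolyBdd fun _ : α => n := PowBdd.const (X := fun a : α => sz a + 1) two_le n

lemma size : PolyBdd fun a : α => sz a := (PowBdd.self (X := fun a : α => sz a + 1)).mono fun _ => Nat.le_succ _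

lemma add {u v : α → ℕ} (hu : PolyBdd u) (hv : PolyBdd v) : PolyBdd fun a => u a + v a :=
  PowBdd.add (X := fun a : α => sz a + 1) two_le hu hv

lemma mul {u v : α → ℕ} (hu : PolyBdd u) (hv : PolyBdd v) : PolyBdd fun a => u a * v a :=
  PowBdd.mul (X := fun a : α => sz a + 1) hu hv

lemma pow {u : α → ℕ} (hu : PolyBdd u) (n : ℕ) : PolyBdd fun a => u a ^ n := PowBdd.pow (X := fun a : α => sz a + 1) hu n

/-- Substitution of arguments whose size is bounded. -/
lemma powBdd {ι : Type*} {X : ι → ℕ} (hX : ∀ i, 2 ≤ X i) {u : α → ℕ} (hu : PolyBdd u) {f : ι → α}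
    (hf : PowBdd X fun i => sz (f i)) : PowBdd X fun i => u (f i) := by
  obtain ⟨C, hC⟩ := hu
  exact ((hf.add hX (PowBdd.const hX 1)).pow C).mono fun i => hC (f i)

end PolyBdd

/-! ### Randomized polynomial time -/

/-- `f` is computed in polynomial time, with outcomes of polynomial size. -/
def RPoly (f : α → PMF β) : Prop :=
  ∃ T S : α → ℕ, PolyBdd T ∧ PolyBdd S ∧ RComp f (fun a => (T a : ℝ≥0∞)) ∧
    ∀ a, ∀ b ∈ (f a).support, sz b ≤ S a

/-- Deterministic polynomial time. -/
def Poly (f : α → β) : Prop := RPoly fun a => PMF.pure (f a)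

lemma RPoly.congr {f g : α → PMF β} (h : RPoly f) (hfg : ∀ a, f a = g a) : RPoly g := by
  have : f = g := funext hfg
  exact this ▸ h

lemma Poly.congr {f g : α → β} (h : Poly f) (hfg : ∀ a, f a = g a) : Poly g := by
  have : f = g := funext hfg
  exact this ▸ h

lemma Poly.intro {f : α → β} {S : α → ℕ} (n : ℕ) (hS : PolyBdd S)
    (h : RComp (fun a => PMF.pure (f a)) fun _ => (n : ℝ≥0∞)) (hs : ∀ a, sz (f a) ≤ S a) :
    Poly f := by
  refine ⟨fun _ => n, S, PolyBdd.const n, hS, h, fun a b hb => ?_⟩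
  rw [PMF.mem_support_pure_iff] at hb
  exact hb ▸ hs a

lemma Poly.polyBdd {f : α → β} (h : Poly f) : PolyBdd fun a => sz (f a) := by
  obtain ⟨_, S, _, hS, _, hs⟩ := h
  exact hS.mono fun a => hs a _ (by simp)

/-- The bound on the size of outcomes is what makes the class closed under composition: it controls
the argument, and hence the running time, of the second function on the whole support. -/
lemma RPoly.comp {f : α → PMF β} {g : β → PMF γ} (hf : RPoly f) (hg : RPoly g) :
    RPoly fun a => (f a).bind g := by
  obtain ⟨Tf, Sf, hTf, hSf, hf, hsf⟩ := hf
  obtain ⟨Tg, Sg, ⟨C, hC⟩, ⟨D, hD⟩, hg, hsg⟩ := hg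
  refine ⟨fun a => Tf a + (Sf a + 1) ^ C + 1, fun a => (Sf a + 1) ^ D,
    (hTf.add ((hSf.add (PolyBdd.const 1)).pow C)).add (PolyBdd.const 1),
    (hSf.add (PolyBdd.const 1)).pow D, (hf.comp hg).mono fun a => ?_, fun a b hb => ?_⟩
  · push_cast
    refine add_le_add (add_le_add le_rfl (expect_le_of_support fun x hx => ?_)) le_rfl
    have : Tg x ≤ (Sf a + 1) ^ C := (hC x).trans (Nat.pow_le_pow_left (by have := hsf a x hx; omega) C)
    exact_mod_cast this
  · rw [PMF.mem_support_bind_iff] at hb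
    obtain ⟨x, hx, hb⟩ := hb
    exact (hsg x b hb).trans ((hD x).trans (Nat.pow_le_pow_left (by have := hsf a x hx; omega) D))

lemma RPoly.pair {f : α → PMF β} {g : α → PMF γ} (hf : RPoly f) (hg : RPoly g) :
    RPoly fun a => (f a).bind fun x => (g a).map fun y => (x, y) := by
  obtain ⟨Tf, Sf, hTf, hSf, hf, hsf⟩ := hf
  obtain ⟨Tg, Sg, hTg, hSg, hg, hsg⟩ := hg
  refine ⟨fun a => Tf a + Tg a + 7, fun a => Sf a + Sg a + 1,
    (hTf.add hTg).add (PolyBdd.const 7), (hSf.add hSg).add (PolyBdd.const 1),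
    (hf.pair hg).mono fun a => by push_cast; exact le_rfl, fun a b hb => ?_⟩
  rw [PMF.mem_support_bind_iff] at hb
  obtain ⟨x, hx, hb⟩ := hb
  rw [PMF.mem_support_map_iff] at hb
  obtain ⟨y, hy, rfl⟩ := hb
  rw [sz_pair]
  have := hsf a x hx
  have := hsg a y hy
  dsimp only
  omega

lemma RPoly.cond {c : α → Bool} {f g : α → PMF β} (hc : Poly c) (hf : RPoly f) (hg : RPoly g) :
    RPoly fun a => if c a then f a else g a := by
  obtain ⟨Tc, Sc, hTc, hSc, hc, hsc⟩ := hc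
  obtain ⟨Tf, Sf, hTf, hSf, hf, hsf⟩ := hf
  obtain ⟨Tg, Sg, hTg, hSg, hg, hsg⟩ := hg
  refine ⟨fun a => Tc a + (Tf a + Tg a) + 4, fun a => Sf a + Sg a,
    (hTc.add (hTf.add hTg)).add (PolyBdd.const 4), hSf.add hSg,
    (hc.cond hf hg).mono fun a => ?_, fun a b hb => ?_⟩
  · push_cast
    refine add_le_add (add_le_add le_rfl ?_) le_rfl
    split_ifs
    · exact le_self_add
    · exact le_add_self
  · dsimp only at hb
    split_ifs at hb
    · exact (hsf a b hb).trans (Nat.le_add_right _ _)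
    · exact (hsg a b hb).trans (Nat.le_add_left _ _)

lemma sz_foldP_le {ι : Type} {f : σ → ι → PMF σ} {G : ℕ} {l : List ι} {s s' : σ}
    (hG : ∀ x ∈ l, ∀ s, ∀ s' ∈ (f s x).support, sz s' ≤ sz s + G)
    (h : s' ∈ (foldP f s l).support) : sz s' ≤ sz s + l.length * G := by
  induction l generalizing s with
  | nil =>
    simp only [foldP, PMF.mem_support_pure_iff] at h
    simp [h]
  | cons x l ih =>
    simp only [foldP, PMF.mem_support_bind_iff] at h
    obtain ⟨s₁, h1, h2⟩ := h
    have h3 := ih (fun y hy => hG y (List.mem_cons_of_mem _ hy)) h2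
    have h4 := hG x List.mem_cons_self s s₁ h1
    simp only [List.length_cons]
    nlinarith

/-- The bound `τ` is required only at states that are reachable after a prefix of the list, so
invariants of the fold may be used to establish it. -/
lemma foldCost_le {σ ι : Type*} {f : σ → ι → PMF σ} {T : σ → ι → ℝ≥0∞} {τ : ℝ≥0∞} {l : List ι} {s : σ}
    (h : ∀ l₁ x l₂, l = l₁ ++ x :: l₂ → ∀ s' ∈ (foldP f s l₁).support, T s' x ≤ τ) :
    foldCost f T s l ≤ l.length * τ := by
  induction l generalizing s with
  | nil => simp [foldCost]
  | cons x l ih =>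
    simp only [foldCost, List.length_cons]
    have h1 : T s x ≤ τ := h [] x l rfl s (by simp [foldP])
    have h2 : expect (f s x) (fun s' => foldCost f T s' l) ≤ l.length * τ := by
      refine expect_le_of_support fun s' hs' => ih fun l₁ y l₂ hl s'' hs'' => ?_
      refine h (x :: l₁) y l₂ (by rw [hl, List.cons_append]) s'' ?_
      rw [foldP, PMF.mem_support_bind_iff]
      exact ⟨s', hs', hs''⟩
    refine (add_le_add h1 h2).trans (le_of_eq ?_)
    push_cast; ring

/-- Folds all of whose intermediate states are polynomially bounded. -/
lemma RPoly.fold_of_bound {l : α → List β} {s₀ : α → σ} {f : α × (σ × β) → PMF σ} {Q : α → ℕ}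
    (hl : Poly l) (hs₀ : Poly s₀) (hf : RPoly f) (hQ : PolyBdd Q)
    (h : ∀ a l₁ l₂, l a = l₁ ++ l₂ →
      ∀ s ∈ (foldP (fun s x => f (a, (s, x))) (s₀ a) l₁).support, sz s ≤ Q a) :
    RPoly fun a => foldP (fun s x => f (a, (s, x))) (s₀ a) (l a) := by
  have hlb := hl.polyBdd
  obtain ⟨Tl, _, hTl, _, hl, _⟩ := hl
  obtain ⟨Ts, _, hTs, _, hs, _⟩ := hs₀
  obtain ⟨Tf, Sf, ⟨C, hC⟩, _, hf, _⟩ := hf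
  refine ⟨fun a => Tl a + Ts a + sz (l a) * ((sz a + (Q a + sz (l a) + 1) + 1 + 1) ^ C + 11) + 9,
    Q, ?_, hQ, (hl.fold hs hf).mono fun a => ?_, fun a b hb => h a (l a) [] (by simp) b hb⟩
  · exact ((hTl.add hTs).add (hlb.mul (((((PolyBdd.size.add ((hQ.add hlb).add
      (PolyBdd.const 1))).add (PolyBdd.const 1)).add (PolyBdd.const 1)).pow C).add
        (PolyBdd.const 11)))).add (PolyBdd.const 9)
  · have := foldCost_le (f := fun s x => f (a, (s, x))) (T := fun s x => (Tf (a, (s, x)) : ℝ≥0∞) + 11)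
      (τ := (((sz a + (Q a + sz (l a) + 1) + 1 + 1) ^ C + 11 : ℕ) : ℝ≥0∞))
      (l := l a) (s := s₀ a) ?_
    · push_cast at this ⊢
      refine add_le_add (add_le_add le_rfl (this.trans ?_)) le_rfl
      gcongr
      exact length_le_sz _
    · intro l₁ x l₂ hx s hs
      have h1 := hC (a, (s, x))
      rw [sz_pair, sz_pair] at h1
      have h2 := h a l₁ (x :: l₂) hx s hs
      have h3 : sz x ≤ sz (l a) := sz_le_of_mem (by rw [hx]; simp)
      have : Tf (a, (s, x)) + 11 ≤ (sz a + (Q a + sz (l a) + 1) + 1 + 1) ^ C + 11 :=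
        Nat.add_le_add_right (h1.trans (Nat.pow_le_pow_left (by omega) C)) _
      exact_mod_cast this

/-- Folds whose state grows by an amount that does not depend on the state. -/
lemma RPoly.fold {l : α → List β} {s₀ : α → σ} {f : α × (σ × β) → PMF σ} {u : α × β → ℕ}
    (hl : Poly l) (hs₀ : Poly s₀) (hf : RPoly f) (hu : PolyBdd u)
    (hG : ∀ a s x, ∀ s' ∈ (f (a, (s, x))).support, sz s' ≤ sz s + u (a, x)) :
    RPoly fun a => foldP (fun s x => f (a, (s, x))) (s₀ a) (l a) := by
  have hlb := hl.polyBdd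
  have hsb := hs₀.polyBdd
  obtain ⟨D, hD⟩ := hu
  set G : α → ℕ := fun a => (sz a + sz (l a) + 1 + 1) ^ D with hGdef
  have hGb : PolyBdd G := (((PolyBdd.size.add hlb).add (PolyBdd.const 1)).add (PolyBdd.const 1)).pow D
  refine RPoly.fold_of_bound hl hs₀ hf (hsb.add (hlb.mul hGb)) fun a l₁ l₂ hl₁ s hs => ?_
  have hlen : l₁.length ≤ sz (l a) := by
    refine le_trans ?_ (length_le_sz (l a))
    rw [hl₁, List.length_append]; omega
  refine (sz_foldP_le (G := G a) (fun x hx s s' hs' => ?_) hs).trans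
    (Nat.add_le_add_left (Nat.mul_le_mul_right _ hlen) _)
  refine (hG a s x s' hs').trans (Nat.add_le_add_left ((hD (a, x)).trans ?_) _)
  rw [sz_pair]
  have : sz x ≤ sz (l a) := sz_le_of_mem (by rw [hl₁]; simp [hx])
  exact Nat.pow_le_pow_left (by omega) D

/-! ### Deterministic building blocks -/

lemma RComp.retype {f : α → β} {g : α → γ} {T : α → ℝ≥0∞}
    (h : RComp (fun a => PMF.pure (f a)) T) (hfg : ∀ a, enc (g a) = enc (f a)) :
    RComp (fun a => PMF.pure (g a)) T := by
  intro b
  obtain ⟨p, hp⟩ := h b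
  refine ⟨p, fun w Θ t K s a U hs hU => ?_⟩
  rw [expect_pure]
  classical
  -- The payoff is infinite away from the actual result, so the hypothesis on the continuation has
  -- content only at `f a`, where both codes agree.
  have key := hp w Θ t K s a (fun x => if x = f a then U (g a) else ∞) hs ?_
  · simpa [expect_pure] using key
  · intro x s' hx hlow
    by_cases hxf : x = f a
    · subst hxf
      simpa using hU (g a) s' (hx.trans (hfg a).symm) hlow
    · simp [hxf]

namespace Poly

lemma comp {f : α → β} {g : β → γ} (hg : Poly g) (hf : Poly f) : Poly fun a => g (f a) :=
  RPoly.congr (RPoly.comp hf hg) fun a => by simp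

lemma pair {f : α → β} {g : α → γ} (hf : Poly f) (hg : Poly g) : Poly fun a => (f a, g a) :=
  RPoly.congr (RPoly.pair hf hg) fun a => by simp [PMF.pure_map]

lemma cond {c : α → Bool} {f g : α → β} (hc : Poly c) (hf : Poly f) (hg : Poly g) :
    Poly fun a => if c a then f a else g a :=
  RPoly.congr (RPoly.cond hc hf hg) fun a => by dsimp only; split_ifs <;> rfl

lemma retype {f : α → β} {g : α → γ} (h : Poly f) (hfg : ∀ a, enc (g a) = enc (f a))
    (hs : PolyBdd fun a => sz (g a)) : Poly g := by
  obtain ⟨T, _, hT, _, hf, _⟩ := h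
  refine ⟨T, _, hT, hs, hf.retype hfg, fun a b hb => ?_⟩
  rw [PMF.mem_support_pure_iff] at hb
  exact hb ▸ le_rfl

protected lemma id : Poly fun a : α => a :=
  Poly.intro 1 PolyBdd.size (by simpa using RComp.recode (f := fun a : α => a) fun _ => rfl)
    fun _ => le_rfl

lemma fst {f : α → β × γ} (hf : Poly f) : Poly fun a => (f a).1 :=
  comp (g := fun p : β × γ => p.1) (Poly.intro 1 PolyBdd.size
    (by simpa using RComp.headVal (f := fun p : β × γ => p.1) fun _ => rfl)
    fun p => by rw [sz_prod]; omega) hf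

lemma snd {f : α → β × γ} (hf : Poly f) : Poly fun a => (f a).2 :=
  comp (g := fun p : β × γ => p.2) (Poly.intro 1 PolyBdd.size
    (by simpa using RComp.tailVal (f := fun p : β × γ => p.2) fun _ => rfl)
    fun p => by rw [sz_prod]; omega) hf

lemma constVal (v : Val) : Poly fun _ : α => v := by
  induction v with
  | nil =>
    exact Poly.intro 1 (PolyBdd.const 1)
      (by simpa using RComp.clearVal (f := fun _ : α => Val.nil) fun _ => rfl) fun _ => le_rfl
  | cons a b iha ihb =>
    exact (iha.pair ihb).retype (fun _ => rfl) (PolyBdd.const 1)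

lemma const (b : β) : Poly fun _ : α => b :=
  (constVal (enc b)).retype (fun _ => rfl) (PolyBdd.const _)

lemma listCons {f : α → β} {g : α → List β} (hf : Poly f) (hg : Poly g) :
    Poly fun a => f a :: g a :=
  (hf.pair hg).retype (fun _ => rfl) ((hf.polyBdd.add (PolyBdd.const 1)).add hg.polyBdd |>.mono
    fun a => by rw [sz_list_cons])

lemma listTail {f : α → List β} (hf : Poly f) : Poly fun a => (f a).tail :=
  comp (g := fun l : List β => l.tail) (Poly.intro 1 PolyBdd.size
    (by simpa using RComp.tailVal (f := fun l : List β => l.tail) fun l => by cases l <;> rfl)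
    fun l => by
      cases l with
      | nil => exact le_rfl
      | cons a l => rw [sz_list_cons]; simp) hf

/-- A single `head` instruction implements this because the head of `nil` is `nil`; the default must
therefore be coded by `nil`. -/
lemma listHeadD {f : α → List β} (hf : Poly f) {d : β} (hd : enc d = Val.nil) :
    Poly fun a => (f a).headD d :=
  comp (g := fun l : List β => l.headD d) (Poly.intro 1 (PolyBdd.size.add (PolyBdd.const (sz d)))
    (by simpa using RComp.headVal (f := fun l : List β => l.headD d) fun l => by
          cases l
          · exact hd
          · rfl)
    fun l => by
      cases l with
      | nil => simp
      | cons a l => rw [sz_list_cons]; simp; omega) hf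

lemma natSucc {f : α → ℕ} (hf : Poly f) : Poly fun a => f a + 1 :=
  ((const (α := α) Val.nil).pair hf).retype (fun _ => rfl) (hf.polyBdd.add (PolyBdd.const 1) |>.mono
    fun a => by simp [sz_nat])

lemma natPred {f : α → ℕ} (hf : Poly f) : Poly fun a => f a - 1 :=
  comp (g := fun n : ℕ => n - 1) (Poly.intro 1 PolyBdd.size
    (by simpa using RComp.tailVal (f := fun n : ℕ => n - 1) fun n => by cases n <;> rfl)
    fun n => by simp only [sz_nat]; omega) hf

lemma valHead {f : α → Val} (hf : Poly f) : Poly fun a => (f a).head :=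
  comp (g := fun v : Val => v.head) (Poly.intro 1 PolyBdd.size
    (by simpa using RComp.headVal (f := fun v : Val => v.head) fun _ => rfl)
    fun _ => le_rfl) hf

lemma valTail {f : α → Val} (hf : Poly f) : Poly fun a => (f a).tail :=
  comp (g := fun v : Val => v.tail) (Poly.intro 1 PolyBdd.size
    (by simpa using RComp.tailVal (f := fun v : Val => v.tail) fun _ => rfl)
    fun _ => le_rfl) hf

/-- Testing whether a representation is `nil`. -/
lemma nonNil {f : α → β} {c : β → Bool} (hf : Poly f) (hc : ∀ b, c b = true ↔ enc b ≠ Val.nil) :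
    Poly fun a => c (f a) := by
  refine comp (g := c) (Poly.intro 4 (PolyBdd.const 1) ?_ fun _ => le_rfl) hf
  intro b
  refine ⟨Cmd.ite b (Cmd.seq (Cmd.clear b) (Cmd.cons b b b)) (Cmd.clear b),
    fun w Θ t K s a U hs hU => ?_⟩
  rw [expect_pure]
  by_cases h : enc a = Val.nil
  · have hca : c a = false := by
      by_contra hne
      exact (hc a).1 (by simpa using hne) h
    refine (add_step_le (n := 0 + 1) (B := U (c a)) (val_ite_nil _ _ _ _ _ (by rw [hs, h]))
      (add_step_le (val_clear _ _ _ _) ?_)).trans (by gcongr; norm_num)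
    rw [mul_zero, zero_add]
    refine hU _ _ (by simp [hca, enc_false]) fun i hi => ?_
    rw [Function.update_of_ne (by omega)]
  · have hca : c a = true := (hc a).2 h
    refine (add_step_le (n := 0 + 1 + 1 + 1) (B := U (c a))
      (val_ite_cons _ _ _ _ _ (by rw [hs]; exact h))
      (add_step_le (val_seq _ _ _ _ _) (add_step_le (val_clear _ _ _ _)
        (add_step_le (val_consCmd _ _ _ _ _ _) ?_)))).trans (by gcongr; norm_num)
    rw [mul_zero, zero_add]
    refine hU _ _ (by simp [hca, enc_true]) fun i hi => ?_
    rw [Function.update_of_ne (by omega), Function.update_of_ne (by omega)]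

lemma fold {l : α → List β} {s₀ : α → σ} {f : α × (σ × β) → σ} {u : α × β → ℕ}
    (hl : Poly l) (hs₀ : Poly s₀) (hf : Poly f) (hu : PolyBdd u)
    (hG : ∀ a s x, sz (f (a, (s, x))) ≤ sz s + u (a, x)) :
    Poly fun a => (l a).foldl (fun s x => f (a, (s, x))) (s₀ a) :=
  RPoly.congr (RPoly.fold hl hs₀ hf hu fun a s x s' hs' => by
    rw [PMF.mem_support_pure_iff] at hs'
    exact hs' ▸ hG a s x) fun a => foldP_pure _ _ _

lemma fold_of_bound {l : α → List β} {s₀ : α → σ} {f : α × (σ × β) → σ} {Q : α → ℕ}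
    (hl : Poly l) (hs₀ : Poly s₀) (hf : Poly f) (hQ : PolyBdd Q)
    (h : ∀ a l₁ l₂, l a = l₁ ++ l₂ → sz (l₁.foldl (fun s x => f (a, (s, x))) (s₀ a)) ≤ Q a) :
    Poly fun a => (l a).foldl (fun s x => f (a, (s, x))) (s₀ a) :=
  RPoly.congr (RPoly.fold_of_bound hl hs₀ hf hQ fun a l₁ l₂ hl₁ s hs => by
    rw [foldP_pure, PMF.mem_support_pure_iff] at hs
    exact hs ▸ h a l₁ l₂ hl₁) fun a => foldP_pure _ _ _

lemma and {f g : α → Bool} (hf : Poly f) (hg : Poly g) : Poly fun a => f a && g a :=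
  (cond hf hg (const false)).congr fun a => by cases f a <;> simp

lemma or {f g : α → Bool} (hf : Poly f) (hg : Poly g) : Poly fun a => f a || g a :=
  (cond hf (const true) hg).congr fun a => by cases f a <;> simp

lemma not {f : α → Bool} (hf : Poly f) : Poly fun a => !f a :=
  (cond hf (const false) (const true)).congr fun a => by cases f a <;> simp

lemma reverse {l : α → List β} (hl : Poly l) : Poly fun a => (l a).reverse :=
  (fold (f := fun p : α × (List β × β) => p.2.2 :: p.2.1) (u := fun p => sz p.2 + 1) hl
    (const []) (listCons (snd (snd Poly.id)) (fst (snd Poly.id)))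
    ((Poly.polyBdd (snd Poly.id)).add (PolyBdd.const 1))
    fun a s x => by rw [sz_list_cons]; simp; omega).congr fun a => by simp

lemma map {l : α → List β} {f : α × β → γ} (hl : Poly l) (hf : Poly f) :
    Poly fun a => (l a).map fun x => f (a, x) := by
  have h := fold (f := fun p : α × (List γ × β) => f (p.1, p.2.2) :: p.2.1)
    (u := fun p => sz (f p) + 1) hl (const [])
    (listCons (comp hf (pair (fst Poly.id) (snd (snd Poly.id)))) (fst (snd Poly.id)))
    (hf.polyBdd.add (PolyBdd.const 1)) fun a s x => by rw [sz_list_cons]; simp; omega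
  refine h.reverse.congr fun a => ?_
  have : ∀ (L : List β) (acc : List γ), L.foldl (fun s x => f (a, x) :: s) acc =
      (L.map fun x => f (a, x)).reverse ++ acc := by
    intro L
    induction L with
    | nil => simp
    | cons x L ih => intro acc; simp [ih]
  simp [this]

lemma all {l : α → List β} {p : α × β → Bool} (hl : Poly l) (hp : Poly p) :
    Poly fun a => (l a).all fun x => p (a, x) := by
  have h := fold (f := fun q : α × (Bool × β) => q.2.1 && p (q.1, q.2.2)) (u := fun _ => 0) hl
    (const true) (and (fst (snd Poly.id)) (comp hp (pair (fst Poly.id) (snd (snd Poly.id)))))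
    (PolyBdd.const 0) fun a s x => le_rfl
  refine h.congr fun a => ?_
  have : ∀ (L : List β) (c : Bool), L.foldl (fun s x => s && p (a, x)) c =
      (c && L.all fun x => p (a, x)) := by
    intro L
    induction L with
    | nil => simp
    | cons x L ih => intro c; simp [ih, Bool.and_assoc]
  simp [this]

lemma countP {l : α → List β} {p : α × β → Bool} (hl : Poly l) (hp : Poly p) :
    Poly fun a => (l a).countP fun x => p (a, x) := by
  have h := fold (f := fun q : α × (ℕ × β) => if p (q.1, q.2.2) then q.2.1 + 1 else q.2.1)
    (u := fun _ => 1) hl (const 0)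
    (cond (comp hp (pair (fst Poly.id) (snd (snd Poly.id)))) (natSucc (fst (snd Poly.id)))
      (fst (snd Poly.id))) (PolyBdd.const 1) fun a s x => by
        simp only [sz_nat]; split_ifs <;> omega
  refine h.congr fun a => ?_
  have : ∀ (L : List β) (c : ℕ), L.foldl (fun s x => if p (a, x) then s + 1 else s) c =
      c + L.countP fun x => p (a, x) := by
    intro L
    induction L with
    | nil => simp
    | cons x L ih =>
      intro c
      rw [List.foldl_cons, ih, List.countP_cons]
      split_ifs <;> omega
  simp [this]

lemma length {l : α → List β} (hl : Poly l) : Poly fun a => (l a).length :=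
  (countP (p := fun _ => true) hl (const true)).congr fun a => by simp

/-- A unary numeral and a list of `false` of that length have the same code. This converts a number
into a list over which a fold can iterate. -/
lemma replicate {f : α → ℕ} (hf : Poly f) : Poly fun a => List.replicate (f a) false := by
  refine hf.retype (fun a => ?_) ?_
  · change Val.ofList ((List.replicate (f a) false).map enc) = Val.ofList (List.replicate (f a) Val.nil)
    rw [List.map_replicate]; rfl
  · refine ((hf.polyBdd.add hf.polyBdd)).mono fun a => ?_
    change ((List.replicate (f a) false).map fun a => sz a + 1).sum + 1 ≤ _
    simp [List.map_replicate, sz_bool, sz_nat]; omega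

/-- Iteration of a function whose value grows by an amount that does not depend on the state. -/
lemma iterate {n : α → ℕ} {s₀ : α → σ} {f : α × σ → σ} {u : α → ℕ}
    (hn : Poly n) (hs₀ : Poly s₀) (hf : Poly f) (hu : PolyBdd u)
    (hG : ∀ a s, sz (f (a, s)) ≤ sz s + u a) :
    Poly fun a => (fun s => f (a, s))^[n a] (s₀ a) := by
  obtain ⟨C, hC⟩ := hu
  have h := fold (f := fun q : α × (σ × Bool) => f (q.1, q.2.1)) (u := fun q => u q.1)
    hn.replicate hs₀ (comp hf (pair (fst Poly.id) (fst (snd Poly.id))))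
    ⟨C, fun q => (hC q.1).trans (Nat.pow_le_pow_left (by rw [sz_prod]; omega) C)⟩
    fun a s _ => hG a s
  refine h.congr fun a => ?_
  generalize s₀ a = s
  induction n a generalizing s with
  | zero => rfl
  | succ m ih => rw [List.replicate_succ, List.foldl_cons, ih]; rfl

lemma natAdd {f g : α → ℕ} (hf : Poly f) (hg : Poly g) : Poly fun a => f a + g a :=
  (iterate (f := fun q : α × ℕ => q.2 + 1) (u := fun _ => 1) hg hf (natSucc (snd Poly.id))
    (PolyBdd.const 1) fun a s => by simp [sz_nat]).congr fun a => by
      generalize f a = m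
      induction g a generalizing m with
      | zero => rfl
      | succ k ih => rw [Function.iterate_succ_apply, ih]; ring

lemma natSub {f g : α → ℕ} (hf : Poly f) (hg : Poly g) : Poly fun a => f a - g a :=
  (iterate (f := fun q : α × ℕ => q.2 - 1) (u := fun _ => 0) hg hf (natPred (snd Poly.id))
    (PolyBdd.const 0) fun a s => by simp [sz_nat]).congr fun a => by
      generalize f a = m
      induction g a generalizing m with
      | zero => rfl
      | succ k ih => rw [Function.iterate_succ_apply, ih]; omega

lemma natMul {f g : α → ℕ} (hf : Poly f) (hg : Poly g) : Poly fun a => f a * g a :=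
  (iterate (f := fun q : α × ℕ => q.2 + f q.1) (u := fun a => sz (f a)) hg (const 0)
    (natAdd (snd Poly.id) (comp hf (fst Poly.id))) hf.polyBdd
    fun a s => by simp [sz_nat]; omega).congr fun a => by
      have : ∀ (k m : ℕ), (fun s => s + f a)^[k] m = m + f a * k := by
        intro k
        induction k with
        | zero => simp
        | succ k ih => intro m; rw [Function.iterate_succ_apply, ih]; ring
      simp [this]

lemma natPow {f : α → ℕ} (hf : Poly f) (q : ℕ) : Poly fun a => f a ^ q := by
  induction q with
  | zero => exact (const 1).congr fun a => (pow_zero _).symm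
  | succ q ih => exact (natMul ih hf).congr fun a => (pow_succ _ _).symm

lemma natLt {f g : α → ℕ} (hf : Poly f) (hg : Poly g) : Poly fun a => decide (f a < g a) :=
  (nonNil (c := fun n : ℕ => decide (0 < n)) (natSub hg hf) fun n => by
    cases n
    · simp [enc_nat_zero]
    · simp [enc_nat_succ]).congr fun a => by simp

lemma natLe {f g : α → ℕ} (hf : Poly f) (hg : Poly g) : Poly fun a => decide (f a ≤ g a) :=
  (natLt hf (natSucc hg)).congr fun a => by simp

lemma natEq {f g : α → ℕ} (hf : Poly f) (hg : Poly g) : Poly fun a => decide (f a = g a) :=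
  (and (natLe hf hg) (natLe hg hf)).congr fun a => by
    rw [← Bool.decide_and, decide_eq_decide]; exact le_antisymm_iff.symm

lemma zip {l : α → List β} {l' : α → List γ} (hl : Poly l) (hl' : Poly l') {d : γ}
    (hd : enc d = Val.nil) : Poly fun a => (l a).zip (l' a) := by
  have hlast : Poly fun q : α × ((List γ × List (β × γ)) × β) => q.2.1.1 := fst (fst (snd Poly.id))
  have hacc : Poly fun q : α × ((List γ × List (β × γ)) × β) => q.2.1.2 := snd (fst (snd Poly.id))
  have h := fold (f := fun q : α × ((List γ × List (β × γ)) × β) =>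
      (q.2.1.1.tail, if !q.2.1.1.isEmpty then (q.2.2, q.2.1.1.headD d) :: q.2.1.2 else q.2.1.2))
    (u := fun p => sz p.2 + 2) hl (s₀ := fun a => (l' a, [])) (pair hl' (const []))
    (pair (listTail hlast) (cond (nonNil (c := fun l : List γ => !l.isEmpty) hlast fun l => by
        cases l <;> simp [enc_list_nil, enc_list_cons])
      (listCons (pair (snd (snd Poly.id)) (listHeadD hlast hd)) hacc) hacc))
    ((Poly.polyBdd (snd Poly.id)).add (PolyBdd.const 2)) fun a s x => by
      obtain ⟨r, acc⟩ := s
      cases r with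
      | nil => simp [sz_prod]
      | cons y r => simp [sz_prod, sz_list_cons]; omega
  refine h.snd.reverse.congr fun a => ?_
  have : ∀ (L : List β) (r : List γ) (acc : List (β × γ)),
      (L.foldl (fun (s : List γ × List (β × γ)) x => (s.1.tail,
        if !s.1.isEmpty then (x, s.1.headD d) :: s.2 else s.2)) (r, acc)).2 =
      (L.zip r).reverse ++ acc := by
    intro L
    induction L with
    | nil => simp
    | cons x L ih =>
      intro r acc
      rw [List.foldl_cons, ih]
      cases r <;> simp
  dsimp only
  rw [this]
  simp

/-- The entries grow with the accumulated list, so the growth of a step depends on the state and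
`fold` does not apply. The explicit quadratic bound on the size feeds `fold_of_bound` instead. -/
lemma range {f : α → ℕ} (hf : Poly f) : Poly fun a => List.range (f a) := by
  have hrep : ∀ (L : List Bool), L.foldl (fun (s : List ℕ) (_ : Bool) => s.length :: s) [] =
      (List.range L.length).reverse := by
    intro L
    induction L using List.reverseRecOn with
    | nil => rfl
    | append_singleton L x ih => simp [ih, List.range_succ]
  have hsz : ∀ n : ℕ, sz (List.range n).reverse ≤ (n + 1) * (n + 2) := by
    intro n
    induction n with
    | zero => simp [sz_list_nil]
    | succ n ih =>
      rw [List.range_succ, List.reverse_append, List.reverse_singleton, List.singleton_append,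
        sz_list_cons, sz_nat]
      nlinarith
  have h := fold_of_bound (f := fun q : α × (List ℕ × Bool) => q.2.1.length :: q.2.1)
    (Q := fun a => (f a + 1) * (f a + 2)) hf.replicate (const [])
    (listCons (length (fst (snd Poly.id))) (fst (snd Poly.id)))
    ((hf.polyBdd.mul (hf.polyBdd.add (PolyBdd.const 1))).mono fun a => by simp [sz_nat])
    fun a l₁ l₂ hl₁ => by
      rw [hrep]
      refine (hsz _).trans ?_
      have : l₁.length ≤ f a := by
        have := congrArg List.length hl₁
        simp at this; omega
      gcongr
  refine h.reverse.congr fun a => ?_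
  rw [hrep]; simp

end Poly

end

end DkS

/-! ### The product graph and the certificate check in polynomial time -/

namespace DkS

noncomputable section

open Enc (enc sz one_le_sz)

variable {α β γ σ : Type} [Enc α] [Enc β] [Enc γ] [Enc σ]

lemma RPoly.bind {f : α → PMF β} {g : α × β → PMF γ} (hf : RPoly f) (hg : RPoly g) :
    RPoly fun a => (f a).bind fun x => g (a, x) :=
  ((RPoly.pair (Poly.id : Poly fun a : α => a) hf).comp hg).congr fun a => by
    simp [← PMF.bind_pure_comp, PMF.bind_bind]

lemma RPoly.comp_poly {f : α → β} {g : β → PMF γ} (hg : RPoly g) (hf : Poly f) :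
    RPoly fun a => g (f a) :=
  (RPoly.comp hf hg).congr fun a => by simp

lemma RPoly.map {f : α → PMF β} {g : α × β → γ} (hf : RPoly f) (hg : Poly g) :
    RPoly fun a => (f a).map fun x => g (a, x) :=
  (hf.bind hg).congr fun a => by rw [← PMF.bind_pure_comp]; rfl

lemma RPoly.coin : RPoly fun _ : α => PMF.uniformOfFintype Bool :=
  ⟨fun _ => 1, fun _ => 1, PolyBdd.const 1, PolyBdd.const 1, by simpa using RComp.coin,
    fun _ _ _ => le_rfl⟩

/-! ### Independent samples -/

/-- `N` independent samples. -/
def iid {ι : Type*} (N : ℕ) (μ : PMF ι) : PMF (List ι) :=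
  foldP (fun (acc : List ι) (_ : Bool) => μ.map fun x => x :: acc) [] (List.replicate N false)

lemma foldP_append {σ ι : Type*} (f : σ → ι → PMF σ) (s : σ) (l₁ l₂ : List ι) :
    foldP f s (l₁ ++ l₂) = (foldP f s l₁).bind fun s' => foldP f s' l₂ := by
  induction l₁ generalizing s with
  | nil => simp [foldP]
  | cons x l ih => simp [foldP, ih, PMF.bind_bind]

lemma iid_zero {ι : Type*} (μ : PMF ι) : iid 0 μ = PMF.pure [] := rfl

lemma iid_succ {ι : Type*} (N : ℕ) (μ : PMF ι) :
    iid (N + 1) μ = (iid N μ).bind fun l => μ.map fun x => x :: l := by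
  unfold iid
  rw [List.replicate_succ', foldP_append]
  simp [foldP]

lemma RPoly.iid {f : α → PMF β} {n : α → ℕ} (hf : RPoly f) (hn : Poly n) :
    RPoly fun a => iid (n a) (f a) := by
  have hf' := hf
  obtain ⟨_, S, _, ⟨C, hC⟩, _, hs⟩ := hf'
  refine RPoly.fold (f := fun q : α × (List β × Bool) => (f q.1).map fun x => x :: q.2.1)
    (u := fun q => (sz q.1 + 1) ^ C + 1) hn.replicate (Poly.const [])
    ((RPoly.comp_poly hf (Poly.fst Poly.id)).map
      (g := fun p : (α × (List β × Bool)) × β => p.2 :: p.1.2.1)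
      (Poly.listCons (Poly.snd Poly.id) (Poly.fst (Poly.snd (Poly.fst Poly.id)))))
    ((((Poly.polyBdd (Poly.fst Poly.id)).add (PolyBdd.const 1)).pow C).add (PolyBdd.const 1)) ?_
  intro a s x s' hs'
  rw [PMF.mem_support_map_iff] at hs'
  obtain ⟨y, hy, rfl⟩ := hs'
  rw [sz_list_cons]
  have := (hs a y hy).trans (hC a)
  dsimp only
  omega

/-- A bit that is `true` with probability `2 ^ (-a)`. -/
def rareBit (a : ℕ) : PMF Bool := (iid a (PMF.uniformOfFintype Bool)).map fun l => l.all fun b => b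

lemma RPoly.rareBit {f : α → ℕ} (hf : Poly f) : RPoly fun a => rareBit (f a) :=
  RPoly.map (g := fun p : α × List Bool => p.2.all fun b => b) (RPoly.iid RPoly.coin hf)
    (Poly.all (p := fun q : (α × List Bool) × Bool => q.2) (Poly.snd Poly.id) (Poly.snd Poly.id))

/-! ### The reduction to Densest `k`-Subgraph, and the certificate -/

/-- Are all pairs from `s × s'` adjacent? -/
def completeB (M : List (List Bool)) (s s' : List Bool) : Bool :=
  (M.zip s).all fun p => !p.2 || (p.1.zip s').all fun q => !q.2 || q.1

/-- Does `s` have exactly `ℓ` elements? -/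
def validB (ℓ : ℕ) (s : List Bool) : Bool := decide (s.countP (fun b => b) = ℓ)

/-- The graph on the sets `S`: two sets of `ℓ` elements are adjacent if all pairs are. -/
def blowup (M : List (List Bool)) (ℓ : ℕ) (S : List (List Bool)) : List (List Bool) :=
  S.map fun s => S.map fun s' => validB ℓ s && (validB ℓ s' && completeB M s s')

/-- Interpret a value as `true` or `false`. -/
def isTrue : Val → Bool
  | Val.nil => false
  | Val.cons _ _ => true

/-- The sets of `ℓ` elements among those selected by `v`. -/
def selectSets (ℓ : ℕ) : List (List Bool) → Val → List (List Bool)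
  | [], _ => []
  | s :: S, v =>
    if isTrue v.head && validB ℓ s then s :: selectSets ℓ S v.tail else selectSets ℓ S v.tail

/-- Mark the pairs in `s × s'`. -/
def addMarks (mat : List (List Bool)) (s s' : List Bool) : List (List Bool) :=
  (mat.zip s).map fun p => if p.2 then (p.1.zip s').map fun q => q.1 || q.2 else p.1

/-- All pairs in `s × s'` for `s, s'` in `C` such that all these pairs are adjacent. -/
def marks (M : List (List Bool)) (C : List (List Bool)) : List (List Bool) :=
  C.foldl (fun mat s => C.foldl (fun mat s' =>
    if completeB M s s' then addMarks mat s s' else mat) mat)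
    (M.map fun row => row.map fun _ => false)

/-- Number of marked pairs. -/
def countMarks (mat : List (List Bool)) : ℕ := (mat.map fun row => row.countP fun b => b).sum

/-- The certificate check. -/
def checkB (M : List (List Bool)) (a A ℓ : ℕ) (S : List (List Bool)) (v : Val) : Bool :=
  decide (M.length ≤ A) && decide (4 * ((selectSets ℓ S v).length * ℓ * a +
    (selectSets ℓ S v).length * (selectSets ℓ S v).length) <
      countMarks (marks M (selectSets ℓ S v)))

namespace Poly

lemma completeB {M : α → List (List Bool)} {s s' : α → List Bool} (hM : Poly M) (hs : Poly s)
    (hs' : Poly s') : Poly fun a => completeB (M a) (s a) (s' a) := by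
  refine all (p := fun p : α × (List Bool × Bool) => !p.2.2 ||
    (p.2.1.zip (s' p.1)).all fun q => !q.2 || q.1) (zip hM hs enc_false) ?_
  refine or (not (snd (snd Poly.id))) ?_
  refine all (p := fun q : (α × (List Bool × Bool)) × (Bool × Bool) => !q.2.2 || q.2.1)
    (zip (fst (snd Poly.id)) (hs'.comp (fst Poly.id)) enc_false) ?_
  exact or (not (snd (snd Poly.id))) (fst (snd Poly.id))

lemma validB {ℓ : α → ℕ} {s : α → List Bool} (hℓ : Poly ℓ) (hs : Poly s) :
    Poly fun a => validB (ℓ a) (s a) :=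
  natEq (countP (p := fun q : α × Bool => q.2) hs (snd Poly.id)) hℓ

lemma blowup {M : α → List (List Bool)} {ℓ : α → ℕ} {S : α → List (List Bool)} (hM : Poly M)
    (hℓ : Poly ℓ) (hS : Poly S) : Poly fun a => blowup (M a) (ℓ a) (S a) := by
  refine map (f := fun p : α × List Bool => (S p.1).map fun s' => DkS.validB (ℓ p.1) p.2 &&
    (DkS.validB (ℓ p.1) s' && DkS.completeB (M p.1) p.2 s')) hS ?_
  refine map (f := fun q : (α × List Bool) × List Bool => DkS.validB (ℓ q.1.1) q.1.2 &&
    (DkS.validB (ℓ q.1.1) q.2 && DkS.completeB (M q.1.1) q.1.2 q.2)) (hS.comp (fst Poly.id)) ?_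
  have h1 : Poly fun q : (α × List Bool) × List Bool => q.1.1 := fst (fst Poly.id)
  have h2 : Poly fun q : (α × List Bool) × List Bool => q.1.2 := snd (fst Poly.id)
  have h3 : Poly fun q : (α × List Bool) × List Bool => q.2 := snd Poly.id
  exact and (validB (hℓ.comp h1) h2) (and (validB (hℓ.comp h1) h3)
    (completeB (hM.comp h1) h2 h3))

lemma isTrue {v : α → Val} (hv : Poly v) : Poly fun a => isTrue (v a) :=
  nonNil hv fun v => by cases v <;> simp [DkS.isTrue, enc_val]

/-- The raw value `v` is only traversed along the list `S`, so its true size, which may be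
exponential in the time that produced it, never enters the cost. -/
lemma selectSets {ℓ : α → ℕ} {S : α → List (List Bool)} {v : α → Val} (hℓ : Poly ℓ) (hS : Poly S)
    (hv : Poly v) : Poly fun a => selectSets (ℓ a) (S a) (v a) := by
  have hv' : Poly fun q : α × ((Val × List (List Bool)) × List Bool) => q.2.1.1 :=
    fst (fst (snd Poly.id))
  have hacc : Poly fun q : α × ((Val × List (List Bool)) × List Bool) => q.2.1.2 :=
    snd (fst (snd Poly.id))
  have hs : Poly fun q : α × ((Val × List (List Bool)) × List Bool) => q.2.2 :=
    snd (snd Poly.id)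
  have h := fold (f := fun q : α × ((Val × List (List Bool)) × List Bool) =>
      (q.2.1.1.tail, if DkS.isTrue q.2.1.1.head && DkS.validB (ℓ q.1) q.2.2 then q.2.2 :: q.2.1.2
        else q.2.1.2)) (u := fun p => sz p.2 + 1) hS (s₀ := fun a => (v a, [])) (pair hv (const []))
    (pair (valTail hv') (cond (and (isTrue (valHead hv')) (validB (hℓ.comp (fst Poly.id)) hs))
      (listCons hs hacc) hacc)) ((Poly.polyBdd (snd Poly.id)).add (PolyBdd.const 1)) fun a s x => by
        simp only [sz_prod, sz_val]
        split_ifs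
        · rw [sz_list_cons]; omega
        · omega
  refine h.snd.reverse.congr fun a => ?_
  have : ∀ (L : List (List Bool)) (v : Val) (acc : List (List Bool)),
      (L.foldl (fun (s : Val × List (List Bool)) x => (s.1.tail,
        if DkS.isTrue s.1.head && DkS.validB (ℓ a) x then x :: s.2 else s.2)) (v, acc)).2 =
      (DkS.selectSets (ℓ a) L v).reverse ++ acc := by
    intro L
    induction L with
    | nil => simp [DkS.selectSets]
    | cons x L ih =>
      intro v acc
      rw [List.foldl_cons, ih, DkS.selectSets]
      split_ifs <;> simp
  dsimp only
  rw [this]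
  simp

lemma addMarks {mat : α → List (List Bool)} {s s' : α → List Bool} (hmat : Poly mat) (hs : Poly s)
    (hs' : Poly s') : Poly fun a => addMarks (mat a) (s a) (s' a) := by
  have h : Poly fun p : α × (List Bool × Bool) =>
      (p.2.1.zip (s' p.1)).map fun q => q.1 || q.2 :=
    map (f := fun q : (α × (List Bool × Bool)) × (Bool × Bool) => q.2.1 || q.2.2)
      (zip (fst (snd Poly.id)) (hs'.comp (fst Poly.id)) enc_false)
      (or (fst (snd Poly.id)) (snd (snd Poly.id)))
  have h' : Poly fun p : α × (List Bool × Bool) => if p.2.2 then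
      (p.2.1.zip (s' p.1)).map fun q => q.1 || q.2 else p.2.1 :=
    cond (snd (snd Poly.id)) h (fst (snd Poly.id))
  exact (map (zip hmat hs enc_false) h').congr fun a => rfl

lemma sz_list_bool (l : List Bool) : sz l = 2 * l.length + 1 := by
  induction l with
  | nil => rfl
  | cons b l ih => rw [sz_list_cons, ih, sz_bool, List.length_cons]; ring

/-- Marking changes entries in place, and zipping can only truncate. Hence the nested folds in
`marks` have growth bound `0`. -/
lemma sz_addMarks_le (mat : List (List Bool)) (s s' : List Bool) :
    sz (DkS.addMarks mat s s') ≤ sz mat := by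
  induction mat generalizing s with
  | nil => simp [DkS.addMarks]
  | cons row mat ih =>
    cases s with
    | nil => simp [DkS.addMarks, sz_list_nil]; exact one_le_sz _
    | cons b s =>
      have h1 : DkS.addMarks (row :: mat) (b :: s) s' =
        (if b then (row.zip s').map fun q => q.1 || q.2 else row) :: DkS.addMarks mat s s' := rfl
      rw [h1, sz_list_cons, sz_list_cons]
      have h2 := ih s
      have h3 : sz (if b then (row.zip s').map fun q => q.1 || q.2 else row) ≤ sz row := by
        split_ifs
        · simp only [sz_list_bool, List.length_map, List.length_zip]; omega
        · exact le_rfl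
      omega

lemma marks {M C : α → List (List Bool)} (hM : Poly M) (hC : Poly C) :
    Poly fun a => marks (M a) (C a) := by
  have inner_sz : ∀ (N : List (List Bool)) (s : List Bool) (L mat : List (List Bool)),
      sz (L.foldl (fun mat s' => if DkS.completeB N s s' then DkS.addMarks mat s s' else mat) mat) ≤
        sz mat := by
    intro N s L
    induction L with
    | nil => intro mat; exact le_rfl
    | cons x L ih =>
      intro mat
      rw [List.foldl_cons]
      refine (ih _).trans ?_
      split_ifs
      · exact sz_addMarks_le _ _ _
      · exact le_rfl
  refine fold (f := fun q : α × (List (List Bool) × List Bool) =>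
    (C q.1).foldl (fun mat s' => if DkS.completeB (M q.1) q.2.2 s' then
      DkS.addMarks mat q.2.2 s' else mat) q.2.1) (u := fun _ => 0) hC ?_ ?_ (PolyBdd.const 0)
    fun a s x => inner_sz _ _ _ _
  · refine map (f := fun p : α × List Bool => p.2.map fun _ => false) hM ?_
    exact map (f := fun _ => false) (snd Poly.id) (const false)
  · have h1 : Poly fun q : (α × (List (List Bool) × List Bool)) × (List (List Bool) × List Bool) =>
        q.1.1 := fst (fst Poly.id)
    have h2 : Poly fun q : (α × (List (List Bool) × List Bool)) × (List (List Bool) × List Bool) =>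
        q.1.2.2 := snd (snd (fst Poly.id))
    have h3 : Poly fun q : (α × (List (List Bool) × List Bool)) × (List (List Bool) × List Bool) =>
        q.2.1 := fst (snd Poly.id)
    have h4 : Poly fun q : (α × (List (List Bool) × List Bool)) × (List (List Bool) × List Bool) =>
        q.2.2 := snd (snd Poly.id)
    refine fold (f := fun q : (α × (List (List Bool) × List Bool)) ×
      (List (List Bool) × List Bool) => if DkS.completeB (M q.1.1) q.1.2.2 q.2.2 then
        DkS.addMarks q.2.1 q.1.2.2 q.2.2 else q.2.1) (u := fun _ => 0) (hC.comp (fst Poly.id))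
      (fst (snd Poly.id)) (cond (completeB (hM.comp h1) h2 h4) (addMarks h3 h2 h4) h3)
      (PolyBdd.const 0) fun a s x => ?_
    dsimp only
    split_ifs
    · exact sz_addMarks_le _ _ _
    · exact le_rfl

lemma countMarks {mat : α → List (List Bool)} (hmat : Poly mat) :
    Poly fun a => countMarks (mat a) := by
  refine (fold (f := fun q : α × (ℕ × List Bool) => q.2.1 + q.2.2.countP fun b => b)
    (u := fun p => sz p.2) hmat (const 0) (natAdd (fst (snd Poly.id))
      (countP (p := fun q : (α × (ℕ × List Bool)) × Bool => q.2) (snd (snd Poly.id)) (snd Poly.id)))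
    (Poly.polyBdd (snd Poly.id)) fun a s x => ?_).congr fun a => ?_
  · have h1 : x.countP (fun b => b) ≤ x.length := List.countP_le_length
    have h2 := length_le_sz x
    simp only [sz_nat]; omega
  · have : ∀ (L : List (List Bool)) (c : ℕ), L.foldl (fun s x => s + x.countP fun b => b) c =
        c + (L.map fun row => row.countP fun b => b).sum := by
      intro L
      induction L with
      | nil => simp
      | cons x L ih => intro c; rw [List.foldl_cons, ih]; simp [add_assoc]
    simp [this, DkS.countMarks]

lemma checkB {M S : α → List (List Bool)} {e A ℓ : α → ℕ} {v : α → Val} (hM : Poly M) (he : Poly e)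
    (hA : Poly A) (hℓ : Poly ℓ) (hS : Poly S) (hv : Poly v) :
    Poly fun a => checkB (M a) (e a) (A a) (ℓ a) (S a) (v a) := by
  have hC := selectSets hℓ hS hv
  exact and (natLe (length hM) hA) (natLt (natMul (const 4) (natAdd (natMul (natMul (length hC) hℓ) he)
    (natMul (length hC) (length hC)))) (countMarks (marks hM hC)))

end Poly

/-- Parameters of a single attempt: the graph, `k`, the size `ℓ` of the sets, `a` and `2 ^ a`,
the number of sets and the time bound. -/
abbrev Params : Type := List (List Bool) × (ℕ × (ℕ × (ℕ × (ℕ × (ℕ × ℕ)))))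

/-- A single attempt to find a certificate with given parameters. -/
def attempt (P : Cmd) : Params → PMF Bool := fun (M, k, ℓ, a, A, N, B) =>
  (iid N (iid M.length (rareBit a))).bind fun S =>
    (run B (start P (enc (blowup M ℓ S, k)))).map fun c =>
      (readOutput c).1 && checkB M a A ℓ S (readOutput c).2

/-- The number of sets, the budget and `2 ^ a` are unary parameters, so everything is polynomial in
the size of the parameters. The run of `P` contributes only its budget, since instance and output
are passed as raw values of size one. -/
lemma RPoly.attempt (P : Cmd) : RPoly (attempt P) := by
  have hrun : RPoly fun a : Val × ℕ => (run a.2 (start P a.1)).map readOutput := by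
    obtain ⟨C, hC⟩ := RComp.runFor P
    refine ⟨fun a => C * (a.2 + 1), fun _ => 3, (PolyBdd.const C).mul
      ((Poly.polyBdd (Poly.snd Poly.id)).mono fun a => by simp [sz_nat]), PolyBdd.const 3,
      hC, fun a b _ => by simp [sz_prod, sz_bool, sz_val]⟩
  have hM : Poly fun p : Params => p.1 := Poly.fst Poly.id
  have hk : Poly fun p : Params => p.2.1 := Poly.fst (Poly.snd Poly.id)
  have hℓ : Poly fun p : Params => p.2.2.1 := Poly.fst (Poly.snd (Poly.snd Poly.id))
  have ha : Poly fun p : Params => p.2.2.2.1 :=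
    Poly.fst (Poly.snd (Poly.snd (Poly.snd Poly.id)))
  have hA : Poly fun p : Params => p.2.2.2.2.1 :=
    Poly.fst (Poly.snd (Poly.snd (Poly.snd (Poly.snd Poly.id))))
  have hN : Poly fun p : Params => p.2.2.2.2.2.1 :=
    Poly.fst (Poly.snd (Poly.snd (Poly.snd (Poly.snd (Poly.snd Poly.id)))))
  have hB : Poly fun p : Params => p.2.2.2.2.2.2 :=
    Poly.snd (Poly.snd (Poly.snd (Poly.snd (Poly.snd (Poly.snd Poly.id)))))
  have hsample : RPoly fun p : Params => DkS.iid p.2.2.2.2.2.1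
      (DkS.iid p.1.length (DkS.rareBit p.2.2.2.1)) :=
    RPoly.iid (RPoly.iid (RPoly.rareBit ha) (Poly.length hM)) hN
  have f1 : Poly fun q : Params × List (List Bool) => q.1 := Poly.fst Poly.id
  have f2 : Poly fun q : Params × List (List Bool) => q.2 := Poly.snd Poly.id
  have hinst : Poly fun q : Params × List (List Bool) =>
      ((enc (blowup q.1.1 q.1.2.2.1 q.2, q.1.2.1) : Val), q.1.2.2.2.2.2.2) :=
    Poly.pair ((Poly.pair (Poly.blowup (hM.comp f1) (hℓ.comp f1) f2) (hk.comp f1)).retype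
      (fun _ => rfl) (PolyBdd.const 1)) (hB.comp f1)
  have g1 : Poly fun q : (Params × List (List Bool)) × (Bool × Val) => q.1.1 :=
    Poly.fst (Poly.fst Poly.id)
  have hfin : Poly fun q : (Params × List (List Bool)) × (Bool × Val) =>
      q.2.1 && checkB q.1.1.1 q.1.1.2.2.2.1 q.1.1.2.2.2.2.1 q.1.1.2.2.1 q.1.2 q.2.2 :=
    Poly.and (Poly.fst (Poly.snd Poly.id)) (Poly.checkB (hM.comp g1) (ha.comp g1) (hA.comp g1)
      (hℓ.comp g1) (Poly.snd (Poly.fst Poly.id)) (Poly.snd (Poly.snd Poly.id)))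
  refine (hsample.bind ((hrun.comp_poly hinst).map hfin)).congr fun p => ?_
  simp only [DkS.attempt, PMF.map_comp]
  rfl

end

end DkS

/-! ### Universal search with geometrically distributed parameters -/

namespace DkS

noncomputable section

open Enc (enc sz one_le_sz)

variable {α β γ σ : Type} [Enc α] [Enc β] [Enc γ] [Enc σ]

/-! ### Random parameters -/

lemma apply_eq_expect {ι : Type*} [DecidableEq ι] (μ : PMF ι) (x : ι) :
    μ x = expect μ fun y => if y = x then 1 else 0 := by
  unfold expect
  rw [tsum_eq_single x]
  · simp
  · intro y hy; simp [hy]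

lemma expect_coin (U : Bool → ℝ≥0∞) :
    expect (PMF.uniformOfFintype Bool) U = 2⁻¹ * U true + 2⁻¹ * U false := by
  rw [expect_bool]
  simp [PMF.uniformOfFintype_apply]

lemma rareBit_true (a : ℕ) : rareBit a true = (2⁻¹ : ℝ≥0∞) ^ a := by
  rw [apply_eq_expect, rareBit, expect_map]
  induction a with
  | zero => simp [iid_zero]
  | succ a ih =>
    rw [iid_succ, expect_bind]
    simp only [expect_map, expect_coin, List.all_cons, Bool.true_and, Bool.false_and,
      Bool.false_eq_true, if_false, mul_zero, add_zero]
    rw [expect_mul_left, ih, pow_succ']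

lemma rareBit_false (a : ℕ) : rareBit a false = 1 - (2⁻¹ : ℝ≥0∞) ^ a := by
  rw [← rareBit_true]
  exact ENNReal.eq_sub_of_add_eq ((rareBit a).apply_ne_top _)
    (by rw [add_comm]; exact bool_add _)

/-- A random number, larger than `m` with probability `2 ^ (-D (m + 1))`. -/
def guess (D : ℕ) : PMF ℕ := failures ((rareBit D).map not)

lemma notRareBit_true (D : ℕ) : (rareBit D).map not true = 1 - (2⁻¹ : ℝ≥0∞) ^ D := by
  rw [apply_eq_expect, expect_map, expect_bool, rareBit_false]
  simp

lemma notRareBit_false (D : ℕ) : (rareBit D).map not false = (2⁻¹ : ℝ≥0∞) ^ D := by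
  rw [apply_eq_expect, expect_map, expect_bool, rareBit_true]
  simp

lemma half_le_notRareBit {D : ℕ} (hD : 1 ≤ D) : (2⁻¹ : ℝ≥0∞) ≤ (rareBit D).map not true := by
  rw [notRareBit_true]
  have h : (2⁻¹ : ℝ≥0∞) ^ D ≤ 2⁻¹ := by
    calc (2⁻¹ : ℝ≥0∞) ^ D ≤ 2⁻¹ ^ 1 := pow_le_pow_right_of_le_one' (by simp) hD
      _ = 2⁻¹ := pow_one _
  calc (2⁻¹ : ℝ≥0∞) = 1 - 2⁻¹ := by rw [ENNReal.one_sub_inv_two]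
    _ ≤ _ := tsub_le_tsub_left h 1

lemma guess_apply {D : ℕ} (hD : 1 ≤ D) (m : ℕ) :
    guess D m = ((2⁻¹ : ℝ≥0∞) ^ D) ^ m * (1 - (2⁻¹ : ℝ≥0∞) ^ D) := by
  have h := half_le_notRareBit hD
  rw [guess, failures_apply (fun h0 => by rw [h0] at h; simp at h), notRareBit_false,
    notRareBit_true]

lemma le_guess_apply {D : ℕ} (hD : 1 ≤ D) (m : ℕ) :
    (2⁻¹ : ℝ≥0∞) ^ (D * m + 1) ≤ guess D m := by
  rw [guess_apply hD, pow_succ, pow_mul, ← notRareBit_true]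
  gcongr
  exact half_le_notRareBit hD

/-- The tail `2 ^ (-(C + 1) * m)` beats the cost `2 ^ (C * m)` by a factor `2 ^ (-m)`, and a
geometric series remains. -/
lemma expect_guess_le (C : ℕ) : expect (guess (C + 1)) (fun m => (2 : ℝ≥0∞) ^ (C * m)) ≤ 2 := by
  unfold expect
  calc ∑' m, guess (C + 1) m * (2 : ℝ≥0∞) ^ (C * m) ≤ ∑' m : ℕ, (2⁻¹ : ℝ≥0∞) ^ m := by
        refine ENNReal.tsum_le_tsum fun m => ?_
        rw [guess_apply (by omega)]
        calc ((2⁻¹ : ℝ≥0∞) ^ (C + 1)) ^ m * (1 - (2⁻¹ : ℝ≥0∞) ^ (C + 1)) * 2 ^ (C * m)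
            ≤ ((2⁻¹ : ℝ≥0∞) ^ (C + 1)) ^ m * 1 * 2 ^ (C * m) := by gcongr; exact tsub_le_self
          _ = 2⁻¹ ^ m * (2⁻¹ * 2) ^ (C * m) := by ring
          _ = 2⁻¹ ^ m := by rw [ENNReal.inv_mul_cancel (by simp) (by simp)]; simp
    _ = 2 := ENNReal.tsum_geometric_two

lemma RComp.guess {D : ℕ} (hD : 1 ≤ D) : ∃ T : α → ℕ, PolyBdd T ∧
    RComp (fun _ : α => guess D) fun a => (T a : ℝ≥0∞) := by
  have h : RPoly fun _ : α => (DkS.rareBit D).map not :=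
    RPoly.map (g := fun p : α × Bool => !p.2) (RPoly.rareBit (Poly.const D))
      (Poly.not (Poly.snd Poly.id))
  obtain ⟨T, _, hT, _, hc, _⟩ := h
  refine ⟨fun a => (T a + 12) * 2 + 8,
    ((hT.add (PolyBdd.const 12)).mul (PolyBdd.const 2)).add (PolyBdd.const 8),
    hc.failures.mono fun a => ?_⟩
  push_cast
  refine add_le_add ?_ le_rfl
  calc ((T a : ℝ≥0∞) + 12) / (DkS.rareBit D).map not true
      ≤ ((T a : ℝ≥0∞) + 12) / 2⁻¹ := ENNReal.div_le_div_left (half_le_notRareBit hD) _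
    _ = _ := by rw [div_eq_mul_inv, inv_inv]

/-- Repeated doubling. The unary result is exponential in `x`, so this function is not `Poly`; its
cost is measured on the scale `8 * 2 ^ x`. -/
lemma RComp.pow_two : ∃ C : ℕ, RComp (fun x : ℕ => PMF.pure (2 ^ x))
    fun x => (((8 * 2 ^ x) ^ C : ℕ) : ℝ≥0∞) := by
  obtain ⟨Tl, _, hTl, _, hl, _⟩ := Poly.replicate (Poly.id : Poly fun x : ℕ => x)
  obtain ⟨Ts, _, hTs, _, hs, _⟩ := (Poly.const 1 : Poly fun _ : ℕ => 1)
  obtain ⟨Tf, _, hTf, _, hf, _⟩ := (Poly.natAdd (Poly.fst (Poly.snd Poly.id))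
    (Poly.fst (Poly.snd Poly.id)) : Poly fun q : ℕ × (ℕ × Bool) => q.2.1 + q.2.1)
  have hX : ∀ x : ℕ, 2 ≤ 8 * 2 ^ x := fun x => by have := Nat.one_le_two_pow (n := x); omega
  obtain ⟨C', hC'⟩ := hTf
  have hself : PowBdd (fun x : ℕ => 8 * 2 ^ x) fun x => 8 * 2 ^ x := PowBdd.self
  have hsz : PowBdd (fun x : ℕ => 8 * 2 ^ x) fun x => sz x :=
    hself.mono fun x => by
      have := Nat.lt_two_pow_self (n := x)
      simp only [sz_nat]; omega
  obtain ⟨C, hC⟩ : PowBdd (fun x : ℕ => 8 * 2 ^ x) fun x =>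
      Tl x + Ts x + sz x * ((8 * 2 ^ x) ^ C' + 11) + 9 :=
    PowBdd.add hX (PowBdd.add hX (PowBdd.add hX (hTl.powBdd hX hsz) (hTs.powBdd hX hsz))
      (hsz.mul (PowBdd.add hX (hself.pow C') (PowBdd.const hX 11)))) (PowBdd.const hX 9)
  refine ⟨C, ((hl.fold hs hf).congr (g := fun x => PMF.pure (2 ^ x)) fun x => ?_).mono fun x => ?_⟩
  · rw [foldP_pure]
    congr 1
    have : ∀ n m : ℕ, (List.replicate n false).foldl (fun s (_ : Bool) => s + s) m = m * 2 ^ n := by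
      intro n
      induction n with
      | zero => simp
      | succ n ih => intro m; rw [List.replicate_succ, List.foldl_cons, ih]; ring
    simpa using this x 1
  · have h1 : foldCost (fun (s : ℕ) (b : Bool) => PMF.pure (s + s))
        (fun s b => (Tf (x, (s, b)) : ℝ≥0∞) + 11) 1 (List.replicate x false) ≤
        (List.replicate x false).length * (((8 * 2 ^ x) ^ C' + 11 : ℕ) : ℝ≥0∞) := by
      refine foldCost_le fun l₁ b l₂ hl₁ s hs => ?_
      rw [foldP_pure, PMF.mem_support_pure_iff] at hs
      have hlen : l₁.length ≤ x := by
        have := congrArg List.length hl₁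
        simp at this; omega
      have hval : ∀ (L : List Bool) (m : ℕ), L.foldl (fun s (_ : Bool) => s + s) m = m * 2 ^ L.length := by
        intro L
        induction L with
        | nil => simp
        | cons c L ih => intro m; rw [List.foldl_cons, ih, List.length_cons]; ring
      rw [hval, one_mul] at hs
      have hs2 : s ≤ 2 ^ x := hs ▸ Nat.pow_le_pow_right (by norm_num) hlen
      have h2 : Tf (x, (s, b)) ≤ (8 * 2 ^ x) ^ C' := by
        refine (hC' _).trans (Nat.pow_le_pow_left ?_ _)
        simp only [sz_pair, sz_nat, sz_bool]
        have := Nat.lt_two_pow_self (n := x)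
        have := Nat.one_le_two_pow (n := x)
        omega
      exact_mod_cast Nat.add_le_add_right h2 11
    have h3 : ((Tl x + Ts x + sz x * ((8 * 2 ^ x) ^ C' + 11) + 9 : ℕ) : ℝ≥0∞) ≤
        (((8 * 2 ^ x) ^ C : ℕ) : ℝ≥0∞) := by exact_mod_cast hC x
    refine le_trans ?_ h3
    push_cast at h1 ⊢
    refine add_le_add (add_le_add le_rfl (h1.trans ?_)) le_rfl
    gcongr
    simp [sz_nat]

/-- Independent pairs. -/
def pairP {ι κ : Type*} (μ : PMF ι) (ν : PMF κ) : PMF (ι × κ) :=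
  μ.bind fun x => ν.map fun y => (x, y)

lemma expect_pairP {ι κ : Type*} (μ : PMF ι) (ν : PMF κ) (U : ι × κ → ℝ≥0∞) :
    expect (pairP μ ν) U = expect μ fun x => expect ν fun y => U (x, y) := by
  simp only [pairP, expect_bind, expect_map]

/-- Five independent random numbers. -/
def guesses (D : ℕ) : PMF (ℕ × (ℕ × (ℕ × (ℕ × ℕ)))) :=
  pairP (guess D) (pairP (guess D) (pairP (guess D) (pairP (guess D) (guess D))))

/-- A single attempt to find a certificate, with random parameters. -/
def trial (P : Cmd) (D : ℕ) (M : List (List Bool)) : PMF Bool :=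
  (guesses D).bind fun p => attempt P (M, p.1, p.2.1, p.2.2.1, 2 ^ p.2.2.1, 2 ^ p.2.2.2.1,
    2 ^ p.2.2.2.2)

lemma RComp.ofPoly {f : α → β} (h : Poly f) : ∃ T : α → ℕ, PolyBdd T ∧
    RComp (fun a => PMF.pure (f a)) fun a => (T a : ℝ≥0∞) := by
  obtain ⟨T, _, hT, _, h, _⟩ := h
  exact ⟨T, hT, h⟩

lemma RComp.guesses {D : ℕ} (hD : 1 ≤ D) : ∃ T : α → ℕ, PolyBdd T ∧
    RComp (fun _ : α => guesses D) fun a => (T a : ℝ≥0∞) := by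
  obtain ⟨T, hT, hg⟩ := RComp.guess (α := α) hD
  refine ⟨fun a => T a + (T a + (T a + (T a + T a + 7) + 7) + 7) + 7, ?_,
    (hg.pair (hg.pair (hg.pair (hg.pair hg)))).mono fun a => by push_cast; exact le_rfl⟩
  have h7 : PolyBdd fun _ : α => 7 := PolyBdd.const 7
  exact (hT.add ((hT.add ((hT.add ((hT.add hT).add h7)).add h7)).add h7)).add h7

/-- The parameters of an attempt that belong to a choice of random numbers. -/
def expand (q : List (List Bool) × (ℕ × (ℕ × (ℕ × (ℕ × ℕ))))) : Params :=
  (q.1, q.2.1, q.2.2.1, q.2.2.2.1, 2 ^ q.2.2.2.1, 2 ^ q.2.2.2.2.1, 2 ^ q.2.2.2.2.2)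

/-- The scale in which the cost of an attempt is measured. -/
def costScale (q : List (List Bool) × (ℕ × (ℕ × (ℕ × (ℕ × ℕ))))) : ℕ :=
  40 * sz q.1 * 2 ^ (q.2.1 + q.2.2.1 + q.2.2.2.1 + q.2.2.2.2.1 + q.2.2.2.2.2)

lemma two_le_costScale (q : List (List Bool) × (ℕ × (ℕ × (ℕ × (ℕ × ℕ))))) : 2 ≤ costScale q := by
  unfold costScale
  have h1 := one_le_sz q.1
  have h2 := Nat.one_le_two_pow (n := q.2.1 + q.2.2.1 + q.2.2.2.1 + q.2.2.2.2.1 + q.2.2.2.2.2)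
  nlinarith

lemma sz_expand_le (q : List (List Bool) × (ℕ × (ℕ × (ℕ × (ℕ × ℕ))))) :
    sz q ≤ costScale q ∧ sz (expand q) ≤ costScale q ∧ 8 * 2 ^ q.2.2.2.1 ≤ costScale q ∧
      8 * 2 ^ q.2.2.2.2.1 ≤ costScale q ∧ 8 * 2 ^ q.2.2.2.2.2 ≤ costScale q := by
  obtain ⟨M, k, ℓ, a, x, y⟩ := q
  simp only [costScale, expand, sz_prod, sz_nat]
  have h1 := one_le_sz M
  set E := 2 ^ (k + ℓ + a + x + y) with hE
  have h2 : k + ℓ + a + x + y < E := Nat.lt_two_pow_self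
  have ha : 2 ^ a ≤ E := Nat.pow_le_pow_right (by norm_num) (by omega)
  have hx : 2 ^ x ≤ E := Nat.pow_le_pow_right (by norm_num) (by omega)
  have hy : 2 ^ y ≤ E := Nat.pow_le_pow_right (by norm_num) (by omega)
  have h3 : E ≤ sz M * E := Nat.le_mul_of_pos_left _ h1
  have h4 : sz M ≤ sz M * E := Nat.le_mul_of_pos_right _ (by omega)
  rw [mul_assoc]
  refine ⟨?_, ?_, ?_, ?_, ?_⟩ <;> omega

lemma RComp.expand : ∃ T : List (List Bool) × (ℕ × (ℕ × (ℕ × (ℕ × ℕ)))) → ℕ,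
    PowBdd costScale T ∧ RComp (fun q => PMF.pure (expand q)) fun q => (T q : ℝ≥0∞) := by
  have hX := two_le_costScale
  have hself : PowBdd costScale costScale := PowBdd.self
  have hsz : PowBdd costScale fun q => sz q := hself.mono fun q => (sz_expand_le q).1
  obtain ⟨C, hC⟩ := RComp.pow_two
  obtain ⟨T0, h0, c0⟩ := RComp.ofPoly (Poly.fst Poly.id :
    Poly fun q : List (List Bool) × (ℕ × (ℕ × (ℕ × (ℕ × ℕ)))) => q.1)
  obtain ⟨T1, h1, c1⟩ := RComp.ofPoly (Poly.fst (Poly.snd Poly.id) :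
    Poly fun q : List (List Bool) × (ℕ × (ℕ × (ℕ × (ℕ × ℕ)))) => q.2.1)
  obtain ⟨T2, h2, c2⟩ := RComp.ofPoly (Poly.fst (Poly.snd (Poly.snd Poly.id)) :
    Poly fun q : List (List Bool) × (ℕ × (ℕ × (ℕ × (ℕ × ℕ)))) => q.2.2.1)
  obtain ⟨T3, h3, c3⟩ := RComp.ofPoly (Poly.fst (Poly.snd (Poly.snd (Poly.snd Poly.id))) :
    Poly fun q : List (List Bool) × (ℕ × (ℕ × (ℕ × (ℕ × ℕ)))) => q.2.2.2.1)
  obtain ⟨T4, h4, c4⟩ := RComp.ofPoly (Poly.fst (Poly.snd (Poly.snd (Poly.snd (Poly.snd Poly.id)))) :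
    Poly fun q : List (List Bool) × (ℕ × (ℕ × (ℕ × (ℕ × ℕ)))) => q.2.2.2.2.1)
  obtain ⟨T5, h5, c5⟩ := RComp.ofPoly (Poly.snd (Poly.snd (Poly.snd (Poly.snd (Poly.snd Poly.id)))) :
    Poly fun q : List (List Bool) × (ℕ × (ℕ × (ℕ × (ℕ × ℕ)))) => q.2.2.2.2.2)
  have key := c0.pair (c1.pair (c2.pair (c3.pair ((c3.comp hC).pair ((c4.comp hC).pair
    (c5.comp hC))))))
  refine ⟨fun q => T0 q + (T1 q + (T2 q + (T3 q + ((T3 q + costScale q ^ C + 1) +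
    ((T4 q + costScale q ^ C + 1) + (T5 q + costScale q ^ C + 1) + 7) + 7) + 7) + 7) + 7) + 7, ?_,
    (key.congr (g := fun q => PMF.pure (DkS.expand q)) fun q => ?_).mono fun q => ?_⟩
  · have k7 : PowBdd costScale fun _ => 7 := PowBdd.const hX 7
    have k1 : PowBdd costScale fun _ => 1 := PowBdd.const hX 1
    have kC := hself.pow C
    have e (T) (h : PolyBdd T) : PowBdd costScale T := h.powBdd hX hsz
    have p (T) (h : PolyBdd T) : PowBdd costScale fun q => T q + costScale q ^ C + 1 :=
      ((e T h).add hX kC).add hX k1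
    exact ((e _ h0).add hX (((e _ h1).add hX (((e _ h2).add hX (((e _ h3).add hX
      (((p _ h3).add hX (((p _ h4).add hX (p _ h5)).add hX k7)).add hX k7)).add hX k7)).add hX
        k7)).add hX k7)).add hX k7
  · simp [PMF.pure_map, DkS.expand]
  · obtain ⟨-, -, e3, e4, e5⟩ := sz_expand_le q
    have f (n : ℕ) (h : n ≤ costScale q) : ((n ^ C : ℕ) : ℝ≥0∞) ≤ (costScale q : ℝ≥0∞) ^ C := by
      exact_mod_cast Nat.pow_le_pow_left h C
    simp only [expect_pure]
    push_cast
    have g3 := f _ e3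
    have g4 := f _ e4
    have g5 := f _ e5
    push_cast at g3 g4 g5
    gcongr

/-- With guessed numbers `k, ℓ, a, x, y` an attempt costs at most `(40 * sz M * 2 ^ (k + ℓ + a + x +
y)) ^ C`. The choice `D = C + 1` makes each of the five independent exponential factors have mean at
most `2`, so the expected cost is at most `32` times a polynomial in the size of the graph. -/
lemma RComp.trial (P : Cmd) : ∃ D C : ℕ, 1 ≤ D ∧
    RComp (trial P D) fun M => (((sz M + 1) ^ C : ℕ) : ℝ≥0∞) := by
  have hX := two_le_costScale
  obtain ⟨Te, hTe, ce⟩ := RComp.expand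
  obtain ⟨Ta, _, hTa, _, ca, _⟩ := RPoly.attempt P
  have hsz : PowBdd costScale fun q => sz (DkS.expand q) :=
    PowBdd.self.mono fun q => (sz_expand_le q).2.1
  obtain ⟨C, hC⟩ := ((hTe.add hX (hTa.powBdd hX hsz)).add hX (PowBdd.const hX 1))
  have crest : RComp (fun q => DkS.attempt P (DkS.expand q))
      fun q => ((costScale q ^ C : ℕ) : ℝ≥0∞) := by
    refine ((ce.comp ca).congr fun q => ?_).mono fun q => ?_
    · simp
    · rw [expect_pure]
      exact_mod_cast hC q
  obtain ⟨Tg, hTg, cg⟩ := RComp.guesses (α := List (List Bool)) (D := C + 1) (by omega)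
  obtain ⟨Ti, hTi, ci⟩ := RComp.ofPoly (Poly.id : Poly fun M : List (List Bool) => M)
  have hfin : PolyBdd fun M : List (List Bool) => Ti M + Tg M + 7 + (40 * sz M) ^ C * 32 + 1 :=
    (((hTi.add hTg).add (PolyBdd.const 7)).add ((((PolyBdd.const 40).mul PolyBdd.size).pow C).mul
      (PolyBdd.const 32))).add (PolyBdd.const 1)
  obtain ⟨C', hC'⟩ := hfin
  refine ⟨C + 1, C', by omega, (((ci.pair cg).comp crest).congr fun M => ?_).mono fun M => ?_⟩
  · simp [DkS.trial, DkS.expand, PMF.bind_map, Function.comp_def]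
  · have h1 : ((Ti M + Tg M + 7 + (40 * sz M) ^ C * 32 + 1 : ℕ) : ℝ≥0∞) ≤
        (((sz M + 1) ^ C' : ℕ) : ℝ≥0∞) := by exact_mod_cast hC' M
    refine le_trans ?_ h1
    push_cast
    refine add_le_add (add_le_add le_rfl ?_) le_rfl
    rw [expect_bind, expect_pure, expect_map]
    simp only [DkS.guesses, expect_pairP, costScale]
    have hsplit : ∀ k ℓ a x y : ℕ, (((40 * sz M * 2 ^ (k + ℓ + a + x + y)) ^ C : ℕ) : ℝ≥0∞) =
        (40 * (sz M : ℝ≥0∞)) ^ C * ((2 : ℝ≥0∞) ^ (C * k) * (2 ^ (C * ℓ) * (2 ^ (C * a) *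
          (2 ^ (C * x) * 2 ^ (C * y))))) := by
      intro k ℓ a x y
      push_cast
      ring
    have hE := expect_guess_le C
    set E := expect (DkS.guess (C + 1)) (fun m => (2 : ℝ≥0∞) ^ (C * m)) with hEdef
    have hcomm : ∀ (c : ℝ≥0∞), expect (DkS.guess (C + 1)) (fun m => (2 : ℝ≥0∞) ^ (C * m) * c) = E * c := by
      intro c
      simp only [mul_comm _ c]
      rw [expect_mul_left]
    push_cast at hsplit ⊢
    simp only [hsplit, expect_mul_left, hcomm]
    rw [← hEdef]
    gcongr
    calc E * (E * (E * (E * E))) ≤ 2 * (2 * (2 * (2 * 2))) := by gcongr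
      _ = 32 := by norm_num

end

end DkS

/-! ### Sampling planted graphs and the cost of a race -/

namespace DkS

noncomputable section

open Enc (enc sz one_le_sz)

variable {α β γ σ : Type} [Enc α] [Enc β] [Enc γ] [Enc σ]

/-! ### Sampling graphs with a planted clique -/

/-- Square matrices of side `m`. -/
def IsSquare (m : ℕ) (M : List (List Bool)) : Prop := M.length = m ∧ ∀ r ∈ M, r.length = m

lemma IsSquare.sz_eq {m : ℕ} {M : List (List Bool)} (h : IsSquare m M) :
    sz M = m * (2 * m + 2) + 1 := by
  have : ∀ L : List (List Bool), (∀ r ∈ L, r.length = m) → sz L = L.length * (2 * m + 2) + 1 := by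
    intro L
    induction L with
    | nil => intro _; simp [sz_list_nil]
    | cons r L ih =>
      intro hL
      rw [sz_list_cons, ih fun r hr => hL r (List.mem_cons_of_mem _ hr), Poly.sz_list_bool,
        hL r List.mem_cons_self, List.length_cons]
      ring
  rw [this M h.2, h.1]

/-- The adjacency matrix of a complete graph. -/
def completeMatrix (κ : ℕ) : List (List Bool) :=
  (List.range κ).map fun i => (List.range κ).map fun j => !decide (i = j)

lemma isSquare_completeMatrix (κ : ℕ) : IsSquare κ (completeMatrix κ) := by
  constructor
  · simp [completeMatrix]
  · intro r hr
    simp only [completeMatrix, List.mem_map] at hr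
    obtain ⟨i, -, rfl⟩ := hr
    simp

/-- Add a new first vertex whose adjacencies are given by `r`. -/
def addVertex (M : List (List Bool)) (r : List Bool) : List (List Bool) :=
  (false :: r) :: (r.zip M).map fun p => p.1 :: p.2

lemma IsSquare.addVertex {m : ℕ} {M : List (List Bool)} (h : IsSquare m M) {r : List Bool}
    (hr : r.length = m) : IsSquare (m + 1) (addVertex M r) := by
  constructor
  · simp [DkS.addVertex, hr, h.1]
  · intro s hs
    simp only [DkS.addVertex, List.mem_cons, List.mem_map] at hs
    rcases hs with rfl | ⟨p, hp, rfl⟩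
    · simp [hr]
    · have := h.2 p.2 (List.of_mem_zip hp).2
      simp [this]

lemma length_of_mem_support_iid {ι : Type*} {N : ℕ} {μ : PMF ι} {l : List ι}
    (h : l ∈ (iid N μ).support) : l.length = N := by
  induction N generalizing l with
  | zero => simp [iid_zero] at h; simp [h]
  | succ N ih =>
    rw [iid_succ, PMF.mem_support_bind_iff] at h
    obtain ⟨l', hl', h⟩ := h
    rw [PMF.mem_support_map_iff] at h
    obtain ⟨x, -, rfl⟩ := h
    simp [ih hl']

/-- Add a new vertex with random adjacencies. -/
def growStep (M : List (List Bool)) : PMF (List (List Bool)) :=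
  (iid M.length (PMF.uniformOfFintype Bool)).map fun r => addVertex M r

/-- Add `j` new vertices with random adjacencies. -/
def grow (M : List (List Bool)) (j : ℕ) : PMF (List (List Bool)) :=
  foldP (fun M (_ : Bool) => growStep M) M (List.replicate j false)

/-- A random graph on `n` vertices with a clique on the last `κ` vertices. -/
def genP (p : ℕ × ℕ) : PMF (List (List Bool)) := grow (completeMatrix p.2) (p.1 - p.2)

lemma IsSquare.of_mem_grow {m : ℕ} {M M' : List (List Bool)} (h : IsSquare m M) {j : ℕ}
    (h' : M' ∈ (grow M j).support) : IsSquare (m + j) M' := by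
  induction j generalizing m M with
  | zero => simp [grow, foldP] at h'; exact h' ▸ h
  | succ j ih =>
    rw [grow, List.replicate_succ, foldP, PMF.mem_support_bind_iff] at h'
    obtain ⟨M₁, h₁, h'⟩ := h'
    rw [growStep, PMF.mem_support_map_iff] at h₁
    obtain ⟨r, hr, rfl⟩ := h₁
    have := ih (h.addVertex ((length_of_mem_support_iid hr).trans h.1)) h'
    rwa [add_assoc, add_comm 1] at this

lemma isSquare_of_mem_genP {n κ : ℕ} (hκ : κ ≤ n) {M : List (List Bool)}
    (h : M ∈ (genP (n, κ)).support) : IsSquare n M := by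
  have := (isSquare_completeMatrix κ).of_mem_grow h
  simpa [Nat.add_sub_cancel' hκ] using this

lemma RPoly.genP : RPoly genP := by
  have hM : Poly fun q : (ℕ × ℕ) × (List (List Bool) × Bool) => q.2.1 := Poly.fst (Poly.snd Poly.id)
  have hstep : RPoly fun q : (ℕ × ℕ) × (List (List Bool) × Bool) => growStep q.2.1 := by
    refine RPoly.map (g := fun q : ((ℕ × ℕ) × (List (List Bool) × Bool)) × List Bool =>
      addVertex q.1.2.1 q.2) (RPoly.iid RPoly.coin hM.length) ?_
    have h1 : Poly fun q : ((ℕ × ℕ) × (List (List Bool) × Bool)) × List Bool => q.1.2.1 :=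
      hM.comp (Poly.fst Poly.id)
    have h2 : Poly fun q : ((ℕ × ℕ) × (List (List Bool) × Bool)) × List Bool => q.2 :=
      Poly.snd Poly.id
    refine Poly.listCons (Poly.listCons (Poly.const false) h2) ?_
    exact Poly.map (f := fun p : (((ℕ × ℕ) × (List (List Bool) × Bool)) × List Bool) ×
      (Bool × List Bool) => p.2.1 :: p.2.2) (Poly.zip h2 h1 (d := []) enc_list_nil)
      (Poly.listCons (Poly.fst (Poly.snd Poly.id)) (Poly.snd (Poly.snd Poly.id)))
  have hκ : Poly fun p : ℕ × ℕ => p.2 := Poly.snd Poly.id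
  have hcomp : Poly fun p : ℕ × ℕ => completeMatrix p.2 := by
    refine Poly.map (f := fun q : (ℕ × ℕ) × ℕ => (List.range q.1.2).map fun j => !decide (q.2 = j))
      hκ.range ?_
    exact Poly.map (f := fun r : ((ℕ × ℕ) × ℕ) × ℕ => !decide (r.1.2 = r.2))
      (hκ.comp (Poly.fst Poly.id)).range
      (Poly.not (Poly.natEq (Poly.snd (Poly.fst Poly.id)) (Poly.snd Poly.id)))
  have hsz : PolyBdd fun p : ℕ × ℕ => sz p * (2 * sz p + 2) + 1 :=
    (PolyBdd.size.mul (((PolyBdd.const 2).mul PolyBdd.size).add (PolyBdd.const 2))).add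
      (PolyBdd.const 1)
  refine RPoly.fold_of_bound (f := fun q : (ℕ × ℕ) × (List (List Bool) × Bool) => growStep q.2.1)
    (Poly.replicate (Poly.natSub (Poly.fst Poly.id) hκ)) hcomp hstep hsz ?_
  intro p l₁ l₂ hl s hs
  have hrep : l₁ = List.replicate l₁.length false := by
    refine List.eq_replicate_of_mem fun b hb => ?_
    have : b ∈ List.replicate (p.1 - p.2) false := hl ▸ List.mem_append_left _ hb
    exact List.eq_of_mem_replicate this
  have hlen : l₁.length ≤ p.1 - p.2 := by
    have := congrArg List.length hl
    simp at this; omega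
  rw [hrep] at hs
  have hsq := (isSquare_completeMatrix p.2).of_mem_grow (j := l₁.length) hs
  rw [hsq.sz_eq]
  have : p.2 + l₁.length ≤ sz p := by rw [sz_prod, sz_nat, sz_nat]; omega
  gcongr

/-! ### Repeated trials -/

lemma expect_failures_le_indicator {μ : PMF Bool} (h : μ true ≠ 0) (j : ℕ) :
    expect (failures μ) (fun m => if j ≤ m then 1 else 0) = μ false ^ j := by
  induction j with
  | zero => simp
  | succ j ih => rw [expect_failures_unfold h]; simp [ih, pow_succ']

lemma expect_tsum {ι κ : Type*} (μ : PMF ι) (U : κ → ι → ℝ≥0∞) :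
    expect μ (fun x => ∑' j, U j x) = ∑' j, expect μ (U j) := by
  unfold expect
  simp only [← ENNReal.tsum_mul_left]
  exact ENNReal.tsum_comm

/-- The mean of a geometric variable, as the sum of its tail probabilities `μ false ^ j`. -/
lemma expect_failures_succ {μ : PMF Bool} (h : μ true ≠ 0) :
    expect (failures μ) (fun m => (m : ℝ≥0∞) + 1) = (μ true)⁻¹ := by
  have h1 : ∀ m : ℕ, (m : ℝ≥0∞) + 1 = ∑' j : ℕ, if j ≤ m then 1 else 0 := by
    intro m
    rw [tsum_eq_sum (s := Finset.range (m + 1))]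
    · rw [Finset.sum_congr rfl (g := fun _ => 1)]
      · simp
      · intro j hj
        rw [Finset.mem_range] at hj
        rw [if_pos (by omega)]
    · intro j hj
      rw [Finset.mem_range] at hj
      rw [if_neg (by omega)]
  simp only [h1]
  rw [expect_tsum]
  simp only [expect_failures_le_indicator h]
  rw [ENNReal.tsum_geometric]
  congr 1
  exact (ENNReal.eq_sub_of_add_eq (μ.apply_ne_top _) (bool_add μ)).symm

/-- Does one of `l.length` independent trials succeed? -/
def anyP (μ : PMF Bool) (l : List Bool) : PMF Bool :=
  foldP (fun s (_ : Bool) => if s then PMF.pure s else μ) false l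

lemma foldP_or_true {ι : Type*} (g : ι → PMF Bool) (l : List ι) :
    foldP (fun s x => if s then PMF.pure s else g x) true l = PMF.pure true := by
  induction l with
  | nil => rfl
  | cons x l ih => simp [foldP, ih]

lemma foldP_or_false {ι : Type*} (g : ι → PMF Bool) (l : List ι) :
    foldP (fun s x => if s then PMF.pure s else g x) false l false =
      (l.map fun x => g x false).prod := by
  induction l with
  | nil => simp [foldP]
  | cons x l ih =>
    simp only [foldP, Bool.false_eq_true, if_false, List.map_cons, List.prod_cons]
    rw [PMF.bind_apply, tsum_bool, ih, foldP_or_true]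
    simp

lemma anyP_false (μ : PMF Bool) (l : List Bool) : anyP μ l false = μ false ^ l.length := by
  rw [anyP, foldP_or_false (fun _ => μ)]
  simp

lemma RComp.anyP {g : α → PMF Bool} {l : α → List Bool} {T Tl : α → ℝ≥0∞} (hg : RComp g T)
    (hl : RComp (fun a => PMF.pure (l a)) Tl) :
    RComp (fun a => anyP (g a) (l a)) fun a => Tl a + (l a).length * (T a + 30) + 10 := by
  have h1 : RComp (fun q : α × (Bool × Bool) => PMF.pure q.2) fun _ => 1 :=
    RComp.tailVal fun q => rfl
  have h2 : RComp (fun q : Bool × Bool => PMF.pure q.1) fun _ => 1 := RComp.headVal fun q => rfl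
  have h3 : RComp (fun q : α × (Bool × Bool) => PMF.pure q.1) fun _ => 1 :=
    RComp.headVal fun q => rfl
  have hflag := (h1.comp h2).congr (g := fun q => PMF.pure q.2.1) fun q => by simp
  have hf := hflag.cond hflag ((h3.comp hg).congr (g := fun q => g q.1) fun q => by simp)
  have hs : RComp (fun _ : α => PMF.pure false) fun _ => 1 := RComp.clearVal fun _ => rfl
  refine (hl.fold hs hf).mono fun a => ?_
  simp only [expect_const, expect_pure]
  have key : foldCost (fun s (x : Bool) => if s then PMF.pure s else g a)
      (fun s (x : Bool) => ((1 : ℝ≥0∞) + 1 + 1 + (if s then 1 + 1 + 1 else 1 + T a + 1) + 4) + 11)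
      false (l a) ≤ (l a).length * (T a + 30) := by
    refine foldCost_le fun _ _ _ _ s _ => ?_
    cases s
    · simp only [Bool.false_eq_true, if_false]
      calc (1 : ℝ≥0∞) + 1 + 1 + (1 + T a + 1) + 4 + 11 = T a + 20 := by ring
        _ ≤ T a + 30 := by gcongr; norm_num
    · simp only [if_true]
      calc (1 : ℝ≥0∞) + 1 + 1 + (1 + 1 + 1) + 4 + 11 = 21 := by norm_num
        _ ≤ 30 := by norm_num
        _ ≤ T a + 30 := le_add_self
  calc _ ≤ Tl a + 1 + (l a).length * (T a + 30) + 9 := by gcongr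
    _ = _ := by ring

/-- The number of failures before a certificate is found in a random graph on `n` vertices with a
clique of `κ` vertices, for `p = (n, κ)`. -/
def waiting (P : Cmd) (D : ℕ) (p : ℕ × ℕ) : PMF ℕ := (genP p).bind fun M => failures (trial P D M)

/-- Search for a certificate for as many trials as another graph needs. -/
def race (P : Cmd) (D : ℕ) (q : List (List Bool) × ℕ) : PMF Bool :=
  (waiting P D (q.1.length, q.2)).bind fun t =>
    anyP (trial P D q.1) (List.replicate (t + 1) false)

/-- Races for all `κ` with `n ≤ κ ^ q`. -/
def sweep (P : Cmd) (D q : ℕ) (M : List (List Bool)) : PMF Bool :=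
  foldP (fun s κ => if s then PMF.pure s else
    if M.length ≤ κ ^ q then race P D (M, κ) else PMF.pure false) false
    (List.range (M.length + 1))

/-- The algorithm for planted clique: two sweeps. -/
def detect (P : Cmd) (D q : ℕ) (M : List (List Bool)) : PMF Bool :=
  anyP (sweep P D q M) [false, false]

/-- A lower bound for the success probabilities of trials on sampled graphs. -/
def TrialBound (P : Cmd) (D q n : ℕ) (ρ : ℝ≥0∞) : Prop :=
  ∀ κ ≤ n, n ≤ κ ^ q → ∀ M ∈ (genP (n, κ)).support, ρ ≤ trial P D M true

/-- The search on the sampled graph has expected cost polynomial divided by `ρ`. It ends after `t`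
failures with the mean of `t + 1` at most `1 / ρ`, and `t` is independent of the coins of the `t +
1` polynomial trials on the input. The input graph is arbitrary: its own success probability plays
no role for the time, which is what allows the race to stop on graphs without certificates. -/
lemma RComp.race (P : Cmd) : ∃ D : ℕ, 1 ≤ D ∧ ∃ T : List (List Bool) × ℕ → ℝ≥0∞,
    RComp (race P D) T ∧ ∃ C : ℕ, ∀ (n q κ : ℕ) (ρ : ℝ≥0∞) (M : List (List Bool)), IsSquare n M →
      TrialBound P D q n ρ → κ ≤ n → n ≤ κ ^ q → ρ ≠ 0 → ρ ≤ 1 →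
        T (M, κ) ≤ ((n + 2) ^ C : ℕ) / ρ := by
  obtain ⟨D, C, hD, ht⟩ := RComp.trial P
  have hgen := RPoly.genP.comp_poly (Poly.pair (Poly.length (Poly.fst Poly.id)) (Poly.snd Poly.id) :
    Poly fun q : List (List Bool) × ℕ => (q.1.length, q.2))
  obtain ⟨Tg, _, ⟨Cg, hCg⟩, _, hg, _⟩ := hgen
  have hM : RComp (fun q : List (List Bool) × ℕ => PMF.pure q.1) fun _ => 1 :=
    RComp.headVal fun q => rfl
  have ht' : RComp (fun q : List (List Bool) × ℕ => PMF.pure q.2) fun _ => 1 :=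
    RComp.tailVal fun q => rfl
  have hnil : RComp (fun q : List (List Bool) × ℕ => PMF.pure false) fun _ => 1 :=
    RComp.clearVal fun q => rfl
  -- The numeral `t` is already the code of a list of `t` times `false`; consing `nil` onto it gives
  -- the list of length `t + 1`.
  have hl : RComp (fun q : List (List Bool) × ℕ => PMF.pure (List.replicate (q.2 + 1) false))
      fun _ => 9 := by
    have h := ((hnil.pair ht').congr (g := fun q => PMF.pure (false, q.2))
      fun q => by simp [PMF.pure_map]).retype (g := fun q => List.replicate (q.2 + 1) false)
        fun q => by
          rw [List.replicate_succ, enc_list_cons, enc_pair]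
          congr 1
          change Val.ofList ((List.replicate q.2 false).map enc) =
            Val.ofList (List.replicate q.2 Val.nil)
          rw [List.map_replicate]; rfl
    exact h.mono fun q => by norm_num
  have hrun := ((hM.comp ht).congr (g := fun q => DkS.trial P D q.1) fun q => by simp).anyP hl
  have hwait := (hM.pair (hg.comp ht.failures)).comp hrun
  refine ⟨D, hD, _, hwait.congr fun q => ?_, ?_⟩
  · simp [DkS.race, waiting, PMF.bind_map, Function.comp_def]
  · have hX : ∀ n : ℕ, 2 ≤ n + 2 := fun n => by omega
    have hU : PowBdd (fun n : ℕ => n + 2) fun n => n + 2 := PowBdd.self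
    have hc : ∀ k, PowBdd (fun n : ℕ => n + 2) fun _ => k := PowBdd.const hX
    have hsz : PowBdd (fun n : ℕ => n + 2) fun n => n * (2 * n + 2) + 1 + (n + 1) + 1 + 1 := by
      refine (((hU.pow 3).add hX (hU.pow 3))).mono fun n => ?_
      nlinarith [pow_pos (show 0 < n + 2 by omega) 3, sq_nonneg n]
    have hτ := hsz.pow C
    obtain ⟨E, hE⟩ := ((hsz.pow Cg).add hX ((hτ.add hX (hc 100)).mul (hc 100)))
    refine ⟨E, fun n q κ ρ M hMn hρ hκ hκq h0 h1 => ?_⟩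
    have hszM := hMn.sz_eq
    set X := n * (2 * n + 2) + 1 + (n + 1) + 1 + 1 with hXdef
    have e1 : Tg (M, κ) ≤ X ^ Cg := (hCg _).trans (Nat.pow_le_pow_left (by
      rw [sz_pair, sz_nat, hszM]; omega) _)
    have eτ : ∀ M', IsSquare n M' → (((sz M' + 1) ^ C : ℕ) : ℝ≥0∞) ≤ (X : ℝ≥0∞) ^ C := by
      intro M' h'
      have : (sz M' + 1) ^ C ≤ X ^ C := Nat.pow_le_pow_left (by rw [h'.sz_eq]; omega) _
      exact_mod_cast this
    have ewait : expect (genP (n, κ)) (fun M' => (((sz M' + 1) ^ C : ℕ) + 12) / DkS.trial P D M' true + 8)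
        ≤ ((X : ℝ≥0∞) ^ C + 12) / ρ + 8 := by
      refine expect_le_of_support fun M' hM' => ?_
      have := eτ M' (isSquare_of_mem_genP hκ hM')
      have := hρ κ hκ hκq M' hM'
      gcongr
    have etime : expect (genP (n, κ)) (fun M' => expect (DkS.failures (DkS.trial P D M'))
        fun t => (t : ℝ≥0∞) + 1) ≤ ρ⁻¹ := by
      refine expect_le_of_support fun M' hM' => ?_
      have h2 := hρ κ hκ hκq M' hM'
      rw [expect_failures_succ (fun h => h0 (by rw [h] at h2; exact le_zero_iff.1 h2))]
      exact ENNReal.inv_le_inv.2 h2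
    have hlen : (M, κ).1.length = n := hMn.1
    simp only [expect_pure, expect_bind, expect_map, List.length_replicate]
    simp only [hlen]
    have emain : expect (genP (n, κ)) (fun M' => expect (DkS.failures (DkS.trial P D M')) fun t =>
        9 + ((t + 1 : ℕ) : ℝ≥0∞) * (1 + (((sz M + 1) ^ C : ℕ) : ℝ≥0∞) + 1 + 30) + 10) ≤
        19 + (X ^ C + 32 : ℝ≥0∞) * ρ⁻¹ := by
      have : ∀ t : ℕ, 9 + ((t + 1 : ℕ) : ℝ≥0∞) * (1 + (((sz M + 1) ^ C : ℕ) : ℝ≥0∞) + 1 + 30) + 10 ≤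
          19 + (X ^ C + 32 : ℝ≥0∞) * (t + 1) := by
        intro t
        have := eτ M hMn
        calc 9 + ((t + 1 : ℕ) : ℝ≥0∞) * (1 + (((sz M + 1) ^ C : ℕ) : ℝ≥0∞) + 1 + 30) + 10
            ≤ 9 + ((t + 1 : ℕ) : ℝ≥0∞) * (1 + (X : ℝ≥0∞) ^ C + 1 + 30) + 10 := by gcongr
          _ = _ := by push_cast; ring
      calc _ ≤ expect (genP (n, κ)) (fun M' => expect (DkS.failures (DkS.trial P D M')) fun t =>
          19 + (X ^ C + 32 : ℝ≥0∞) * (t + 1)) := expect_mono fun M' => expect_mono this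
        _ = 19 + (X ^ C + 32 : ℝ≥0∞) * expect (genP (n, κ)) (fun M' =>
            expect (DkS.failures (DkS.trial P D M')) fun t => (t : ℝ≥0∞) + 1) := by
          simp only [expect_add, expect_const, expect_mul_left]
        _ ≤ _ := by gcongr
    have h19 : (1 : ℝ≥0∞) ≤ ρ⁻¹ := ENNReal.one_le_inv.2 h1
    have hEn : ((X ^ Cg + (X ^ C + 100) * 100 : ℕ) : ℝ≥0∞) ≤ ((n + 2) ^ E : ℕ) := by
      exact_mod_cast hE n
    have e1' : (Tg (M, κ) : ℝ≥0∞) ≤ (X : ℝ≥0∞) ^ Cg := by exact_mod_cast e1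
    calc _ ≤ 1 + ((X : ℝ≥0∞) ^ Cg + (((X : ℝ≥0∞) ^ C + 12) / ρ + 8) + 1) + 7 +
        (19 + (X ^ C + 32 : ℝ≥0∞) * ρ⁻¹) + 1 := by gcongr
      _ = (X : ℝ≥0∞) ^ Cg * 1 + (2 * X ^ C + 44) * ρ⁻¹ + 37 * 1 := by rw [div_eq_mul_inv]; ring
      _ ≤ (X : ℝ≥0∞) ^ Cg * ρ⁻¹ + (2 * X ^ C + 44) * ρ⁻¹ + 37 * ρ⁻¹ := by gcongr
      _ = ((X : ℝ≥0∞) ^ Cg + (2 * X ^ C + 81)) * ρ⁻¹ := by ring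
      _ ≤ ((X : ℝ≥0∞) ^ Cg + (X ^ C + 100) * 100) * ρ⁻¹ := by
        gcongr
        calc 2 * (X : ℝ≥0∞) ^ C + 81 ≤ 100 * X ^ C + 10000 := by gcongr <;> norm_num
          _ = _ := by ring
      _ ≤ ((n + 2) ^ E : ℕ) * ρ⁻¹ := by
        gcongr
        exact_mod_cast hEn
      _ = _ := by rw [div_eq_mul_inv]

/-- Each of the two sweeps consists of at most `n + 1` races, and those that are actually run
satisfy `κ ≤ n ≤ κ ^ q`, the range in which `TrialBound` applies. -/
lemma RComp.detect (P : Cmd) (q : ℕ) : ∃ D : ℕ, 1 ≤ D ∧ ∃ T : List (List Bool) → ℝ≥0∞,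
    RComp (detect P D q) T ∧ ∃ C : ℕ, ∀ (n : ℕ) (ρ : ℝ≥0∞) (M : List (List Bool)), IsSquare n M →
      TrialBound P D q n ρ → ρ ≠ 0 → ρ ≤ 1 → T M ≤ ((n + 2) ^ C : ℕ) / ρ := by
  obtain ⟨D, hD, Tr, hr, C, hC⟩ := RComp.race P
  have pM : Poly fun p : List (List Bool) × (Bool × ℕ) => p.1 := Poly.fst Poly.id
  have ps : Poly fun p : List (List Bool) × (Bool × ℕ) => p.2.1 := Poly.fst (Poly.snd Poly.id)
  have pκ : Poly fun p : List (List Bool) × (Bool × ℕ) => p.2.2 := Poly.snd (Poly.snd Poly.id)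
  obtain ⟨T1, ⟨C1, h1⟩, c1⟩ := RComp.ofPoly
    (Poly.and (Poly.not ps) (Poly.natLe (Poly.length pM) (Poly.natPow pκ q)))
  obtain ⟨T2, ⟨C2, h2⟩, c2⟩ := RComp.ofPoly ps
  obtain ⟨T3, ⟨C3, h3⟩, c3⟩ := RComp.ofPoly (Poly.pair pM pκ)
  obtain ⟨T4, ⟨C4, h4⟩, c4⟩ := RComp.ofPoly
    (Poly.range (Poly.natSucc (Poly.length (Poly.id : Poly fun M : List (List Bool) => M))))
  have hs : RComp (fun _ : List (List Bool) => PMF.pure false) fun _ => 1 :=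
    RComp.clearVal fun _ => rfl
  have hstep := c1.cond ((c3.comp hr).congr (g := fun p => DkS.race P D (p.1, p.2.2))
    fun p => by simp) c2
  have hsweep := (c4.fold hs hstep).congr (g := DkS.sweep P D q) fun M => by
    unfold DkS.sweep
    congr 1
    funext s κ
    cases s <;> by_cases h : M.length ≤ κ ^ q <;> simp [h]
  obtain ⟨T5, ⟨C5, h5⟩, c5⟩ := RComp.ofPoly
    (Poly.const [false, false] : Poly fun _ : List (List Bool) => [false, false])
  refine ⟨D, hD, _, hsweep.anyP c5, ?_⟩
  have hX : ∀ n : ℕ, 2 ≤ n + 2 := fun n => by omega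
  have hU : PowBdd (fun n : ℕ => n + 2) fun n => n + 2 := PowBdd.self
  have hc : ∀ k, PowBdd (fun n : ℕ => n + 2) fun _ => k := PowBdd.const hX
  have hsz : PowBdd (fun n : ℕ => n + 2) fun n => n * (2 * n + 2) + n + 10 := by
    refine (((hU.pow 3).add hX (hc 10))).mono fun n => ?_
    nlinarith [pow_pos (show 0 < n + 2 by omega) 3, sq_nonneg n]
  obtain ⟨E, hE⟩ := ((((hsz.pow C5).add hX (hsz.pow C4)).add hX (hU.mul ((((hsz.pow C1).add hX
    (hsz.pow C2)).add hX (hsz.pow C3)).add hX (hU.pow C)))).add hX (hU.mul (hc 1))).mul (hc 400)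
  refine ⟨E, fun n ρ M hMn hρ h0 hle => ?_⟩
  have hszM := hMn.sz_eq
  set X := n * (2 * n + 2) + n + 10 with hXdef
  have hinv : (1 : ℝ≥0∞) ≤ ρ⁻¹ := ENNReal.one_le_inv.2 hle
  have hszp : ∀ (s : Bool) (κ : ℕ), κ ≤ n → sz (M, (s, κ)) + 1 ≤ X := by
    intro s κ hκ
    rw [sz_pair, sz_pair, sz_nat, sz_bool, hszM]
    omega
  have b1 : ∀ (s : Bool) (κ : ℕ), κ ≤ n → (T1 (M, (s, κ)) : ℝ≥0∞) ≤ (X : ℝ≥0∞) ^ C1 := by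
    intro s κ hκ
    exact_mod_cast (h1 _).trans (Nat.pow_le_pow_left (hszp s κ hκ) _)
  have b2 : ∀ (s : Bool) (κ : ℕ), κ ≤ n → (T2 (M, (s, κ)) : ℝ≥0∞) ≤ (X : ℝ≥0∞) ^ C2 := by
    intro s κ hκ
    exact_mod_cast (h2 _).trans (Nat.pow_le_pow_left (hszp s κ hκ) _)
  have b3 : ∀ (s : Bool) (κ : ℕ), κ ≤ n → (T3 (M, (s, κ)) : ℝ≥0∞) ≤ (X : ℝ≥0∞) ^ C3 := by
    intro s κ hκ
    exact_mod_cast (h3 _).trans (Nat.pow_le_pow_left (hszp s κ hκ) _)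
  have b4 : (T4 M : ℝ≥0∞) ≤ (X : ℝ≥0∞) ^ C4 := by
    exact_mod_cast (h4 _).trans (Nat.pow_le_pow_left (by rw [hszM]; omega) _)
  have b5 : (T5 M : ℝ≥0∞) ≤ (X : ℝ≥0∞) ^ C5 := by
    exact_mod_cast (h5 _).trans (Nat.pow_le_pow_left (by rw [hszM]; omega) _)
  set Y : ℝ≥0∞ := (X : ℝ≥0∞) ^ C1 + X ^ C2 + X ^ C3 + ((n + 2 : ℕ) : ℝ≥0∞) ^ C with hY
  have key : foldCost (fun s κ => if (!s && decide (M.length ≤ κ ^ q)) = true then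
        DkS.race P D (M, κ) else PMF.pure s)
      (fun s κ => (T1 (M, (s, κ)) : ℝ≥0∞) + (if (!s && decide (M.length ≤ κ ^ q)) = true then
        (T3 (M, (s, κ)) : ℝ≥0∞) + Tr (M, κ) + 1 else (T2 (M, (s, κ)) : ℝ≥0∞)) + 4 + 11) false
      (List.range (M.length + 1)) ≤ (List.range (M.length + 1)).length * ((Y + 16) * ρ⁻¹) := by
    refine foldCost_le fun l₁ κ l₂ hl s _ => ?_
    have hκ : κ ≤ n := by
      have : κ ∈ List.range (M.length + 1) := by rw [hl]; simp
      rw [List.mem_range, hMn.1] at this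
      omega
    have hr' : (!s && decide (M.length ≤ κ ^ q)) = true →
        Tr (M, κ) ≤ ((n + 2 : ℕ) : ℝ≥0∞) ^ C * ρ⁻¹ := by
      intro h
      simp only [Bool.and_eq_true, decide_eq_true_eq, hMn.1] at h
      refine (hC n q κ ρ M hMn hρ hκ h.2 h0 hle).trans ?_
      rw [div_eq_mul_inv]; push_cast; exact le_rfl
    have hb : (if (!s && decide (M.length ≤ κ ^ q)) = true then
        (T3 (M, (s, κ)) : ℝ≥0∞) + Tr (M, κ) + 1 else (T2 (M, (s, κ)) : ℝ≥0∞)) ≤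
        X ^ C2 + X ^ C3 + ((n + 2 : ℕ) : ℝ≥0∞) ^ C * ρ⁻¹ + 1 := by
      split_ifs with h
      · have h1 := b3 s κ hκ
        have h2 := hr' h
        calc _ ≤ (X : ℝ≥0∞) ^ C3 + ((n + 2 : ℕ) : ℝ≥0∞) ^ C * ρ⁻¹ + 1 := by gcongr
          _ ≤ _ := by gcongr; exact le_add_self
      · refine (b2 s κ hκ).trans ?_
        rw [add_assoc, add_assoc]
        exact le_self_add
    calc _ ≤ (X : ℝ≥0∞) ^ C1 + (X ^ C2 + X ^ C3 + ((n + 2 : ℕ) : ℝ≥0∞) ^ C * ρ⁻¹ + 1) + 4 + 11 := by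
          gcongr
          exact b1 s κ hκ
      _ = (X ^ C1 + X ^ C2 + X ^ C3 + 16) * 1 + ((n + 2 : ℕ) : ℝ≥0∞) ^ C * ρ⁻¹ := by ring
      _ ≤ (X ^ C1 + X ^ C2 + X ^ C3 + 16) * ρ⁻¹ + ((n + 2 : ℕ) : ℝ≥0∞) ^ C * ρ⁻¹ := by gcongr
      _ = _ := by rw [hY]; ring
  have hlen : (List.range (M.length + 1)).length = n + 1 := by simp [hMn.1]
  rw [hlen] at key
  simp only [expect_pure]
  have hEn : (((X ^ C5 + X ^ C4 + (n + 2) * (X ^ C1 + X ^ C2 + X ^ C3 + (n + 2) ^ C) + (n + 2) * 1)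
      * 400 : ℕ) : ℝ≥0∞) ≤ ((n + 2) ^ E : ℕ) := by exact_mod_cast hE n
  calc _ ≤ (X : ℝ≥0∞) ^ C5 + (([false, false] : List Bool).length : ℝ≥0∞) * (X ^ C4 + 1 +
        ((n + 1 : ℕ) : ℝ≥0∞) * ((Y + 16) * ρ⁻¹) + 9 + 30) + 10 := by gcongr
    _ = (X ^ C5 + 2 * X ^ C4 + 90) * 1 + (2 * (n + 1)) * (Y + 16) * ρ⁻¹ := by
      push_cast; simp only [List.length_cons, List.length_nil]; push_cast; ring
    _ ≤ (X ^ C5 + 2 * X ^ C4 + 90) * ρ⁻¹ + (2 * (n + 1)) * (Y + 16) * ρ⁻¹ := by gcongr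
    _ = (X ^ C5 + 2 * X ^ C4 + 90 + 2 * ((n + 1) * (Y + 16))) * ρ⁻¹ := by ring
    _ ≤ (400 * X ^ C5 + 400 * X ^ C4 + 90 + 2 * ((n + 2) * (Y + 16))) * ρ⁻¹ := by
      gcongr
      · exact le_mul_of_one_le_left' (by norm_num)
      · norm_num
      · norm_num
    _ ≤ ((n + 2) ^ E : ℕ) * ρ⁻¹ := by
      gcongr
      refine le_trans ?_ hEn
      rw [hY]
      push_cast
      have hn2 : (2 : ℝ≥0∞) ≤ n + 2 := le_add_self
      calc 400 * (X : ℝ≥0∞) ^ C5 + 400 * X ^ C4 + 90 + 2 * ((n + 2) * ((X : ℝ≥0∞) ^ C1 + X ^ C2 +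
            X ^ C3 + (n + 2) ^ C + 16))
          ≤ 400 * (X : ℝ≥0∞) ^ C5 + 400 * X ^ C4 + (n + 2) * 90 + 400 * ((n + 2) *
            ((X : ℝ≥0∞) ^ C1 + X ^ C2 + X ^ C3 + (n + 2) ^ C)) + 32 * (n + 2) := by
            have e90 : (90 : ℝ≥0∞) ≤ (n + 2) * 90 := le_mul_of_one_le_left' (le_trans (by norm_num) hn2)
            have e2 : 2 * ((n + 2) * ((X : ℝ≥0∞) ^ C1 + X ^ C2 + X ^ C3 + (n + 2) ^ C)) ≤
              400 * ((n + 2) * ((X : ℝ≥0∞) ^ C1 + X ^ C2 + X ^ C3 + (n + 2) ^ C)) := by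
              gcongr; norm_num
            calc _ = 400 * (X : ℝ≥0∞) ^ C5 + 400 * X ^ C4 + 90 + 2 * ((n + 2) * ((X : ℝ≥0∞) ^ C1 +
                  X ^ C2 + X ^ C3 + (n + 2) ^ C)) + 32 * (n + 2) := by ring
              _ ≤ _ := by gcongr
        _ = 400 * (X : ℝ≥0∞) ^ C5 + 400 * X ^ C4 + 400 * ((n + 2) *
            ((X : ℝ≥0∞) ^ C1 + X ^ C2 + X ^ C3 + (n + 2) ^ C)) + 122 * (n + 2) := by ring
        _ ≤ 400 * (X : ℝ≥0∞) ^ C5 + 400 * X ^ C4 + 400 * ((n + 2) *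
            ((X : ℝ≥0∞) ^ C1 + X ^ C2 + X ^ C3 + (n + 2) ^ C)) + 400 * (n + 2) := by
              gcongr; norm_num
        _ = _ := by ring
    _ = _ := by rw [div_eq_mul_inv]

end

end DkS

/-! ### From lists of bits to functions, sets and marked pairs -/

namespace DkS

noncomputable section

open Enc (enc sz one_le_sz)

/-! ### Product distributions -/

/-- The distribution of `N` independent samples, as a distribution on functions. -/
def piP {ι : Type*} : (N : ℕ) → PMF ι → PMF (Fin N → ι)
  | 0, _ => PMF.pure Fin.elim0
  | N + 1, μ => (piP N μ).bind fun f => μ.map fun x => (Fin.cons x f : Fin (N + 1) → ι)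

lemma iid_eq_map_piP {ι : Type*} (N : ℕ) (μ : PMF ι) : iid N μ = (piP N μ).map List.ofFn := by
  induction N with
  | zero => simp [iid_zero, piP, PMF.pure_map]
  | succ N ih =>
    rw [iid_succ, ih, piP, PMF.map_bind, PMF.bind_map]
    congr 1
    funext f
    simp [PMF.map_comp, Function.comp_def]

lemma piP_apply {ι : Type*} (N : ℕ) (μ : PMF ι) (f : Fin N → ι) : piP N μ f = ∏ i, μ (f i) := by
  classical
  induction N with
  | zero =>
    have : f = Fin.elim0 := Subsingleton.elim _ _
    simp [piP, this]
  | succ N ih =>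
    rw [apply_eq_expect, piP, expect_bind]
    simp only [expect_map]
    have h : ∀ g : Fin N → ι, expect μ (fun x => if (Fin.cons x g : Fin (N + 1) → ι) = f then
        (1 : ℝ≥0∞) else 0) = μ (f 0) * if g = Fin.tail f then 1 else 0 := by
      intro g
      rw [apply_eq_expect μ (f 0), mul_comm, ← expect_mul_left]
      congr 1
      funext x
      have : (Fin.cons x g : Fin (N + 1) → ι) = f ↔ g = Fin.tail f ∧ x = f 0 := by
        constructor
        · rintro rfl; simp
        · rintro ⟨rfl, rfl⟩; simp
      simp only [this]
      by_cases h1 : g = Fin.tail f <;> by_cases h2 : x = f 0 <;> simp [h1, h2]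
    simp only [h]
    rw [expect_mul_left, ← apply_eq_expect, ih, Fin.prod_univ_succ]
    rfl

/-- Independence: expectations of products over the coordinates factor. Every estimate for the
random sets below rests on this. -/
lemma expect_piP_prod {ι : Type*} [Fintype ι] (N : ℕ) (μ : PMF ι) (U : Fin N → ι → ℝ≥0∞) :
    expect (piP N μ) (fun f => ∏ i, U i (f i)) = ∏ i, expect μ (U i) := by
  classical
  simp only [expect_fintype, piP_apply, ← Finset.prod_mul_distrib]
  rw [Finset.prod_univ_sum]
  simp

/-! ### Matrices and vertex sets as functions -/

/-- The list of rows. -/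
def mat {m n : ℕ} (A : Fin m → Fin n → Bool) : List (List Bool) :=
  List.ofFn fun i => List.ofFn (A i)

open Classical in
/-- The adjacency matrix of a graph. -/
def adj {n : ℕ} (G : SimpleGraph (Fin n)) (i j : Fin n) : Bool := decide (G.Adj i j)

lemma adj_iff {n : ℕ} {G : SimpleGraph (Fin n)} {i j : Fin n} : adj G i j = true ↔ G.Adj i j := by
  simp [adj]

lemma isSquare_mat {n : ℕ} (A : Fin n → Fin n → Bool) : IsSquare n (mat A) := by
  refine ⟨by simp [mat], fun r hr => ?_⟩
  rw [mat, List.mem_ofFn] at hr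
  obtain ⟨i, rfl⟩ := hr
  simp

lemma enc_ofFn {α : Type} [Enc α] {n : ℕ} (f : Fin n → α) :
    enc (List.ofFn f) = Val.ofList (List.ofFn fun i => enc (f i)) := by
  change Val.ofList ((List.ofFn f).map enc) = _
  rw [List.map_ofFn]
  rfl

lemma enc_mat_adj {n : ℕ} (G : SimpleGraph (Fin n)) : enc (mat (adj G)) = encodeGraph G := by
  simp only [mat, enc_ofFn]
  rfl

lemma enc_instance {n : ℕ} (G : SimpleGraph (Fin n)) (k : ℕ) :
    enc (mat (adj G), k) = encodeInstance G k := by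
  rw [enc_pair, enc_mat_adj]
  rfl

lemma zip_ofFn {α β : Type*} {n : ℕ} (f : Fin n → α) (g : Fin n → β) :
    (List.ofFn f).zip (List.ofFn g) = List.ofFn fun i => (f i, g i) := by
  apply List.ext_getElem <;> simp

/-- The elements of a set given by a characteristic function. -/
def supp {n : ℕ} (s : Fin n → Bool) : Finset (Fin n) := Finset.univ.filter fun i => s i = true

@[simp] lemma mem_supp {n : ℕ} {s : Fin n → Bool} {i : Fin n} : i ∈ supp s ↔ s i = true := by
  simp [supp]

/-- All pairs from `s × s'` are adjacent. -/
def Complete {n : ℕ} (A : Fin n → Fin n → Bool) (s s' : Fin n → Bool) : Prop :=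
  ∀ i ∈ supp s, ∀ j ∈ supp s', A i j = true

lemma completeB_mat {n : ℕ} (A : Fin n → Fin n → Bool) (s s' : Fin n → Bool) :
    completeB (mat A) (List.ofFn s) (List.ofFn s') = true ↔ Complete A s s' := by
  simp only [completeB, mat, zip_ofFn, List.all_eq_true, List.forall_mem_ofFn_iff, Complete,
    mem_supp, Bool.or_eq_true, Bool.not_eq_true']
  refine forall_congr' fun i => ?_
  cases s i
  · simp
  · simp only [Bool.true_eq_false, false_or, forall_true_left]
    refine forall_congr' fun j => ?_
    cases s' j <;> simp

lemma countP_ofFn {n : ℕ} (s : Fin n → Bool) :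
    (List.ofFn s).countP (fun b => b) = (supp s).card := by
  induction n with
  | zero => simp [supp]
  | succ n ih =>
    rw [List.ofFn_succ, List.countP_cons, ih]
    simp only [supp, Fin.univ_succ, Finset.filter_cons, Finset.filter_map]
    cases s 0
    · simp
    · simp

lemma validB_ofFn {n : ℕ} (ℓ : ℕ) (s : Fin n → Bool) :
    validB ℓ (List.ofFn s) = decide ((supp s).card = ℓ) := by
  rw [validB, countP_ofFn]

open Classical in
/-- Adjacency in the graph on sets of `ℓ` vertices. -/
def blow {n N : ℕ} (A : Fin n → Fin n → Bool) (ℓ : ℕ) (S : Fin N → Fin n → Bool) (i j : Fin N) :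
    Bool :=
  decide ((supp (S i)).card = ℓ ∧ (supp (S j)).card = ℓ ∧ Complete A (S i) (S j))

lemma blow_iff {n N : ℕ} {A : Fin n → Fin n → Bool} {ℓ : ℕ} {S : Fin N → Fin n → Bool}
    {i j : Fin N} : blow A ℓ S i j = true ↔
      (supp (S i)).card = ℓ ∧ (supp (S j)).card = ℓ ∧ Complete A (S i) (S j) := by
  simp [blow]

lemma blowup_mat {n N : ℕ} (A : Fin n → Fin n → Bool) (ℓ : ℕ) (S : Fin N → Fin n → Bool) :
    blowup (mat A) ℓ (mat S) = mat (blow A ℓ S) := by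
  simp only [blowup, mat, List.map_ofFn]
  congr 1
  funext i
  simp only [Function.comp_def]
  congr 1
  funext j
  rw [Bool.eq_iff_iff, blow_iff]
  have := completeB_mat A (S i) (S j)
  simp only [mat] at this
  simp [validB_ofFn, this]

/-- The elements with property `p` among those selected by `v`. -/
def selBy {ι : Type*} (p : ι → Bool) : List ι → Val → List ι
  | [], _ => []
  | x :: L, v => if isTrue v.head && p x then x :: selBy p L v.tail else selBy p L v.tail

lemma selectSets_eq_selBy (ℓ : ℕ) (L : List (List Bool)) (v : Val) :
    selectSets ℓ L v = selBy (validB ℓ) L v := by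
  induction L generalizing v with
  | nil => rfl
  | cons x L ih => simp [selectSets, selBy, ih]

lemma selBy_map {ι κ : Type*} (g : ι → κ) (p : κ → Bool) (L : List ι) (v : Val) :
    selBy p (L.map g) v = (selBy (fun x => p (g x)) L v).map g := by
  induction L generalizing v with
  | nil => rfl
  | cons x L ih =>
    simp only [List.map_cons, selBy, ih]
    split_ifs <;> simp

lemma selBy_prop {ι : Type*} {p : ι → Bool} {L : List ι} {v : Val} {x : ι} (h : x ∈ selBy p L v) :
    p x = true := by
  induction L generalizing v with
  | nil => simp [selBy] at h
  | cons y L ih =>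
    simp only [selBy] at h
    split_ifs at h with h'
    · rcases List.mem_cons.1 h with rfl | h
      · simp at h'; exact h'.2
      · exact ih h
    · exact ih h

open Classical in
/-- The pairs in `s × s'` for `s, s'` in `C` such that all these pairs are adjacent. -/
def marked {n : ℕ} (A : Fin n → Fin n → Bool) (C : List (Fin n → Bool)) : Finset (Fin n × Fin n) :=
  Finset.univ.filter fun p => ∃ s ∈ C, ∃ s' ∈ C, Complete A s s' ∧ p.1 ∈ supp s ∧ p.2 ∈ supp s'

lemma mem_marked {n : ℕ} {A : Fin n → Fin n → Bool} {C : List (Fin n → Bool)}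
    {p : Fin n × Fin n} : p ∈ marked A C ↔
      ∃ s ∈ C, ∃ s' ∈ C, Complete A s s' ∧ p.1 ∈ supp s ∧ p.2 ∈ supp s' := by
  simp [marked]

lemma addMarks_mat {n : ℕ} (B : Fin n → Fin n → Bool) (s s' : Fin n → Bool) :
    addMarks (mat B) (List.ofFn s) (List.ofFn s') = mat fun i j => B i j || (s i && s' j) := by
  simp only [addMarks, mat, zip_ofFn, List.map_ofFn]
  congr 1
  funext i
  simp only [Function.comp_def, zip_ofFn, List.map_ofFn]
  cases s i <;> simp

open Classical in
lemma marks_mat {n : ℕ} (A : Fin n → Fin n → Bool) (C : List (Fin n → Bool)) :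
    marks (mat A) (C.map List.ofFn) = mat fun i j => decide ((i, j) ∈ marked A C) := by
  have inner : ∀ (s : Fin n → Bool) (L : List (Fin n → Bool)) (B : Fin n → Fin n → Bool),
      (L.map List.ofFn).foldl (fun mat' s' => if completeB (mat A) (List.ofFn s) s' then
        addMarks mat' (List.ofFn s) s' else mat') (mat B) =
      mat fun i j => B i j || decide (∃ s' ∈ L, Complete A s s' ∧ i ∈ supp s ∧ j ∈ supp s') := by
    intro s L
    induction L with
    | nil => simp
    | cons s' L ih =>
      intro B
      rw [List.map_cons, List.foldl_cons]
      by_cases h : Complete A s s'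
      · rw [if_pos ((completeB_mat A s s').2 h), addMarks_mat, ih]
        congr 1
        funext i j
        rw [Bool.eq_iff_iff]
        simp [h]
        tauto
      · rw [if_neg (fun h' => h ((completeB_mat A s s').1 h')), ih]
        congr 1
        funext i j
        simp [h]
  have outer : ∀ (L : List (Fin n → Bool)) (B : Fin n → Fin n → Bool),
      (L.map List.ofFn).foldl (fun mat' s => (C.map List.ofFn).foldl (fun mat' s' =>
        if completeB (mat A) s s' then addMarks mat' s s' else mat') mat') (mat B) =
      mat fun i j => B i j ||
        decide (∃ s ∈ L, ∃ s' ∈ C, Complete A s s' ∧ i ∈ supp s ∧ j ∈ supp s') := by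
    intro L
    induction L with
    | nil => simp
    | cons s L ih =>
      intro B
      rw [List.map_cons, List.foldl_cons, inner, ih]
      congr 1
      funext i j
      rw [Bool.eq_iff_iff]
      simp only [Bool.or_eq_true, decide_eq_true_eq, List.mem_cons, exists_eq_or_imp,
        or_assoc]
  have h0 : ((mat A).map fun row => row.map fun _ => false) = mat fun _ _ : Fin n => false := by
    simp only [mat, List.map_ofFn, Function.comp_def]
  rw [marks, h0, outer]
  congr 1
  funext i j
  simp [mem_marked]

lemma countMarks_mat {n : ℕ} (F : Finset (Fin n × Fin n)) :
    countMarks (mat fun i j => decide ((i, j) ∈ F)) = F.card := by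
  simp only [countMarks, mat, List.map_ofFn, Function.comp_def, countP_ofFn, List.sum_ofFn]
  rw [Finset.card_eq_sum_card_fiberwise (f := Prod.fst) (t := Finset.univ) (by simp)]
  refine Finset.sum_congr rfl fun i _ => ?_
  refine Finset.card_bij (fun j _ => (i, j)) ?_ ?_ ?_
  · intro j hj; simpa using hj
  · intro j _ j' _ h; simpa using h
  · rintro ⟨i', j⟩ h
    simp only [Finset.mem_filter] at h
    obtain ⟨h, rfl⟩ := h
    exact ⟨j, by simpa using h, rfl⟩

/-- Many more marked pairs than it takes bits to describe them. -/
def IsCert {n : ℕ} (A : Fin n → Fin n → Bool) (a ℓ : ℕ) (C : List (Fin n → Bool)) : Prop :=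
  4 * (C.length * ℓ * a + C.length * C.length) < (marked A C).card

/-- The sets of `ℓ` elements among those selected by `v`. -/
def chosen {n N : ℕ} (ℓ : ℕ) (S : Fin N → Fin n → Bool) (v : Val) : List (Fin n → Bool) :=
  selBy (fun s => decide ((supp s).card = ℓ)) (List.ofFn S) v

lemma checkB_mat {n N : ℕ} (A : Fin n → Fin n → Bool) (a ℓ : ℕ) (S : Fin N → Fin n → Bool)
    (v : Val) : checkB (mat A) a (2 ^ a) ℓ (mat S) v = true ↔
      n ≤ 2 ^ a ∧ IsCert A a ℓ (chosen ℓ S v) := by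
  have h : selectSets ℓ (mat S) v = (chosen ℓ S v).map List.ofFn := by
    have : mat S = (List.ofFn S).map List.ofFn := by simp [mat, List.map_ofFn, Function.comp_def]
    rw [selectSets_eq_selBy, this, selBy_map]
    simp only [validB_ofFn]
    rfl
  simp only [checkB, h, marks_mat, countMarks_mat]
  simp [mat, IsCert]

open Classical in
lemma attempt_mat (P : Cmd) {n : ℕ} (A : Fin n → Fin n → Bool) (k ℓ a N B : ℕ) :
    attempt P (mat A, k, ℓ, a, 2 ^ a, N, B) true =
      expect (piP N (piP n (rareBit a))) fun S =>
        expect (run B (start P (enc (mat (blow A ℓ S), k)))) fun c =>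
          if (readOutput c).1 = true ∧ n ≤ 2 ^ a ∧ IsCert A a ℓ (chosen ℓ S (readOutput c).2) then 1
            else 0 := by
  have hlen : (mat A).length = n := by simp [mat]
  have hiid : iid N (iid n (rareBit a)) = (piP N (piP n (rareBit a))).map mat := by
    rw [iid_eq_map_piP n]
    have : ∀ N (μ : PMF (Fin n → Bool)), iid N (μ.map List.ofFn) = (iid N μ).map
        (List.map List.ofFn) := by
      intro N μ
      induction N with
      | zero => simp [iid_zero, PMF.pure_map]
      | succ N ih =>
        rw [iid_succ, iid_succ, ih, PMF.map_bind, PMF.bind_map]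
        simp [PMF.map_comp, Function.comp_def]
    rw [this, iid_eq_map_piP, PMF.map_comp]
    congr 1
    funext S
    simp [mat, List.map_ofFn, Function.comp_def]
  rw [apply_eq_expect, attempt]
  simp only [hlen, hiid, expect_bind, expect_map, blowup_mat]
  congr 1
  funext S
  congr 1
  funext c
  refine if_congr ?_ rfl rfl
  rw [Bool.and_eq_true, checkB_mat]

end

end DkS

/-! ### Symmetry of trials, soundness, and exchangeability of waiting times -/

namespace DkS

noncomputable section

open Enc (enc sz one_le_sz)

/-! ### Invariance under relabeling -/

lemma card_supp_comp {n : ℕ} (π : Equiv.Perm (Fin n)) (s : Fin n → Bool) :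
    (supp fun i => s (π i)).card = (supp s).card := by
  refine Finset.card_bij (fun i _ => π i) ?_ ?_ ?_
  · intro i hi; simpa using hi
  · intro i _ j _ h; exact π.injective h
  · intro j hj; exact ⟨π.symm j, by simpa using hj, by simp⟩

lemma complete_comp {n : ℕ} (π : Equiv.Perm (Fin n)) (A : Fin n → Fin n → Bool)
    (s s' : Fin n → Bool) : Complete (fun i j => A (π i) (π j)) (fun i => s (π i))
      (fun i => s' (π i)) ↔ Complete A s s' := by
  simp only [Complete, mem_supp]
  constructor
  · intro h i hi j hj
    simpa using h (π.symm i) (by simpa using hi) (π.symm j) (by simpa using hj)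
  · intro h i hi j hj
    exact h _ hi _ hj

lemma card_marked_comp {n : ℕ} (π : Equiv.Perm (Fin n)) (A : Fin n → Fin n → Bool)
    (C : List (Fin n → Bool)) : (marked (fun i j => A (π i) (π j)) (C.map fun s i => s (π i))).card =
      (marked A C).card := by
  refine Finset.card_bij (fun p _ => (π p.1, π p.2)) ?_ ?_ ?_
  · intro p hp
    rw [mem_marked] at hp ⊢
    obtain ⟨s, hs, s', hs', hc, h1, h2⟩ := hp
    rw [List.mem_map] at hs hs'
    obtain ⟨t, ht, rfl⟩ := hs
    obtain ⟨t', ht', rfl⟩ := hs'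
    exact ⟨t, ht, t', ht', (complete_comp π A t t').1 hc, by simpa using h1, by simpa using h2⟩
  · intro p _ q _ h
    simpa [Prod.ext_iff] using h
  · intro p hp
    rw [mem_marked] at hp
    obtain ⟨s, hs, s', hs', hc, h1, h2⟩ := hp
    refine ⟨(π.symm p.1, π.symm p.2), ?_, by simp⟩
    rw [mem_marked]
    exact ⟨_, List.mem_map.2 ⟨s, hs, rfl⟩, _, List.mem_map.2 ⟨s', hs', rfl⟩,
      (complete_comp π A s s').2 hc, by simpa using h1, by simpa using h2⟩

lemma blow_comp {n N : ℕ} (π : Equiv.Perm (Fin n)) (A : Fin n → Fin n → Bool) (ℓ : ℕ)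
    (S : Fin N → Fin n → Bool) :
    blow (fun i j => A (π i) (π j)) ℓ (fun t i => S t (π i)) = blow A ℓ S := by
  funext i j
  rw [Bool.eq_iff_iff, blow_iff, blow_iff, card_supp_comp, card_supp_comp, complete_comp]

lemma chosen_comp {n N : ℕ} (π : Equiv.Perm (Fin n)) (ℓ : ℕ) (S : Fin N → Fin n → Bool) (v : Val) :
    chosen ℓ (fun t i => S t (π i)) v = (chosen ℓ S v).map fun s i => s (π i) := by
  have : List.ofFn (fun t i => S t (π i)) = (List.ofFn S).map fun s i => s (π i) := by
    simp [List.map_ofFn, Function.comp_def]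
  rw [chosen, this, selBy_map]
  simp only [card_supp_comp]
  rfl

lemma isCert_comp {n N : ℕ} (π : Equiv.Perm (Fin n)) (A : Fin n → Fin n → Bool) (a ℓ : ℕ)
    (S : Fin N → Fin n → Bool) (v : Val) :
    IsCert (fun i j => A (π i) (π j)) a ℓ (chosen ℓ (fun t i => S t (π i)) v) ↔
      IsCert A a ℓ (chosen ℓ S v) := by
  rw [chosen_comp, IsCert, IsCert, card_marked_comp, List.length_map]

lemma expect_piP_comp {n N : ℕ} (π : Equiv.Perm (Fin n)) (μ : PMF Bool)
    (U : (Fin N → Fin n → Bool) → ℝ≥0∞) :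
    expect (piP N (piP n μ)) (fun S => U fun t i => S t (π i)) = expect (piP N (piP n μ)) U := by
  rw [expect_fintype, expect_fintype]
  let e : (Fin N → Fin n → Bool) ≃ (Fin N → Fin n → Bool) :=
    Equiv.arrowCongr (Equiv.refl _) (Equiv.arrowCongr π.symm (Equiv.refl _))
  rw [← Equiv.sum_comp e (fun S => piP N (piP n μ) S * U S)]
  refine Finset.sum_congr rfl fun S _ => ?_
  have he : e S = fun t i => S t (π i) := by
    funext t i
    simp [e, Equiv.arrowCongr]
  rw [he]
  congr 1
  simp only [piP_apply]
  exact Finset.prod_congr rfl fun t _ => (Equiv.prod_comp π fun i => μ (S t i)).symm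

lemma bool_ext {μ ν : PMF Bool} (h : μ true = ν true) : μ = ν := by
  ext b
  cases b
  · have h1 : μ false = 1 - μ true := ENNReal.eq_sub_of_add_eq (μ.apply_ne_top _)
      (by rw [add_comm]; exact bool_add μ)
    have h2 : ν false = 1 - ν true := ENNReal.eq_sub_of_add_eq (ν.apply_ne_top _)
      (by rw [add_comm]; exact bool_add ν)
    rw [h1, h2, h]
  · exact h

lemma trial_true (P : Cmd) (D : ℕ) (M : List (List Bool)) :
    trial P D M true = expect (guesses D) fun p => attempt P (M, p.1, p.2.1, p.2.2.1, 2 ^ p.2.2.1,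
      2 ^ p.2.2.2.1, 2 ^ p.2.2.2.2) true := by
  rw [trial, PMF.bind_apply]
  rfl

open Classical in
-- Relabeling the graph and the sampled sets together yields literally the same instance for `P` and
-- the same verdict on certificates. The law of the sampled sets is unchanged because membership of
-- the vertices is independent and identically distributed.
lemma trial_comp (P : Cmd) (D : ℕ) {n : ℕ} (π : Equiv.Perm (Fin n)) (A : Fin n → Fin n → Bool) :
    trial P D (mat fun i j => A (π i) (π j)) = trial P D (mat A) := by
  refine bool_ext ?_
  rw [trial_true, trial_true]
  congr 1
  funext p
  rw [attempt_mat, attempt_mat, ← expect_piP_comp π]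
  simp only [blow_comp]
  congr 1
  funext S
  congr 1
  funext c
  refine if_congr ?_ rfl rfl
  rw [isCert_comp]

/-! ### Graphs without certificates -/

/-- There is a certificate. -/
def HasCert {n : ℕ} (A : Fin n → Fin n → Bool) : Prop :=
  ∃ a ℓ C, n ≤ 2 ^ a ∧ (∀ s ∈ C, (supp s).card = ℓ) ∧ IsCert A a ℓ C

/-- A trial verifies the certificate itself, so this holds whatever `P` outputs, in particular on
instances outside its promise. -/
lemma trial_eq_zero (P : Cmd) (D : ℕ) {n : ℕ} {A : Fin n → Fin n → Bool} (h : ¬ HasCert A) :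
    trial P D (mat A) true = 0 := by
  rw [trial_true]
  refine le_zero_iff.1 (expect_le_of_support fun p _ => ?_)
  rw [attempt_mat]
  refine expect_le_of_support fun S _ => expect_le_of_support fun c _ => ?_
  rw [if_neg]
  rintro ⟨-, h1, h2⟩
  refine h ⟨_, _, _, h1, fun s hs => ?_, h2⟩
  have := selBy_prop hs
  simpa using this

lemma race_false (P : Cmd) (D : ℕ) (M : List (List Bool)) (κ : ℕ) :
    race P D (M, κ) false = expect (waiting P D (M.length, κ)) fun t =>
      trial P D M false ^ (t + 1) := by
  rw [race, PMF.bind_apply]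
  simp only [anyP_false, List.length_replicate]
  rfl

lemma sweep_false (P : Cmd) (D q : ℕ) (M : List (List Bool)) :
    sweep P D q M false = ((List.range (M.length + 1)).map fun κ =>
      if M.length ≤ κ ^ q then race P D (M, κ) false else 1).prod := by
  rw [sweep, foldP_or_false (fun κ => if M.length ≤ κ ^ q then race P D (M, κ) else PMF.pure false)]
  congr 1
  refine List.map_congr_left fun κ _ => ?_
  split_ifs <;> simp

lemma detect_false (P : Cmd) (D q : ℕ) (M : List (List Bool)) :
    detect P D q M false = sweep P D q M false ^ 2 := by
  rw [detect, anyP_false]; rfl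

lemma detect_eq_zero (P : Cmd) (D q : ℕ) {n : ℕ} {A : Fin n → Fin n → Bool} (h : ¬ HasCert A) :
    detect P D q (mat A) true = 0 := by
  have h1 : trial P D (mat A) false = 1 := by
    have := bool_add (trial P D (mat A))
    rwa [trial_eq_zero P D h, zero_add] at this
  have h2 : detect P D q (mat A) false = 1 := by
    rw [detect_false, sweep_false]
    simp [race_false, h1]
  have h3 := bool_add (detect P D q (mat A))
  rw [h2] at h3
  have h4 : detect P D q (mat A) true = 1 - 1 := ENNReal.eq_sub_of_add_eq (by simp) h3
  simpa using h4

lemma sweep_false_le (P : Cmd) (D q : ℕ) {M : List (List Bool)} {κ : ℕ} (hκ : κ ≤ M.length)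
    (hκq : M.length ≤ κ ^ q) : sweep P D q M false ≤ race P D (M, κ) false := by
  rw [sweep_false]
  have key : ∀ L : List ℕ, κ ∈ L → (L.map fun κ => if M.length ≤ κ ^ q then
      race P D (M, κ) false else 1).prod ≤ race P D (M, κ) false := by
    intro L
    have hle : ∀ κ, (if M.length ≤ κ ^ q then race P D (M, κ) false else 1) ≤ 1 := by
      intro κ
      split_ifs
      · exact PMF.coe_le_one _ _
      · exact le_rfl
    induction L with
    | nil => simp
    | cons x L ih =>
      intro hx
      rw [List.map_cons, List.prod_cons]
      rcases List.mem_cons.1 hx with rfl | hx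
      · rw [if_pos hκq]
        refine mul_le_of_le_one_right' ?_
        clear ih hx
        induction L with
        | nil => simp
        | cons y L ih =>
          rw [List.map_cons, List.prod_cons]
          exact mul_le_one' (hle y) ih
      · exact (mul_le_of_le_one_left' (hle x)).trans (ih hx)
  exact key _ (List.mem_range.2 (by omega))

/-! ### Completeness of the race -/

open Classical in
-- The three events that one of the variables is the strict maximum are disjoint and, by
-- exchangeability, equally likely. Ties only reduce the probability.
lemma expect_max_le (μ : PMF ℕ) : expect μ (fun x => expect μ fun y => expect μ fun z =>
    if y < x ∧ z < x then 1 else 0) ≤ 1 / 3 := by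
  set E := expect μ (fun x => expect μ fun y => expect μ fun z =>
    if y < x ∧ z < x then (1 : ℝ≥0∞) else 0) with hE
  have h1 : expect μ (fun x => expect μ fun y => expect μ fun z =>
      if x < y ∧ z < y then (1 : ℝ≥0∞) else 0) = E := by rw [hE, expect_comm]
  have h2 : expect μ (fun x => expect μ fun y => expect μ fun z =>
      if x < z ∧ y < z then (1 : ℝ≥0∞) else 0) = E := by
    rw [← h1]
    congr 1
    funext x
    rw [expect_comm]
  have h3 : E + E + E ≤ 1 := by
    calc E + E + E = expect μ (fun x => expect μ fun y => expect μ fun z =>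
        (if y < x ∧ z < x then (1 : ℝ≥0∞) else 0) + (if x < y ∧ z < y then (1 : ℝ≥0∞) else 0) +
          (if x < z ∧ y < z then (1 : ℝ≥0∞) else 0)) := by
          simp only [expect_add, h1, h2]
          rw [← hE]
      _ ≤ expect μ (fun x => expect μ fun y => expect μ fun z => 1) := by
          refine expect_mono fun x => expect_mono fun y => expect_mono fun z => ?_
          by_cases a : y < x ∧ z < x
          · rw [if_pos a, if_neg (by omega), if_neg (by omega)]; simp
          · by_cases b : x < y ∧ z < y
            · rw [if_neg a, if_pos b, if_neg (by omega)]; simp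
            · rw [if_neg a, if_neg b]
              split_ifs <;> simp
      _ = 1 := by simp
  rw [ENNReal.le_div_iff_mul_le (by simp) (by simp)]
  calc E * 3 = E + E + E := by ring
    _ ≤ 1 := h3

/-- If the waiting time for `M ~ ν` has the same law as the reference waiting time, then the race
is lost twice with probability at most `1/3`. -/
lemma expect_detect_false_le (P : Cmd) (D q : ℕ) {n κ : ℕ} (hκ : κ ≤ n) (hκq : n ≤ κ ^ q)
    (ν : PMF (List (List Bool))) (hlen : ∀ M ∈ ν.support, M.length = n)
    (hpos : ∀ M ∈ ν.support, trial P D M true ≠ 0)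
    (hlaw : (ν.bind fun M => failures (trial P D M)) = waiting P D (n, κ)) :
    expect ν (fun M => detect P D q M false) ≤ 1 / 3 := by
  classical
  set μ := waiting P D (n, κ) with hμ
  calc expect ν (fun M => detect P D q M false)
      ≤ expect ν (fun M => expect (failures (trial P D M)) fun x => expect μ fun y =>
          expect μ fun z => if y < x ∧ z < x then 1 else 0) := by
        refine expect_mono_support fun M hM => ?_
        have hl := hlen M hM
        have hp := hpos M hM
        rw [detect_false]
        have h1 : sweep P D q M false ≤ expect μ fun t => trial P D M false ^ (t + 1) := by
          refine (sweep_false_le P D q (κ := κ) (by rw [hl]; exact hκ) (by rw [hl]; exact hκq)).trans ?_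
          rw [race_false, hl]
        rw [expect_comm]
        calc sweep P D q M false ^ 2 ≤ (expect μ fun t => trial P D M false ^ (t + 1)) ^ 2 := by
              gcongr
          _ = expect μ (fun y => expect μ fun z =>
              trial P D M false ^ (y + 1) * trial P D M false ^ (z + 1)) := by
            simp only [expect_mul_left]
            rw [sq, ← expect_mul_left]
            congr 1
            funext y
            rw [mul_comm]
          _ ≤ _ := by
            refine expect_mono fun y => ?_
            rw [expect_comm]
            refine expect_mono fun z => ?_
            -- Losing races of lengths `y + 1` and `z + 1` has the probability that the waiting time
            -- `x` is at least `y + z + 2`, which implies `y < x` and `z < x`. One copy of `x` thus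
            -- covers both races on the same input.
            rw [← pow_add, ← expect_failures_le_indicator hp]
            refine expect_mono fun x => ?_
            split_ifs with h h' h'
            · exact le_rfl
            · omega
            · exact zero_le_one
            · exact le_rfl
    _ = expect μ (fun x => expect μ fun y => expect μ fun z => if y < x ∧ z < x then 1 else 0) := by
        rw [← hlaw, expect_bind]
    _ ≤ 1 / 3 := expect_max_le μ

end

end DkS

/-! ### Planted and uniform random graphs; absence of certificates -/

namespace DkS

noncomputable section

open Enc (enc sz one_le_sz)

/-! ### Uniform distributions -/

lemma expect_uniform {ι : Type*} [Fintype ι] [Nonempty ι] (U : ι → ℝ≥0∞) :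
    expect (PMF.uniformOfFintype ι) U = (Fintype.card ι : ℝ≥0∞)⁻¹ * ∑ x, U x := by
  rw [expect_fintype, Finset.mul_sum]
  simp [PMF.uniformOfFintype_apply]

lemma expect_uniform_equiv {ι κ : Type*} [Fintype ι] [Nonempty ι] [Fintype κ] [Nonempty κ]
    (e : ι ≃ κ) (U : κ → ℝ≥0∞) :
    expect (PMF.uniformOfFintype ι) (fun x => U (e x)) = expect (PMF.uniformOfFintype κ) U := by
  rw [expect_uniform, expect_uniform, Fintype.card_congr e, Equiv.sum_comp e U]

lemma expect_uniform_prod {ι κ : Type*} [Fintype ι] [Nonempty ι] [Fintype κ] [Nonempty κ]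
    (U : ι × κ → ℝ≥0∞) :
    expect (PMF.uniformOfFintype (ι × κ)) U = expect (PMF.uniformOfFintype ι) fun x =>
      expect (PMF.uniformOfFintype κ) fun y => U (x, y) := by
  simp only [expect_uniform, Fintype.sum_prod_type, Fintype.card_prod, ← Finset.mul_sum]
  rw [← mul_assoc]
  congr 1
  push_cast
  exact ENNReal.mul_inv (by simp) (by simp)

lemma piP_coin (m : ℕ) : piP m (PMF.uniformOfFintype Bool) = PMF.uniformOfFintype (Fin m → Bool) := by
  ext f
  rw [piP_apply]
  simp [PMF.uniformOfFintype_apply, ENNReal.inv_pow]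

/-! ### Adding a vertex to a random graph -/

/-- Add a new vertex `0`. -/
def consAdj {m : ℕ} (A : Fin m → Fin m → Bool) (r : Fin m → Bool) : Fin (m + 1) → Fin (m + 1) → Bool :=
  Fin.cons (Fin.cons false r) fun i => Fin.cons (r i) (A i)

lemma addVertex_mat {m : ℕ} (A : Fin m → Fin m → Bool) (r : Fin m → Bool) :
    addVertex (mat A) (List.ofFn r) = mat (consAdj A r) := by
  rw [addVertex, mat, mat, zip_ofFn, List.map_ofFn, List.ofFn_succ]
  simp [consAdj, Function.comp_def, List.ofFn_succ]

/-- A graph with a new vertex `0`. -/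
def consGraph {m : ℕ} (G : SimpleGraph (Fin m)) (r : Fin m → Bool) : SimpleGraph (Fin (m + 1)) where
  Adj i j := consAdj (adj G) r i j = true
  symm := ⟨fun i j => by
    refine Fin.cases ?_ (fun i => ?_) i <;> refine Fin.cases ?_ (fun j => ?_) j <;>
      simp [consAdj, adj_iff, G.adj_comm]⟩
  loopless := ⟨fun i => by refine Fin.cases ?_ (fun i => ?_) i <;> simp [consAdj, adj_iff]⟩

lemma adj_consGraph {m : ℕ} (G : SimpleGraph (Fin m)) (r : Fin m → Bool) :
    adj (consGraph G r) = consAdj (adj G) r := by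
  funext i j
  rw [Bool.eq_iff_iff, adj_iff]
  rfl

open Classical in
/-- Graphs on `m + 1` vertices correspond to graphs on `m` vertices with an adjacency vector. -/
def consGraphEquiv (m : ℕ) : SimpleGraph (Fin m) × (Fin m → Bool) ≃ SimpleGraph (Fin (m + 1)) where
  toFun p := consGraph p.1 p.2
  invFun G := (G.comap Fin.succ, fun i => decide (G.Adj 0 i.succ))
  left_inv := by
    rintro ⟨G, r⟩
    refine Prod.ext ?_ ?_
    · ext i j
      simp [consGraph, consAdj, adj_iff]
    · funext i
      simp [consGraph, consAdj]
  right_inv := by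
    intro G
    ext i j
    refine Fin.cases ?_ (fun i => ?_) i <;> refine Fin.cases ?_ (fun j => ?_) j <;>
      simp [consGraph, consAdj, adj_iff, G.adj_comm]

lemma expect_erdosRenyi_succ (m : ℕ) (U : SimpleGraph (Fin (m + 1)) → ℝ≥0∞) :
    expect (erdosRenyi (m + 1)) U = expect (erdosRenyi m) fun G =>
      expect (piP m (PMF.uniformOfFintype Bool)) fun r => U (consGraph G r) := by
  rw [erdosRenyi, erdosRenyi, piP_coin, ← expect_uniform_equiv (consGraphEquiv m),
    expect_uniform_prod]
  rfl

/-- The vertices from `j` on. -/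
def verticesFrom (n j : ℕ) : Finset (Fin n) := Finset.univ.filter fun i => j ≤ i.val

lemma cliqueOn_adj {n : ℕ} {S : Finset (Fin n)} {i j : Fin n} :
    (cliqueOn S).Adj i j ↔ i ≠ j ∧ i ∈ S ∧ j ∈ S := by
  simp only [cliqueOn, SimpleGraph.fromRel_adj]
  tauto

lemma consGraph_sup_cliqueOn {m j : ℕ} (G : SimpleGraph (Fin m)) (r : Fin m → Bool) :
    consGraph (G ⊔ cliqueOn (verticesFrom m j)) r =
      consGraph G r ⊔ cliqueOn (verticesFrom (m + 1) (j + 1)) := by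
  ext i i'
  refine Fin.cases ?_ (fun i => ?_) i <;> refine Fin.cases ?_ (fun i' => ?_) i' <;>
    simp [consGraph, consAdj, adj_iff, cliqueOn_adj, verticesFrom]

lemma growStep_mat {m : ℕ} (A : Fin m → Fin m → Bool) (U : List (List Bool) → ℝ≥0∞) :
    expect (growStep (mat A)) U =
      expect (piP m (PMF.uniformOfFintype Bool)) fun r => U (mat (consAdj A r)) := by
  rw [growStep, expect_map, (isSquare_mat A).1, iid_eq_map_piP, expect_map]
  simp only [addVertex_mat]

lemma grow_succ (M : List (List Bool)) (j : ℕ) : grow M (j + 1) = (grow M j).bind growStep := by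
  rw [grow, List.replicate_succ', foldP_append]
  congr 1
  funext M'
  simp [foldP]

/-- A clique on all vertices absorbs `G`, so the starting point of the growth is deterministic. -/
lemma completeMatrix_eq {κ : ℕ} (G : SimpleGraph (Fin κ)) :
    completeMatrix κ = mat (adj (G ⊔ cliqueOn (verticesFrom κ 0))) := by
  have h : ∀ {β : Type} (f : ℕ → β), (List.range κ).map f = List.ofFn fun i : Fin κ => f i := by
    intro β f
    apply List.ext_getElem <;> simp
  rw [completeMatrix, h]
  simp only [h]
  unfold mat
  congr 1
  funext i
  congr 1
  funext j
  rw [Bool.eq_iff_iff, adj_iff]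
  simp only [SimpleGraph.sup_adj, cliqueOn_adj, verticesFrom, Bool.not_eq_true', decide_eq_false_iff_not,
    Finset.mem_filter, Finset.mem_univ, Nat.zero_le, and_true, Fin.val_inj]
  constructor
  · exact Or.inr
  · rintro (h | h)
    · exact h.ne
    · exact h

/-- New vertices are inserted at position `0` with uniform adjacencies. After `j` insertions the
clique occupies the vertices from `j` on, and all other adjacencies are those of a uniform graph. -/
lemma expect_grow (κ j : ℕ) (U : List (List Bool) → ℝ≥0∞) :
    expect (grow (completeMatrix κ) j) U = expect (erdosRenyi (κ + j)) fun G =>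
      U (mat (adj (G ⊔ cliqueOn (verticesFrom (κ + j) j)))) := by
  induction j generalizing U with
  | zero =>
    have : ∀ G : SimpleGraph (Fin (κ + 0)), mat (adj (G ⊔ cliqueOn (verticesFrom (κ + 0) 0))) =
        completeMatrix κ := fun G => (completeMatrix_eq G).symm
    simp only [this]
    simp [grow, foldP]
  | succ j ih =>
    rw [grow_succ, expect_bind, ih, ← add_assoc, expect_erdosRenyi_succ]
    congr 1
    funext G
    rw [growStep_mat]
    simp only [← adj_consGraph, consGraph_sup_cliqueOn]

lemma expect_genP {n κ : ℕ} (hκ : κ ≤ n) (U : List (List Bool) → ℝ≥0∞) :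
    expect (genP (n, κ)) U = expect (erdosRenyi n) fun G =>
      U (mat (adj (G ⊔ cliqueOn (verticesFrom n (n - κ))))) := by
  obtain ⟨j, rfl⟩ := Nat.exists_eq_add_of_le hκ
  rw [genP]
  simp only [Nat.add_sub_cancel_left]
  exact expect_grow κ j U

lemma card_verticesFrom {n κ : ℕ} (hκ : κ ≤ n) : (verticesFrom n (n - κ)).card = κ := by
  have h : (verticesFrom n (n - κ)).card = (Finset.univ.filter fun i : Fin n => i.val < κ).card := by
    refine Finset.card_bij (fun i _ => i.rev) ?_ ?_ ?_
    · intro i hi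
      simp only [verticesFrom, Finset.mem_filter, Finset.mem_univ, true_and, Fin.val_rev] at hi ⊢
      omega
    · intro i _ j _ h; exact Fin.rev_injective h
    · intro i hi
      refine ⟨i.rev, ?_, Fin.rev_rev i⟩
      simp only [verticesFrom, Finset.mem_filter, Finset.mem_univ, true_and, Fin.val_rev] at hi ⊢
      omega
  rw [h, Fin.card_filter_val_lt]
  omega

/-! ### The position of the planted clique does not matter -/

/-- A permutation carrying one `κ`-set to another preserves the uniform distribution on graphs, so
for an isomorphism-invariant `U` every position of the clique contributes the same amount. -/
lemma expect_plantedClique {n κ : ℕ} (hκ : κ ≤ n) (U : SimpleGraph (Fin n) → ℝ≥0∞)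
    (hU : ∀ (π : Equiv.Perm (Fin n)) G, U (G.comap π) = U G) :
    expect (plantedClique n κ) U = expect (erdosRenyi n) fun G =>
      U (G ⊔ cliqueOn (verticesFrom n (n - κ))) := by
  set T := verticesFrom n (n - κ) with hT
  have key : ∀ S : Finset (Fin n), S.card = κ →
      expect (erdosRenyi n) (fun G => U (G ⊔ cliqueOn S)) =
        expect (erdosRenyi n) fun G => U (G ⊔ cliqueOn T) := by
    intro S hS
    have e : {x // x ∈ S} ≃ {x // x ∈ T} :=
      Finset.equivOfCardEq (by rw [hS, hT, card_verticesFrom hκ])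
    set π : Equiv.Perm (Fin n) := e.extendSubtype with hπ
    have hmem : ∀ x, π x ∈ T ↔ x ∈ S := by
      intro x
      constructor
      · intro h
        by_contra hx
        exact e.extendSubtype_not_mem x hx h
      · intro h
        exact e.extendSubtype_mem x h
    have hcomap : ∀ G : SimpleGraph (Fin n), (G ⊔ cliqueOn T).comap π = G.comap π ⊔ cliqueOn S := by
      intro G
      ext i j
      simp [cliqueOn_adj, hmem]
    let E : SimpleGraph (Fin n) ≃ SimpleGraph (Fin n) := Equiv.simpleGraph π.symm
    have hE : ∀ G, E G = G.comap π := fun G => rfl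
    rw [erdosRenyi, ← expect_uniform_equiv E]
    simp only [hE, ← hcomap, hU]
  rw [plantedClique, expect_bind]
  simp only [expect_map]
  rw [expect_comm]
  have hS : ∀ S ∈ (randomSubset n κ).support, expect (erdosRenyi n) (fun G => U (G ⊔ cliqueOn S)) =
      expect (erdosRenyi n) fun G => U (G ⊔ cliqueOn T) := by
    intro S hS
    rw [randomSubset, PMF.mem_support_uniformOfFinset_iff, Finset.mem_powersetCard] at hS
    exact key S (by rw [hS.2, min_eq_left hκ])
  refine le_antisymm ?_ ?_
  · exact expect_le_of_support fun S h => (hS S h).le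
  · rw [← expect_const (randomSubset n κ) (expect (erdosRenyi n) fun G => U (G ⊔ cliqueOn T))]
    exact expect_mono_support fun S h => (hS S h).ge

lemma trial_comap (P : Cmd) (D : ℕ) {n : ℕ} (π : Equiv.Perm (Fin n)) (G : SimpleGraph (Fin n)) :
    trial P D (mat (adj (G.comap π))) = trial P D (mat (adj G)) :=
  trial_comp P D π (adj G)

/-- The failure count is isomorphism-invariant in law, so fixing the clique on the last vertices, as
`genP` does, loses nothing. This equality of laws is the hypothesis of `expect_detect_false_le`. -/
lemma planted_waiting (P : Cmd) (D : ℕ) {n κ : ℕ} (hκ : κ ≤ n) :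
    (((plantedClique n κ).map fun G => mat (adj G)).bind fun M => failures (trial P D M)) =
      waiting P D (n, κ) := by
  ext t
  rw [PMF.bind_apply, waiting, PMF.bind_apply]
  change expect _ (fun M => failures (trial P D M) t) = expect _ fun M => failures (trial P D M) t
  rw [expect_map, expect_genP hκ, expect_plantedClique hκ]
  intro π G
  rw [trial_comap]

/-! ### Random graphs have no certificates -/

open Classical in
-- More than `4 * Q` ordered pairs contain more than `2 * Q` unordered ones, and each of these is an
-- edge with probability `1/2`, independently.
lemma expect_erdosRenyi_contains_le {n Q : ℕ} (F : Finset (Fin n × Fin n)) (hF : 4 * Q < F.card) :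
    expect (erdosRenyi n) (fun G => if ∀ p ∈ F, G.Adj p.1 p.2 then 1 else 0) ≤
      (2⁻¹ : ℝ≥0∞) ^ (2 * Q) := by
  set E : Finset (Sym2 (Fin n)) := F.image fun p => s(p.1, p.2) with hE
  have hcard : F.card ≤ 2 * E.card := by
    refine Finset.card_le_mul_card_image _ 2 fun e he => ?_
    induction e using Sym2.ind with
    | _ x y =>
      have : (F.filter fun p => s(p.1, p.2) = s(x, y)) ⊆ {(x, y), (y, x)} := by
        intro p hp
        simp only [Finset.mem_filter, Sym2.eq_iff] at hp
        simp only [Finset.mem_insert, Finset.mem_singleton, Prod.ext_iff]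
        exact hp.2
      exact (Finset.card_le_card this).trans Finset.card_le_two
  set X := Finset.univ.filter fun G : SimpleGraph (Fin n) => ∀ p ∈ F, G.Adj p.1 p.2 with hX
  have hmem : ∀ G ∈ X, ∀ e ∈ E, e ∈ G.edgeSet := by
    intro G hG e he
    simp only [hX, Finset.mem_filter, Finset.mem_univ, true_and] at hG
    simp only [hE, Finset.mem_image] at he
    obtain ⟨p, hp, rfl⟩ := he
    exact hG p hp
  -- Counting form of independence: a graph containing all edges of `E` and a subset of `E` to be
  -- deleted are both recovered from the result of the deletion.
  have hinj : X.card * 2 ^ E.card ≤ Fintype.card (SimpleGraph (Fin n)) := by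
    rw [← Finset.card_powerset, ← Finset.card_product, ← Finset.card_univ]
    refine Finset.card_le_card_of_injOn (fun q => q.1.deleteEdges (q.2 : Set (Sym2 (Fin n))))
      (fun _ _ => Finset.mem_univ _) ?_
    rintro ⟨G, A⟩ h ⟨G', A'⟩ h' heq
    simp only [Finset.coe_product, Set.mem_prod, Finset.mem_coe, Finset.mem_powerset] at h h'
    have heq' : ∀ e, (e ∈ G.edgeSet ∧ e ∉ A) ↔ (e ∈ G'.edgeSet ∧ e ∉ A') := by
      intro e
      have := congrArg (fun H : SimpleGraph (Fin n) => e ∈ H.edgeSet) heq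
      simpa [SimpleGraph.edgeSet_deleteEdges] using this
    have hA : A = A' := by
      ext e
      have h1 := heq' e
      constructor
      · intro he
        have := hmem G' h'.1 e (h.2 he)
        by_contra hne
        exact (h1.2 ⟨this, hne⟩).2 he
      · intro he
        have := hmem G h.1 e (h'.2 he)
        by_contra hne
        exact (h1.1 ⟨this, hne⟩).2 he
    subst hA
    refine Prod.ext ?_ rfl
    refine SimpleGraph.edgeSet_injective ?_
    ext e
    have h1 := heq' e
    by_cases he : e ∈ A
    · exact ⟨fun _ => hmem G' h'.1 e (h'.2 he), fun _ => hmem G h.1 e (h.2 he)⟩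
    · simpa [he] using h1
  rw [erdosRenyi, expect_uniform, Finset.sum_ite, Finset.sum_const_zero, add_zero, Finset.sum_const,
    nsmul_eq_mul, mul_one, ← ENNReal.inv_pow]
  rw [mul_comm, ← div_eq_mul_inv]
  refine ENNReal.div_le_of_le_mul ?_
  rw [mul_comm, ← div_eq_mul_inv, ENNReal.le_div_iff_mul_le (by simp) (by simp)]
  have hle : 2 * Q ≤ E.card := by omega
  have : X.card * 2 ^ (2 * Q) ≤ Fintype.card (SimpleGraph (Fin n)) :=
    (Nat.mul_le_mul_left _ (Nat.pow_le_pow_right (by norm_num) hle)).trans hinj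
  exact_mod_cast this

/-- The pairs covered by the products of the sets `c i` and `c j` with `R i j`. -/
def covered {n k : ℕ} (c : Fin k → Fin n → Bool) (R : Fin k → Fin k → Bool) :
    Finset (Fin n × Fin n) :=
  Finset.univ.filter fun p => ∃ i j, R i j = true ∧ p.1 ∈ supp (c i) ∧ p.2 ∈ supp (c j)

open Classical in
-- The form suited to a union bound: an indexed family of sets and a relation that records which
-- pairs are complete, so that the pairs covered no longer depend on `G`. The bit count `a` drops to
-- its least value `Nat.clog 2 n`. A certificate has a marked pair, so the numbers of sets and of
-- elements are positive, whence the shift by one.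
lemma HasCert.exists_covered {n : ℕ} {G : SimpleGraph (Fin n)} (h : HasCert (adj G)) :
    ∃ (k ℓ : ℕ) (c : Fin (k + 1) → Fin n → Bool) (R : Fin (k + 1) → Fin (k + 1) → Bool),
      (∀ i, (supp (c i)).card = ℓ + 1) ∧
      4 * ((k + 1) * (ℓ + 1) * Nat.clog 2 n + (k + 1) * (k + 1)) < (covered c R).card ∧
      ∀ p ∈ covered c R, G.Adj p.1 p.2 := by
  obtain ⟨a, ℓ, C, ha, hC, hcert⟩ := h
  have hpos : 0 < (marked (adj G) C).card := lt_of_le_of_lt (Nat.zero_le _) hcert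
  obtain ⟨p, hp⟩ := Finset.card_pos.1 hpos
  obtain ⟨s, hs, s', -, -, h1, -⟩ := mem_marked.1 hp
  obtain ⟨k, hk⟩ : ∃ k, C.length = k + 1 :=
    Nat.exists_eq_succ_of_ne_zero (by have := List.length_pos_of_mem hs; omega)
  obtain ⟨ℓ', rfl⟩ : ∃ ℓ', ℓ = ℓ' + 1 :=
    Nat.exists_eq_succ_of_ne_zero (by
      have := Finset.card_pos.2 ⟨_, h1⟩
      rw [hC s hs] at this; omega)
  have hcl : Nat.clog 2 n ≤ a := (Nat.clog_le_iff_le_pow (by norm_num)).2 ha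
  let c : Fin (k + 1) → Fin n → Bool := fun i => C.get (Fin.cast hk.symm i)
  have hc : ∀ s, s ∈ C ↔ ∃ i, c i = s := by
    intro s
    rw [List.mem_iff_get]
    constructor
    · rintro ⟨i, rfl⟩; exact ⟨Fin.cast hk i, rfl⟩
    · rintro ⟨i, rfl⟩; exact ⟨_, rfl⟩
  let R : Fin (k + 1) → Fin (k + 1) → Bool := fun i j => decide (Complete (adj G) (c i) (c j))
  have hcov : covered c R = marked (adj G) C := by
    ext p
    simp only [covered, Finset.mem_filter, Finset.mem_univ, true_and, mem_marked, hc, R,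
      decide_eq_true_eq]
    constructor
    · rintro ⟨i, j, h1, h2, h3⟩
      exact ⟨_, ⟨i, rfl⟩, _, ⟨j, rfl⟩, h1, h2, h3⟩
    · rintro ⟨_, ⟨i, rfl⟩, _, ⟨j, rfl⟩, h1, h2, h3⟩
      exact ⟨i, j, h1, h2, h3⟩
  refine ⟨k, ℓ', c, R, fun i => hC _ ((hc _).2 ⟨i, rfl⟩), ?_, ?_⟩
  · rw [hcov]
    refine lt_of_le_of_lt ?_ hcert
    rw [hk]
    gcongr
  · intro p hp
    rw [hcov, mem_marked] at hp
    obtain ⟨s, -, s', -, hcomp, h1, h2⟩ := hp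
    exact adj_iff.1 (hcomp _ h1 _ h2)

lemma card_filter_supp_le (n ℓ : ℕ) :
    (Finset.univ.filter fun s : Fin n → Bool => (supp s).card = ℓ).card ≤ n ^ ℓ := by
  calc _ ≤ (Finset.powersetCard ℓ (Finset.univ : Finset (Fin n))).card := by
        refine Finset.card_le_card_of_injOn supp ?_ ?_
        · intro s hs
          simp only [Finset.coe_filter, Finset.mem_univ, true_and, Set.mem_ofPred_eq] at hs
          simp [Finset.mem_powersetCard, hs]
        · intro s _ t _ h
          funext i
          rw [Bool.eq_iff_iff, ← mem_supp, ← mem_supp, h]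
    _ = n.choose ℓ := by simp
    _ ≤ n ^ ℓ := Nat.choose_le_pow n ℓ

open Classical in
-- There are at most `2 ^ Q` descriptions with given numbers of sets and elements, and each is
-- realized with probability at most `2 ^ (-2 * Q)`. From `n ≥ 9` follows `Nat.clog 2 n ≥ 4`, so `2
-- ^ (-Q)` is at most `1/4` times a term of a double geometric series with sum `1`.
lemma expect_hasCert_le {n : ℕ} (hn : 9 ≤ n) :
    expect (erdosRenyi n) (fun G => if HasCert (adj G) then 1 else 0) ≤ 1 / 3 := by
  set a := Nat.clog 2 n with ha
  have ha4 : 4 ≤ a := by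
    rw [ha]
    by_contra h
    have h2 : Nat.clog 2 n ≤ 3 := by omega
    rw [Nat.clog_le_iff_le_pow (by norm_num)] at h2
    omega
  have hna : n ≤ 2 ^ a := Nat.le_pow_clog (by norm_num) n
  let Q : ℕ → ℕ → ℕ := fun k ℓ => (k + 1) * (ℓ + 1) * a + (k + 1) * (k + 1)
  let Z : (k ℓ : ℕ) → Finset ((Fin (k + 1) → Fin n → Bool) × (Fin (k + 1) → Fin (k + 1) → Bool)) :=
    fun k ℓ => (Fintype.piFinset fun _ => Finset.univ.filter
      fun s : Fin n → Bool => (supp s).card = ℓ + 1) ×ˢ Finset.univ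
  let W : (k ℓ : ℕ) → ((Fin (k + 1) → Fin n → Bool) × (Fin (k + 1) → Fin (k + 1) → Bool)) →
      SimpleGraph (Fin n) → ℝ≥0∞ := fun k ℓ z G =>
    if 4 * Q k ℓ < (covered z.1 z.2).card ∧ ∀ p ∈ covered z.1 z.2, G.Adj p.1 p.2 then 1 else 0
  have hW : ∀ k ℓ z, expect (erdosRenyi n) (W k ℓ z) ≤ (2⁻¹ : ℝ≥0∞) ^ (2 * Q k ℓ) := by
    intro k ℓ z
    by_cases h : 4 * Q k ℓ < (covered z.1 z.2).card
    · simp only [W, h, true_and]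
      exact expect_erdosRenyi_contains_le _ h
    · simp only [W, h, false_and, if_false, expect_const]
      exact zero_le
  have hZ : ∀ k ℓ, (Z k ℓ).card ≤ 2 ^ Q k ℓ := by
    intro k ℓ
    simp only [Z, Finset.card_product, Fintype.card_piFinset_const, Finset.card_univ,
      Fintype.card_fun, Fintype.card_bool, Fintype.card_fin, Q]
    rw [pow_add 2 ((k + 1) * (ℓ + 1) * a), ← pow_mul 2 (k + 1) (k + 1)]
    refine Nat.mul_le_mul_right _ ?_
    calc _ ≤ (n ^ (ℓ + 1)) ^ (k + 1) := Nat.pow_le_pow_left (card_filter_supp_le n (ℓ + 1)) _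
      _ ≤ ((2 ^ a) ^ (ℓ + 1)) ^ (k + 1) := by gcongr
      _ = 2 ^ ((k + 1) * (ℓ + 1) * a) := by rw [← pow_mul, ← pow_mul]; ring_nf
  have hind : ∀ G : SimpleGraph (Fin n), (if HasCert (adj G) then (1 : ℝ≥0∞) else 0) ≤
      ∑' k : ℕ, ∑' ℓ : ℕ, ∑ z ∈ Z k ℓ, W k ℓ z G := by
    intro G
    split_ifs with h
    · obtain ⟨k, ℓ, c, R, hc, hcard, hadj⟩ := h.exists_covered
      have hmem : (c, R) ∈ Z k ℓ := by simp [Z, Fintype.mem_piFinset, hc]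
      calc (1 : ℝ≥0∞) = W k ℓ (c, R) G := by
            simp only [W]
            exact (if_pos ⟨hcard, hadj⟩).symm
        _ ≤ ∑ z ∈ Z k ℓ, W k ℓ z G :=
            Finset.single_le_sum (f := fun z => W k ℓ z G) (fun _ _ => zero_le) hmem
        _ ≤ ∑' ℓ : ℕ, ∑ z ∈ Z k ℓ, W k ℓ z G :=
            ENNReal.le_tsum (f := fun ℓ => ∑ z ∈ Z k ℓ, W k ℓ z G) ℓ
        _ ≤ _ := ENNReal.le_tsum (f := fun k => ∑' ℓ : ℕ, ∑ z ∈ Z k ℓ, W k ℓ z G) k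
    · exact zero_le
  have hsum : ∀ k ℓ, expect (erdosRenyi n) (fun G => ∑ z ∈ Z k ℓ, W k ℓ z G) ≤
      4⁻¹ * ((2⁻¹ : ℝ≥0∞) ^ (k + 1) * (2⁻¹ : ℝ≥0∞) ^ (ℓ + 1)) := by
    intro k ℓ
    have hcomm : expect (erdosRenyi n) (fun G => ∑ z ∈ Z k ℓ, W k ℓ z G) =
        ∑ z ∈ Z k ℓ, expect (erdosRenyi n) (W k ℓ z) := by
      simp only [expect_fintype, Finset.mul_sum]
      exact Finset.sum_comm
    have h2 : (2 : ℝ≥0∞) * 2⁻¹ = 1 := ENNReal.mul_inv_cancel (by simp) (by simp)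
    calc expect (erdosRenyi n) (fun G => ∑ z ∈ Z k ℓ, W k ℓ z G)
        ≤ ∑ z ∈ Z k ℓ, (2⁻¹ : ℝ≥0∞) ^ (2 * Q k ℓ) := by
          rw [hcomm]; exact Finset.sum_le_sum fun z _ => hW k ℓ z
      _ = (Z k ℓ).card * (2⁻¹ : ℝ≥0∞) ^ (2 * Q k ℓ) := by rw [Finset.sum_const, nsmul_eq_mul]
      _ ≤ (2 : ℝ≥0∞) ^ Q k ℓ * (2⁻¹ : ℝ≥0∞) ^ (2 * Q k ℓ) := by
          gcongr; exact_mod_cast hZ k ℓ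
      _ = (2⁻¹ : ℝ≥0∞) ^ Q k ℓ := by
        rw [two_mul, pow_add (2⁻¹ : ℝ≥0∞) (Q k ℓ), ← mul_assoc, ← mul_pow, h2]; simp
      _ ≤ (2⁻¹ : ℝ≥0∞) ^ (2 + (k + 1) + (ℓ + 1)) := by
          refine pow_le_pow_right_of_le_one' (by simp) ?_
          simp only [Q]
          nlinarith [Nat.mul_le_mul_left ((k + 1) * (ℓ + 1)) ha4, Nat.zero_le (k * ℓ)]
      _ = _ := by
        rw [pow_add, pow_add, mul_assoc]
        congr 1
        rw [← ENNReal.inv_pow]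
        norm_num
  have hgeo : ∑' k : ℕ, (2⁻¹ : ℝ≥0∞) ^ (k + 1) = 1 := by
    rw [ENNReal.tsum_geometric_add_one, ENNReal.one_sub_inv_two, inv_inv]
    exact ENNReal.inv_mul_cancel (by simp) (by simp)
  calc _ ≤ expect (erdosRenyi n) (fun G => ∑' k : ℕ, ∑' ℓ : ℕ, ∑ z ∈ Z k ℓ, W k ℓ z G) :=
        expect_mono hind
    _ = ∑' k : ℕ, ∑' ℓ : ℕ, expect (erdosRenyi n) (fun G => ∑ z ∈ Z k ℓ, W k ℓ z G) := by
        simp only [expect_tsum]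
    _ ≤ ∑' k : ℕ, ∑' ℓ : ℕ, 4⁻¹ * ((2⁻¹ : ℝ≥0∞) ^ (k + 1) * (2⁻¹ : ℝ≥0∞) ^ (ℓ + 1)) :=
        ENNReal.tsum_le_tsum fun k => ENNReal.tsum_le_tsum fun ℓ => hsum k ℓ
    _ = 4⁻¹ := by
        simp only [ENNReal.tsum_mul_left, hgeo, mul_one]
    _ ≤ 1 / 3 := by
        rw [one_div]
        exact ENNReal.inv_le_inv.2 (by norm_num)

end

end DkS

/-! ### Truncated runs, and certificates from approximate solutions -/

namespace DkS

noncomputable section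

open Enc (enc sz one_le_sz)

/-! ### Stopping a program after a multiple of its expected running time -/

open Classical in
lemma toOuterMeasure_eq_expect {ι : Type*} (μ : PMF ι) (X : Set ι) :
    μ.toOuterMeasure X = expect μ fun x => if x ∈ X then 1 else 0 := by
  rw [PMF.toOuterMeasure_apply]
  refine tsum_congr fun x => ?_
  by_cases h : x ∈ X <;> simp [h]

lemma run_add (s t : ℕ) (c : Config) : run (s + t) c = (run s c).bind (run t) := by
  induction s generalizing c with
  | zero => simp [run]
  | succ s ih =>
    rw [Nat.succ_add]
    simp only [run, PMF.bind_bind]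
    congr 1
    funext c'
    exact ih c'

lemma running_antitone (s t : ℕ) (c : Config) :
    (run (s + t) c).toOuterMeasure {c | c.1 ≠ []} ≤ (run s c).toOuterMeasure {c | c.1 ≠ []} := by
  classical
  rw [toOuterMeasure_eq_expect, toOuterMeasure_eq_expect, run_add, expect_bind]
  refine expect_mono fun c' => ?_
  obtain ⟨K, σ⟩ := c'
  by_cases h : K = []
  · subst h
    rw [run_nil]
    simp
  · rw [if_pos (by exact h)]
    exact expect_le_of_support fun x _ => by split_ifs <;> simp

/-- Markov's inequality: the probability of still running decreases in time, and its sum over all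
times is the expected time. -/
lemma mul_running_le (B : ℕ) (P : Cmd) (v : Val) :
    (B : ℝ≥0∞) * (run B (start P v)).toOuterMeasure {c | c.1 ≠ []} ≤ expectedTime P v := by
  calc (B : ℝ≥0∞) * (run B (start P v)).toOuterMeasure {c | c.1 ≠ []}
      = ∑ _t ∈ Finset.range B, (run B (start P v)).toOuterMeasure {c | c.1 ≠ []} := by simp
    _ ≤ ∑ t ∈ Finset.range B, (run t (start P v)).toOuterMeasure {c | c.1 ≠ []} := by
        refine Finset.sum_le_sum fun t ht => ?_
        have : B = t + (B - t) := by have := Finset.mem_range.1 ht; omega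
        rw [this]
        exact running_antitone _ _ _
    _ ≤ expectedTime P v := ENNReal.sum_le_tsum _

lemma outputProb_le_add_running (B : ℕ) (P : Cmd) (v : Val) (X : Set Val) :
    outputProb P v X ≤ (run B (start P v)).toOuterMeasure {c | c.1 = [] ∧ c.2 0 ∈ X} +
      (run B (start P v)).toOuterMeasure {c | c.1 ≠ []} := by
  classical
  rw [outputProb]
  refine iSup_le fun t => ?_
  have hmono : (run t (start P v)).toOuterMeasure {c | c.1 = [] ∧ c.2 0 ∈ X} ≤
      (run (B + t) (start P v)).toOuterMeasure {c | c.1 = [] ∧ c.2 0 ∈ X} := by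
    have h := fun t => toOuterMeasure_halted_eq_val {s : Store | s 0 ∈ X} t (start P v)
    simp only [Set.mem_ofPred_eq] at h
    rw [h, h]
    exact val_mono (Nat.le_add_left _ _) _
  refine hmono.trans ?_
  rw [toOuterMeasure_eq_expect, toOuterMeasure_eq_expect, toOuterMeasure_eq_expect, run_add,
    expect_bind, ← expect_add]
  refine expect_mono fun c' => ?_
  obtain ⟨K, σ⟩ := c'
  by_cases h : K = []
  · subst h
    rw [run_nil]
    simp
  · refine le_trans (expect_le_of_support (c := 1) fun x _ => by split_ifs <;> simp) ?_
    rw [if_pos (c := (K, σ) ∈ {c : Config | c.1 ≠ []}) (by exact h)]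
    exact le_add_self

/-- After three times the expected running time the program is still running with probability at
most `1/3`, so stopping it there costs at most half of the success probability `2/3`. -/
lemma third_le_of_expectedTime_le {P : Cmd} {v : Val} {X : Set Val} {E B : ℕ}
    (hE : expectedTime P v ≤ E) (hX : 2 / 3 ≤ outputProb P v X) (hB : 3 * E ≤ B) (hB1 : 1 ≤ B) :
    1 / 3 ≤ (run B (start P v)).toOuterMeasure {c | c.1 = [] ∧ c.2 0 ∈ X} := by
  have h1 := outputProb_le_add_running B P v X
  have h2 := mul_running_le B P v
  set r := (run B (start P v)).toOuterMeasure {c | c.1 ≠ []} with hr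
  have h3 : r ≤ 1 / 3 := by
    rw [ENNReal.le_div_iff_mul_le (by simp) (by simp)]
    have hB0 : (B : ℝ≥0∞) ≠ 0 := by
      have : B ≠ 0 := by omega
      exact_mod_cast this
    have h4 : (B : ℝ≥0∞) * (r * 3) ≤ B * 1 := by
      calc (B : ℝ≥0∞) * (r * 3) = 3 * (B * r) := by ring
        _ ≤ 3 * E := by gcongr; exact h2.trans hE
        _ ≤ B * 1 := by rw [mul_one]; exact_mod_cast hB
    exact (ENNReal.mul_le_mul_iff_right hB0 (by simp)).1 h4
  have h5 : (2 / 3 : ℝ≥0∞) = 1 / 3 + 1 / 3 := by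
    rw [ENNReal.div_add_div_same]; norm_num
  have h6 : (1 / 3 : ℝ≥0∞) + 1 / 3 ≤
      (run B (start P v)).toOuterMeasure {c | c.1 = [] ∧ c.2 0 ∈ X} + 1 / 3 := by
    rw [← h5]
    exact hX.trans (h1.trans (add_le_add le_rfl h3))
  exact (ENNReal.add_le_add_iff_right (by simp)).1 h6

/-! ### Approximate solutions yield certificates -/

lemma encodeSet_cons {N : ℕ} (b : Fin (N + 1) → Bool) :
    Val.ofList (List.ofFn fun i => Val.ofBool (b i)) =
      Val.cons (Val.ofBool (b 0)) (Val.ofList (List.ofFn fun i => Val.ofBool (b (Fin.succ i)))) := by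
  rw [List.ofFn_succ]; rfl

lemma selBy_ofFn {ι : Type*} (p : ι → Bool) {N : ℕ} (S : Fin N → ι) (b : Fin N → Bool) :
    (selBy p (List.ofFn S) (Val.ofList (List.ofFn fun i => Val.ofBool (b i)))).length =
        (supp fun i => b i && p (S i)).card ∧
      ∀ i, b i = true → p (S i) = true →
        S i ∈ selBy p (List.ofFn S) (Val.ofList (List.ofFn fun i => Val.ofBool (b i))) := by
  induction N with
  | zero => exact ⟨by simp [selBy, supp], fun i => i.elim0⟩
  | succ N ih =>
    obtain ⟨h1, h2⟩ := ih (fun i => S i.succ) fun i => b i.succ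
    have hT : ∀ x, isTrue (Val.ofBool x) = x := by intro x; cases x <;> rfl
    rw [encodeSet_cons, List.ofFn_succ]
    simp only [selBy, Val.head, Val.tail, hT]
    constructor
    · rw [← countP_ofFn, List.ofFn_succ, List.countP_cons, countP_ofFn, ← h1]
      split_ifs <;> simp_all
    · intro i
      refine Fin.cases ?_ (fun i => ?_) i
      · intro hb hp
        rw [if_pos (by simp [hb, hp])]
        exact List.mem_cons_self
      · intro hb hp
        have := h2 i hb hp
        split_ifs
        · exact List.mem_cons_of_mem _ this
        · exact this

open Classical in
lemma two_mul_inducedEdges {N : ℕ} (H : SimpleGraph (Fin N)) (T : Finset (Fin N)) :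
    2 * inducedEdges H T = ((T ×ˢ T).filter fun p => H.Adj p.1 p.2).card := by
  rw [inducedEdges, ← SimpleGraph.coe_edgeFinset, Set.ncard_coe_finset,
    SimpleGraph.two_mul_card_edgeFinset]
  refine Finset.card_bij (fun p _ => (p.1.val, p.2.val)) ?_ ?_ ?_
  · intro p hp
    simp only [Finset.mem_filter, Finset.mem_univ, true_and, SimpleGraph.comap_adj] at hp
    exact Finset.mem_filter.2 ⟨Finset.mem_product.2 ⟨p.1.2, p.2.2⟩, hp⟩
  · intro p _ q _ h
    simp only [Prod.mk.injEq] at h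
    exact Prod.ext (Subtype.ext h.1) (Subtype.ext h.2)
  · rintro ⟨i, j⟩ h
    simp only [Finset.mem_filter, Finset.mem_product] at h
    exact ⟨(⟨i, h.1.1⟩, ⟨j, h.1.2⟩), by simpa using h.2, rfl⟩

lemma two_mul_inducedEdges_clique {N k : ℕ} {H : SimpleGraph (Fin N)} {K : Finset (Fin N)}
    (hK : H.IsNClique k K) : 2 * inducedEdges H K = k * (k - 1) := by
  classical
  rw [two_mul_inducedEdges]
  have : ((K ×ˢ K).filter fun p => H.Adj p.1 p.2) = K.offDiag := by
    ext ⟨i, j⟩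
    simp only [Finset.mem_filter, Finset.mem_product, Finset.mem_offDiag]
    constructor
    · rintro ⟨⟨h1, h2⟩, h3⟩; exact ⟨h1, h2, h3.ne⟩
    · rintro ⟨h1, h2, h3⟩
      exact ⟨⟨h1, h2⟩, hK.isClique h1 h2 h3⟩
  rw [this, Finset.offDiag_card, hK.card_eq, Nat.mul_sub, mul_one]

/-- The graph on the sets `S i` of `ℓ` vertices. -/
def blowGraph {n N : ℕ} (G : SimpleGraph (Fin n)) {ℓ : ℕ} (hℓ : 1 ≤ ℓ) (S : Fin N → Fin n → Bool) :
    SimpleGraph (Fin N) where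
  Adj i j := blow (adj G) ℓ S i j = true
  symm := ⟨fun i j h => by
    rw [blow_iff] at h ⊢
    refine ⟨h.2.1, h.1, fun x hx y hy => ?_⟩
    have := h.2.2 y hy x hx
    rw [adj_iff] at this ⊢
    exact this.symm⟩
  loopless := ⟨fun i h => by
    rw [blow_iff] at h
    obtain ⟨x, hx⟩ := Finset.card_pos.1 (show 0 < (supp (S i)).card by omega)
    exact G.loopless.irrefl x (adj_iff.1 (h.2.2 x hx x hx))⟩

lemma adj_blowGraph {n N : ℕ} (G : SimpleGraph (Fin n)) {ℓ : ℕ} (hℓ : 1 ≤ ℓ)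
    (S : Fin N → Fin n → Bool) : adj (blowGraph G hℓ S) = blow (adj G) ℓ S := by
  funext i j
  rw [Bool.eq_iff_iff, adj_iff]
  rfl

/-- Any `r ≤ k` of the sets with `ℓ` elements have at least `lam * r` elements in their union. -/
def Expanding {n N : ℕ} (k ℓ lam : ℕ) (S : Fin N → Fin n → Bool) : Prop :=
  ∀ I : Finset (Fin N), I.card ≤ k → (∀ i ∈ I, (supp (S i)).card = ℓ) →
    lam * I.card ≤ (I.biUnion fun i => supp (S i)).card

open Classical in
/-- By Hall's theorem the sets have disjoint subsets of size `lam`. -/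
lemma Expanding.card_marked_ge {n N k ℓ lam : ℕ} {G : SimpleGraph (Fin n)} (hℓ : 1 ≤ ℓ)
    {S : Fin N → Fin n → Bool} (hS : Expanding k ℓ lam S) {T : Finset (Fin N)} (hT : T.card = k)
    {C : List (Fin n → Bool)} (hC : ∀ i ∈ T, (supp (S i)).card = ℓ → S i ∈ C) :
    2 * inducedEdges (blowGraph G hℓ S) T * (lam * lam) ≤ (marked (adj G) C).card := by
  set H := blowGraph G hℓ S with hH
  set V := T.filter fun i => (supp (S i)).card = ℓ with hV
  -- Every set is taken `lam` times. Expansion is exactly Hall's condition for these copies, and a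
  -- system of distinct representatives assigns to each set `lam` vertices of its own.
  let t : V × Fin lam → Finset (Fin n) := fun q => supp (S q.1)
  have hall : ∀ s : Finset (V × Fin lam), s.card ≤ (s.biUnion t).card := by
    intro s
    set I : Finset (Fin N) := (s.image Prod.fst).map (Function.Embedding.subtype _) with hI
    have hIV : ∀ i ∈ I, i ∈ V := by
      intro i hi
      simp only [hI, Finset.mem_map, Function.Embedding.coe_subtype] at hi
      obtain ⟨x, -, rfl⟩ := hi
      exact x.2
    have h1 : s.card ≤ lam * I.card := by
      rw [hI, Finset.card_map]
      refine Finset.card_le_mul_card_image _ lam fun b _ => ?_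
      calc (s.filter fun q => q.1 = b).card ≤ (Finset.univ : Finset (Fin lam)).card := by
            refine Finset.card_le_card_of_injOn Prod.snd (fun _ _ => Finset.mem_univ _) ?_
            intro q hq q' hq' h
            simp only [Finset.coe_filter, Set.mem_ofPred_eq] at hq hq'
            exact Prod.ext (hq.2.trans hq'.2.symm) h
        _ = lam := by simp
    have h2 := hS I ((Finset.card_le_card fun i hi => (Finset.mem_filter.1 (hIV i hi)).1).trans
      hT.le) fun i hi => (Finset.mem_filter.1 (hIV i hi)).2
    refine h1.trans (h2.trans (Finset.card_le_card ?_))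
    intro x hx
    rw [Finset.mem_biUnion] at hx ⊢
    obtain ⟨i, hi, hx⟩ := hx
    simp only [hI, Finset.mem_map, Finset.mem_image, Function.Embedding.coe_subtype] at hi
    obtain ⟨y, ⟨q, hq, rfl⟩, rfl⟩ := hi
    exact ⟨q, hq, hx⟩
  obtain ⟨φ, hφ, hφt⟩ := (Finset.all_card_le_biUnion_card_iff_exists_injective t).1 hall
  rw [two_mul_inducedEdges]
  set R := (Finset.univ : Finset (V × V)).filter fun p => H.Adj p.1 p.2 with hR
  have hcard : ((T ×ˢ T).filter fun p => H.Adj p.1 p.2).card ≤ R.card := by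
    refine Finset.card_le_card_of_surjOn (fun p => (p.1.val, p.2.val)) ?_
    rintro ⟨i, j⟩ h
    simp only [Finset.coe_filter, Finset.mem_product, Set.mem_ofPred_eq] at h
    have hb := blow_iff.1 h.2
    refine ⟨(⟨i, Finset.mem_filter.2 ⟨h.1.1, hb.1⟩⟩, ⟨j, Finset.mem_filter.2 ⟨h.1.2, hb.2.1⟩⟩), ?_, rfl⟩
    simp only [hR, Finset.coe_filter, Finset.mem_univ, true_and, Set.mem_ofPred_eq]
    exact h.2
  calc _ ≤ R.card * (lam * lam) := Nat.mul_le_mul_right _ hcard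
    _ = (R ×ˢ (Finset.univ : Finset (Fin lam × Fin lam))).card := by
        simp [Finset.card_product]
    _ ≤ (marked (adj G) C).card := by
        -- An adjacent ordered pair of sets and two copy indices are sent to the pair of
        -- representatives. It is marked because the two sets are completely joined, and the map is
        -- injective because the representatives are distinct.
        refine Finset.card_le_card_of_injOn
          (fun z => (φ (z.1.1, z.2.1), φ (z.1.2, z.2.2))) ?_ ?_
        · rintro ⟨⟨i, j⟩, r, r'⟩ hz
          simp only [Finset.coe_product, Set.mem_prod, Finset.mem_coe, hR, Finset.mem_filter,
            Finset.mem_univ, true_and, and_true] at hz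
          have hb := blow_iff.1 hz
          rw [Finset.mem_coe, mem_marked]
          exact ⟨S i, hC i (Finset.mem_filter.1 i.2).1 hb.1, S j,
            hC j (Finset.mem_filter.1 j.2).1 hb.2.1, hb.2.2, hφt (i, r), hφt (j, r')⟩
        · rintro ⟨⟨i, j⟩, r, r'⟩ - ⟨⟨i', j'⟩, u, u'⟩ - h
          simp only [Prod.mk.injEq] at h
          have h1 := hφ h.1
          have h2 := hφ h.2
          simp only [Prod.mk.injEq] at h1 h2
          simp [h1, h2]

/-- The `k`-clique spans `k * (k - 1) / 2` edges, so approximation within `γ`, where `γ * Θ ≤ k`,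
leaves `T` at least `(k - 1) * Θ / 2` edges. Expansion turns each of them into `2 * lam ^ 2` marked
pairs, and `hnum` compares this with the length of the description. -/
lemma isCert_of_approx {n N k ℓ lam a Θ : ℕ} {G : SimpleGraph (Fin n)} (hℓ : 1 ≤ ℓ)
    {S : Fin N → Fin n → Bool} (hS : Expanding k ℓ lam S) {γ : ℝ} (hk : 1 ≤ k)
    (hγ : γ * Θ ≤ k) (hnum : 4 * (k * ℓ * a + k * k) < (k - 1) * Θ * (lam * lam))
    {K : Finset (Fin N)} (hK : (blowGraph G hℓ S).IsNClique k K) {T : Finset (Fin N)}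
    (hT : IsApproxSolution (blowGraph G hℓ S) k γ T) :
    IsCert (adj G) a ℓ (chosen ℓ S (encodeSet T)) := by
  set H := blowGraph G hℓ S with hH
  obtain ⟨hTk, hTapx⟩ := hT
  obtain ⟨hlen, hmem⟩ := selBy_ofFn (fun s : Fin n → Bool => decide ((supp s).card = ℓ)) S
    fun i => decide (i ∈ T)
  have hlen' : (chosen ℓ S (encodeSet T)).length ≤ k := by
    rw [chosen, encodeSet, hlen, ← hTk]
    refine Finset.card_le_card fun i hi => ?_
    simp only [mem_supp, Bool.and_eq_true, decide_eq_true_eq] at hi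
    exact hi.1
  have hmarked := hS.card_marked_ge (G := G) hℓ hTk (C := chosen ℓ S (encodeSet T))
    fun i hi hv => hmem i (by simpa using hi) (by simpa using hv)
  have hedges : (k - 1) * Θ ≤ 2 * inducedEdges H T := by
    have h1 := hTapx K hK.card_eq
    have h2 : (2 * inducedEdges H K : ℝ) = k * (k - 1 : ℕ) := by
      exact_mod_cast two_mul_inducedEdges_clique hK
    have hkpos : (0 : ℝ) < k := by exact_mod_cast hk
    have h3 : (k : ℝ) * (((k - 1 : ℕ) : ℝ) * Θ) ≤ k * (2 * inducedEdges H T) := by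
      calc (k : ℝ) * (((k - 1 : ℕ) : ℝ) * Θ) = 2 * inducedEdges H K * Θ := by rw [h2]; ring
        _ ≤ 2 * (γ * inducedEdges H T) * Θ := by gcongr
        _ = γ * Θ * (2 * inducedEdges H T) := by ring
        _ ≤ k * (2 * inducedEdges H T) := by gcongr
    have h4 := le_of_mul_le_mul_left h3 hkpos
    exact_mod_cast h4
  unfold IsCert
  calc 4 * ((chosen ℓ S (encodeSet T)).length * ℓ * a +
        (chosen ℓ S (encodeSet T)).length * (chosen ℓ S (encodeSet T)).length)
      ≤ 4 * (k * ℓ * a + k * k) := by gcongr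
    _ < (k - 1) * Θ * (lam * lam) := hnum
    _ ≤ 2 * inducedEdges H T * (lam * lam) := by gcongr
    _ ≤ _ := hmarked

end

end DkS

/-! ### Random sets: expansion and hitting the parts of a clique -/

namespace DkS

noncomputable section

open Enc (enc sz one_le_sz)

/-! ### Random sets -/

lemma expect_sum {ι κ : Type*} (μ : PMF ι) (s : Finset κ) (U : κ → ι → ℝ≥0∞) :
    expect μ (fun x => ∑ z ∈ s, U z x) = ∑ z ∈ s, expect μ (U z) := by
  unfold expect
  simp only [Finset.mul_sum]
  exact Summable.tsum_finsetSum fun _ _ => ENNReal.summable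

lemma prod_ite_mem {n : ℕ} (U : Finset (Fin n)) (β : ℝ≥0∞) :
    ∏ i : Fin n, (if i ∈ U then β else 1) = β ^ U.card := by
  rw [Finset.prod_ite_mem]
  simp

open Classical in
lemma expect_contains {n a : ℕ} (U : Finset (Fin n)) :
    expect (piP n (rareBit a)) (fun s => if U ⊆ supp s then 1 else 0) = ((2⁻¹ : ℝ≥0∞) ^ a) ^ U.card := by
  have h : ∀ s : Fin n → Bool, (if U ⊆ supp s then (1 : ℝ≥0∞) else 0) =
      ∏ i, if i ∈ U then (if s i = true then 1 else 0) else 1 := by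
    intro s
    split_ifs with hs
    · refine (Finset.prod_eq_one fun i _ => ?_).symm
      split_ifs with h1 h2
      · rfl
      · exact absurd (mem_supp.1 (hs h1)) h2
      · rfl
    · obtain ⟨i, hi, hi'⟩ := Finset.not_subset.1 hs
      refine (Finset.prod_eq_zero (Finset.mem_univ i) ?_).symm
      rw [if_pos hi, if_neg (by simpa using hi')]
  simp only [h]
  rw [expect_piP_prod n (rareBit a) fun i b => if i ∈ U then (if b = true then 1 else 0) else 1,
    ← prod_ite_mem]
  refine Finset.prod_congr rfl fun i _ => ?_
  by_cases hi : i ∈ U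
  · simp only [hi, if_true, expect_bool]
    simp [rareBit_true]
  · simp [hi]

open Classical in
/-- Indicator of the sets of `ℓ` elements in `W`. -/
def inside {n : ℕ} (ℓ : ℕ) (W : Finset (Fin n)) (s : Fin n → Bool) : ℝ≥0∞ :=
  if (supp s).card = ℓ ∧ supp s ⊆ W then 1 else 0

/-- A union bound over the `ℓ`-subsets of `W`, each contained in the random set with probability `2
^ (-a * ℓ)`. -/
lemma expect_inside_le {n a : ℕ} (ℓ : ℕ) (W : Finset (Fin n)) :
    expect (piP n (rareBit a)) (inside ℓ W) ≤ (W.card : ℝ≥0∞) ^ ℓ * ((2⁻¹ : ℝ≥0∞) ^ a) ^ ℓ := by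
  classical
  calc expect (piP n (rareBit a)) (inside ℓ W)
      ≤ expect (piP n (rareBit a)) (fun s => ∑ U ∈ Finset.powersetCard ℓ W,
          if U ⊆ supp s then 1 else 0) := by
        refine expect_mono fun s => ?_
        unfold inside
        split_ifs with h
        · have hmem : supp s ∈ Finset.powersetCard ℓ W := Finset.mem_powersetCard.2 ⟨h.2, h.1⟩
          refine le_trans ?_ (Finset.single_le_sum (fun _ _ => zero_le) hmem)
          simp
        · exact zero_le
    _ = ∑ U ∈ Finset.powersetCard ℓ W, ((2⁻¹ : ℝ≥0∞) ^ a) ^ ℓ := by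
        rw [expect_sum]
        refine Finset.sum_congr rfl fun U hU => ?_
        rw [expect_contains, (Finset.mem_powersetCard.1 hU).2]
    _ = (W.card.choose ℓ : ℝ≥0∞) * ((2⁻¹ : ℝ≥0∞) ^ a) ^ ℓ := by
        rw [Finset.sum_const, Finset.card_powersetCard, nsmul_eq_mul]
    _ ≤ _ := by
        gcongr
        exact_mod_cast Nat.choose_le_pow _ _

lemma one_le_pow_add_mul {x β : ℝ≥0∞} (h : x + β = 1) (m : ℕ) : 1 ≤ x ^ m + m * β := by
  have hx : x ≤ 1 := h ▸ le_self_add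
  induction m with
  | zero => simp
  | succ m ih =>
    calc 1 = x * 1 + β := by rw [mul_one, h]
      _ ≤ x * (x ^ m + m * β) + β := by gcongr
      _ = x ^ (m + 1) + x * (m * β) + β := by ring
      _ ≤ x ^ (m + 1) + 1 * (m * β) + β := by gcongr
      _ = _ := by push_cast; ring

/-- By Bernoulli's inequality `(1 - 2 ^ (-a)) ^ (2 ^ (a - 1)) ≥ 1/2`; squaring reaches the exponent
`2 ^ a ≥ n`. -/
lemma quarter_le_pow {a n : ℕ} (ha : 1 ≤ a) (hn : n ≤ 2 ^ a) :
    (4⁻¹ : ℝ≥0∞) ≤ (1 - (2⁻¹ : ℝ≥0∞) ^ a) ^ n := by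
  set β := (2⁻¹ : ℝ≥0∞) ^ a with hβ
  have hβ1 : β ≤ 1 := pow_le_one' (by simp) a
  have hsum : (1 - β) + β = 1 := tsub_add_cancel_of_le hβ1
  obtain ⟨b, rfl⟩ : ∃ b, a = b + 1 := ⟨a - 1, by omega⟩
  have h2 : (2 : ℝ≥0∞) * 2⁻¹ = 1 := ENNReal.mul_inv_cancel (by simp) (by simp)
  have hhalf : ((2 ^ b : ℕ) : ℝ≥0∞) * β = 2⁻¹ := by
    rw [hβ, pow_succ, ← mul_assoc]
    push_cast
    rw [← mul_pow, h2, one_pow, one_mul]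
  have h1 : (2⁻¹ : ℝ≥0∞) ≤ (1 - β) ^ (2 ^ b) := by
    have h := one_le_pow_add_mul hsum (2 ^ b)
    rw [hhalf] at h
    have h' : (2⁻¹ : ℝ≥0∞) + 2⁻¹ ≤ (1 - β) ^ 2 ^ b + 2⁻¹ := by rwa [ENNReal.inv_two_add_inv_two]
    exact (ENNReal.add_le_add_iff_right (by simp)).1 h'
  calc (4⁻¹ : ℝ≥0∞) = 2⁻¹ ^ 2 := by rw [← ENNReal.inv_pow]; norm_num
    _ ≤ ((1 - β) ^ (2 ^ b)) ^ 2 := by gcongr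
    _ = (1 - β) ^ (2 ^ (b + 1)) := by rw [← pow_mul, ← pow_succ]
    _ ≤ (1 - β) ^ n := pow_le_pow_right_of_le_one' tsub_le_self hn

/-- The random set equals a given `ℓ`-subset of `W` with probability at least `2 ^ (-a * ℓ) / 4`:
the factor `1/4` pays for the absence of the other vertices. Distinct subsets are disjoint events.
-/
lemma le_expect_inside {n a : ℕ} (ha : 1 ≤ a) (hn : n ≤ 2 ^ a) (ℓ : ℕ) (W : Finset (Fin n)) :
    (W.card.choose ℓ : ℝ≥0∞) * (((2⁻¹ : ℝ≥0∞) ^ a) ^ ℓ * 4⁻¹) ≤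
      expect (piP n (rareBit a)) (inside ℓ W) := by
  classical
  let χ : Finset (Fin n) → Fin n → Bool := fun U i => decide (i ∈ U)
  have hχ : ∀ U, supp (χ U) = U := by intro U; ext i; simp [χ]
  have hinj : Function.Injective χ := Function.LeftInverse.injective (g := supp) hχ
  have hval : ∀ U ∈ Finset.powersetCard ℓ W, ((2⁻¹ : ℝ≥0∞) ^ a) ^ ℓ * 4⁻¹ ≤
      piP n (rareBit a) (χ U) * inside ℓ W (χ U) := by
    intro U hU
    rw [Finset.mem_powersetCard] at hU
    have h1 : inside ℓ W (χ U) = 1 := by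
      unfold inside
      rw [hχ, if_pos ⟨hU.2, hU.1⟩]
    rw [h1, mul_one, piP_apply, ← hU.2, ← prod_ite_mem]
    calc (∏ i : Fin n, if i ∈ U then (2⁻¹ : ℝ≥0∞) ^ a else 1) * 4⁻¹
        ≤ (∏ i : Fin n, if i ∈ U then (2⁻¹ : ℝ≥0∞) ^ a else 1) * (1 - (2⁻¹ : ℝ≥0∞) ^ a) ^ n := by
          gcongr; exact quarter_le_pow ha hn
      _ = ∏ i : Fin n, (if i ∈ U then (2⁻¹ : ℝ≥0∞) ^ a else 1) * (1 - (2⁻¹ : ℝ≥0∞) ^ a) := by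
          rw [Finset.prod_mul_distrib]; simp
      _ ≤ ∏ i : Fin n, rareBit a (χ U i) := by
          refine Finset.prod_le_prod' fun i _ => ?_
          by_cases hi : i ∈ U
          · simp only [χ, hi, if_true, decide_true, rareBit_true]
            exact mul_le_of_le_one_right' tsub_le_self
          · simp [χ, hi, rareBit_false]
  calc (W.card.choose ℓ : ℝ≥0∞) * (((2⁻¹ : ℝ≥0∞) ^ a) ^ ℓ * 4⁻¹)
      = ∑ U ∈ Finset.powersetCard ℓ W, ((2⁻¹ : ℝ≥0∞) ^ a) ^ ℓ * 4⁻¹ := by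
        rw [Finset.sum_const, Finset.card_powersetCard, nsmul_eq_mul]
    _ ≤ ∑ U ∈ Finset.powersetCard ℓ W, piP n (rareBit a) (χ U) * inside ℓ W (χ U) :=
        Finset.sum_le_sum hval
    _ = ∑ s ∈ (Finset.powersetCard ℓ W).image χ, piP n (rareBit a) s * inside ℓ W s :=
        (Finset.sum_image (f := fun s => piP n (rareBit a) s * inside ℓ W s)
          fun U _ U' _ h => hinj h).symm
    _ ≤ ∑ s, piP n (rareBit a) s * inside ℓ W s :=
        Finset.sum_le_sum_of_subset (Finset.subset_univ _)
    _ = _ := (expect_fintype _ _).symm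

lemma half_pow_mul_two_pow (a ℓ : ℕ) : ((2 : ℝ≥0∞) ^ a) ^ ℓ * ((2⁻¹ : ℝ≥0∞) ^ a) ^ ℓ = 1 := by
  rw [← mul_pow, ← mul_pow, ENNReal.mul_inv_cancel (by simp) (by simp), one_pow, one_pow]

open Classical in
-- If expansion fails for `r` sets, they all lie in some `W` of size `lam * r`. The choices of the
-- sets and of `W` number at most `N ^ r * n ^ (lam * r)`, and independence gives an `r`-th power
-- again. The total is `X ^ r ≤ X`, summed over `1 ≤ r ≤ k`.
lemma expect_not_expanding_le {n N k ℓ lam a : ℕ} (hlam : lam * k ≤ n)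
    (hX : 3 * k * (N * n ^ lam * (lam * k) ^ ℓ) ≤ (2 ^ a) ^ ℓ) :
    expect (piP N (piP n (rareBit a))) (fun S => if Expanding k ℓ lam S then 0 else 1) ≤ 1 / 3 := by
  set ν := piP n (rareBit a) with hν
  let Y : Finset (Fin N) → Finset (Fin n) → (Fin N → Fin n → Bool) → ℝ≥0∞ := fun I W S =>
    ∏ i, if i ∈ I then inside ℓ W (S i) else 1
  set X : ℝ≥0∞ := N * n ^ lam * (lam * k) ^ ℓ * ((2⁻¹ : ℝ≥0∞) ^ a) ^ ℓ with hXdef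
  have hkX : 3 * k * X ≤ 1 := by
    rw [hXdef, ← half_pow_mul_two_pow a ℓ]
    calc _ = ((3 * k * (N * n ^ lam * (lam * k) ^ ℓ) : ℕ) : ℝ≥0∞) * ((2⁻¹ : ℝ≥0∞) ^ a) ^ ℓ := by
          push_cast; ring
      _ ≤ (((2 ^ a) ^ ℓ : ℕ) : ℝ≥0∞) * ((2⁻¹ : ℝ≥0∞) ^ a) ^ ℓ := by gcongr
      _ = _ := by push_cast; rfl
  have hY : ∀ r ≤ k, ∀ I ∈ Finset.powersetCard r (Finset.univ : Finset (Fin N)),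
      ∀ W ∈ Finset.powersetCard (lam * r) (Finset.univ : Finset (Fin n)),
      expect (piP N ν) (Y I W) ≤ ((lam * k) ^ ℓ * ((2⁻¹ : ℝ≥0∞) ^ a) ^ ℓ) ^ r := by
    intro r hr I hI W hW
    rw [Finset.mem_powersetCard] at hI hW
    have h1 : expect (piP N ν) (Y I W) = (expect ν (inside ℓ W)) ^ r := by
      rw [expect_piP_prod N ν fun i s => if i ∈ I then inside ℓ W s else 1, ← hI.2,
        ← prod_ite_mem]
      refine Finset.prod_congr rfl fun i _ => ?_
      by_cases hi : i ∈ I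
      · simp only [hi, if_true]
      · simp [hi]
    rw [h1]
    gcongr
    refine (expect_inside_le ℓ W).trans ?_
    rw [hW.2]
    push_cast
    gcongr
  have hind : ∀ S : Fin N → Fin n → Bool, (if Expanding k ℓ lam S then (0 : ℝ≥0∞) else 1) ≤
      ∑ r ∈ Finset.Icc 1 k, ∑ I ∈ Finset.powersetCard r (Finset.univ : Finset (Fin N)),
        ∑ W ∈ Finset.powersetCard (lam * r) (Finset.univ : Finset (Fin n)), Y I W S := by
    intro S
    split_ifs with h
    · exact zero_le
    · unfold Expanding at h
      push Not at h
      obtain ⟨I, hIk, hval, hlt⟩ := h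
      have hpos : 1 ≤ I.card := by
        rcases Nat.eq_zero_or_pos I.card with h0 | h0
        · rw [h0] at hlt; simp at hlt
        · exact h0
      obtain ⟨W, hIW, -, hW⟩ := Finset.exists_subsuperset_card_eq
        (Finset.subset_univ (I.biUnion fun i => supp (S i))) hlt.le
        (by rw [Finset.card_univ, Fintype.card_fin]
            exact (Nat.mul_le_mul_left lam hIk).trans hlam)
      have hone : Y I W S = 1 := by
        refine Finset.prod_eq_one fun i _ => ?_
        split_ifs with hi
        · unfold inside
          exact if_pos ⟨hval i hi, (Finset.subset_biUnion_of_mem (fun i => supp (S i)) hi).trans hIW⟩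
        · rfl
      calc (1 : ℝ≥0∞) = Y I W S := hone.symm
        _ ≤ ∑ W ∈ Finset.powersetCard (lam * I.card) (Finset.univ : Finset (Fin n)), Y I W S :=
          Finset.single_le_sum (f := fun W => Y I W S) (fun _ _ => zero_le)
            (Finset.mem_powersetCard.2 ⟨Finset.subset_univ _, hW⟩)
        _ ≤ ∑ I' ∈ Finset.powersetCard I.card (Finset.univ : Finset (Fin N)),
            ∑ W ∈ Finset.powersetCard (lam * I.card) (Finset.univ : Finset (Fin n)), Y I' W S :=
          Finset.single_le_sum (f := fun I' => ∑ W ∈ Finset.powersetCard (lam * I.card)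
            (Finset.univ : Finset (Fin n)), Y I' W S) (fun _ _ => zero_le)
            (Finset.mem_powersetCard.2 ⟨Finset.subset_univ _, rfl⟩)
        _ ≤ _ := Finset.single_le_sum (f := fun r =>
            ∑ I' ∈ Finset.powersetCard r (Finset.univ : Finset (Fin N)),
            ∑ W ∈ Finset.powersetCard (lam * r) (Finset.univ : Finset (Fin n)), Y I' W S)
            (fun _ _ => zero_le) (Finset.mem_Icc.2 ⟨hpos, hIk⟩)
  have hterm : ∀ r ∈ Finset.Icc 1 k,
      ∑ I ∈ Finset.powersetCard r (Finset.univ : Finset (Fin N)),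
        ∑ W ∈ Finset.powersetCard (lam * r) (Finset.univ : Finset (Fin n)),
          expect (piP N ν) (Y I W) ≤ X := by
    intro r hr
    rw [Finset.mem_Icc] at hr
    have hX1 : X ≤ 1 := by
      refine le_trans ?_ hkX
      refine le_mul_of_one_le_left' ?_
      have : 1 ≤ 3 * k := by omega
      exact_mod_cast this
    calc _ ≤ ∑ I ∈ Finset.powersetCard r (Finset.univ : Finset (Fin N)),
        ∑ W ∈ Finset.powersetCard (lam * r) (Finset.univ : Finset (Fin n)),
          ((lam * k) ^ ℓ * ((2⁻¹ : ℝ≥0∞) ^ a) ^ ℓ) ^ r :=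
          Finset.sum_le_sum fun I hI => Finset.sum_le_sum fun W hW => hY r hr.2 I hI W hW
      _ = (N.choose r : ℝ≥0∞) * ((n.choose (lam * r) : ℝ≥0∞) *
          ((lam * k) ^ ℓ * ((2⁻¹ : ℝ≥0∞) ^ a) ^ ℓ) ^ r) := by
          simp only [Finset.sum_const, Finset.card_powersetCard, nsmul_eq_mul, Finset.card_univ,
            Fintype.card_fin]
      _ ≤ (N : ℝ≥0∞) ^ r * ((n : ℝ≥0∞) ^ (lam * r) *
          ((lam * k) ^ ℓ * ((2⁻¹ : ℝ≥0∞) ^ a) ^ ℓ) ^ r) := by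
          gcongr
          · exact_mod_cast Nat.choose_le_pow _ _
          · exact_mod_cast Nat.choose_le_pow _ _
      _ = X ^ r := by rw [hXdef, pow_mul, ← mul_pow, ← mul_pow]; ring
      _ ≤ X ^ 1 := pow_le_pow_right_of_le_one' hX1 hr.1
      _ = X := pow_one X
  calc _ ≤ _ := expect_mono hind
    _ = ∑ r ∈ Finset.Icc 1 k, ∑ I ∈ Finset.powersetCard r (Finset.univ : Finset (Fin N)),
        ∑ W ∈ Finset.powersetCard (lam * r) (Finset.univ : Finset (Fin n)),
          expect (piP N ν) (Y I W) := by simp only [expect_sum]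
    _ ≤ ∑ r ∈ Finset.Icc 1 k, X := Finset.sum_le_sum hterm
    _ = k * X := by simp
    _ ≤ 1 / 3 := by
        rw [ENNReal.le_div_iff_mul_le (by simp) (by simp)]
        calc k * X * 3 = 3 * k * X := by ring
          _ ≤ 1 := hkX

open Classical in
-- A part `W j` captures one sampled `ℓ`-set with probability `ρ`, and `hN` says that `N * ρ ≥ 3 *
-- k`. It is missed by all `N` sets with probability `(1 - ρ) ^ N ≤ 1 / (N * ρ)`; a union bound over
-- the `k` parts follows.
lemma expect_missing_le {n N k m ℓ a : ℕ} (ha : 1 ≤ a) (hn : n ≤ 2 ^ a)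
    (hN : 12 * k * (2 ^ a) ^ ℓ ≤ N * m.choose ℓ) (W : Fin k → Finset (Fin n))
    (hW : ∀ j, (W j).card = m) :
    expect (piP N (piP n (rareBit a))) (fun S =>
      if ∀ j, ∃ i, (supp (S i)).card = ℓ ∧ supp (S i) ⊆ W j then 0 else 1) ≤ 1 / 3 := by
  set ν := piP n (rareBit a) with hν
  let out : Fin k → (Fin n → Bool) → ℝ≥0∞ := fun j s =>
    if (supp s).card = ℓ ∧ supp s ⊆ W j then 0 else 1
  have hind : ∀ S : Fin N → Fin n → Bool,
      (if ∀ j, ∃ i, (supp (S i)).card = ℓ ∧ supp (S i) ⊆ W j then (0 : ℝ≥0∞) else 1) ≤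
        ∑ j, ∏ i, out j (S i) := by
    intro S
    split_ifs with h
    · exact zero_le
    · push Not at h
      obtain ⟨j, hj⟩ := h
      refine le_trans ?_ (Finset.single_le_sum (f := fun j => ∏ i, out j (S i))
        (fun _ _ => zero_le) (Finset.mem_univ j))
      refine (Finset.prod_eq_one fun i _ => ?_).ge
      exact if_neg fun h' => hj i h'.1 h'.2
  have hj : ∀ j, expect (piP N ν) (fun S => ∏ i, out j (S i)) ≤ (3 * k : ℝ≥0∞)⁻¹ := by
    intro j
    have hk : k ≠ 0 := by rintro rfl; exact j.elim0
    rw [expect_piP_prod N ν fun _ => out j, Finset.prod_const, Finset.card_univ, Fintype.card_fin]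
    set q := expect ν (out j) with hq
    set ρ := expect ν (inside ℓ (W j)) with hρ
    have hsum : q + ρ = 1 := by
      rw [hq, hρ, ← expect_add, ← expect_const ν 1]
      congr 1
      funext s
      simp only [out, inside]
      split_ifs <;> simp
    -- Together with Bernoulli's `N * ρ ≤ (1 + ρ) ^ N` this gives `q ^ N ≤ 1 / (N * ρ)` without
    -- exponentials or subtraction.
    have hqρ : q * (1 + ρ) ≤ 1 := by
      have hq1 : q ≤ 1 := hsum ▸ le_self_add
      calc q * (1 + ρ) = q + q * ρ := by ring
        _ ≤ q + 1 * ρ := by gcongr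
        _ = 1 := by rw [one_mul, hsum]
    have hbern : ∀ N : ℕ, (N : ℝ≥0∞) * ρ ≤ (1 + ρ) ^ N := by
      intro N
      have : 1 + (N : ℝ≥0∞) * ρ ≤ (1 + ρ) ^ N := by
        induction N with
        | zero => simp
        | succ N ih =>
          calc 1 + ((N + 1 : ℕ) : ℝ≥0∞) * ρ ≤ 1 + (N + 1 : ℕ) * ρ + N * ρ * ρ := le_self_add
            _ = (1 + N * ρ) * (1 + ρ) := by push_cast; ring
            _ ≤ (1 + ρ) ^ N * (1 + ρ) := by gcongr
            _ = _ := (pow_succ _ _).symm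
      exact le_add_self.trans this
    have hNρ : (3 * k : ℝ≥0∞) ≤ N * ρ := by
      have h1 := le_expect_inside ha hn ℓ (W j)
      rw [← hν, ← hρ, hW] at h1
      have h4 : (4 : ℝ≥0∞) * 4⁻¹ = 1 := ENNReal.mul_inv_cancel (by simp) (by simp)
      calc (3 * k : ℝ≥0∞) = 3 * k * 1 * 1 := by ring
        _ = 3 * k * (4 * 4⁻¹) * (((2 : ℝ≥0∞) ^ a) ^ ℓ * ((2⁻¹ : ℝ≥0∞) ^ a) ^ ℓ) := by
            rw [h4, half_pow_mul_two_pow]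
        _ = ((12 * k * (2 ^ a) ^ ℓ : ℕ) : ℝ≥0∞) * (((2⁻¹ : ℝ≥0∞) ^ a) ^ ℓ * 4⁻¹) := by
            push_cast; ring
        _ ≤ ((N * m.choose ℓ : ℕ) : ℝ≥0∞) * (((2⁻¹ : ℝ≥0∞) ^ a) ^ ℓ * 4⁻¹) := by gcongr
        _ = N * (m.choose ℓ * (((2⁻¹ : ℝ≥0∞) ^ a) ^ ℓ * 4⁻¹)) := by push_cast; ring
        _ ≤ N * ρ := by gcongr
    have hfin : q ^ N * (3 * k) ≤ 1 := by
      calc q ^ N * (3 * k) ≤ q ^ N * (1 + ρ) ^ N := by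
            gcongr; exact hNρ.trans (hbern N)
        _ = (q * (1 + ρ)) ^ N := (mul_pow _ _ _).symm
        _ ≤ 1 := pow_le_one' hqρ N
    rw [← one_div, ENNReal.le_div_iff_mul_le]
    · exact hfin
    · left; simp [hk]
    · left; exact ENNReal.mul_ne_top (by simp) (by simp)
  calc _ ≤ _ := expect_mono hind
    _ = ∑ j, expect (piP N ν) (fun S => ∏ i, out j (S i)) := expect_sum _ _ _
    _ ≤ ∑ _j : Fin k, (3 * k : ℝ≥0∞)⁻¹ := Finset.sum_le_sum fun j _ => hj j
    _ = k * (3 * k : ℝ≥0∞)⁻¹ := by simp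
    _ ≤ 1 / 3 := by
        rw [ENNReal.mul_inv (by simp) (by simp), mul_comm, mul_assoc, one_div]
        refine mul_le_of_le_one_right' ?_
        exact ENNReal.inv_mul_le_one _

lemma exists_disjoint_parts {n k m : ℕ} {K : Finset (Fin n)} (h : k * m ≤ K.card) :
    ∃ W : Fin k → Finset (Fin n), (∀ j, (W j).card = m) ∧ (∀ j, W j ⊆ K) ∧
      ∀ j j', j ≠ j' → Disjoint (W j) (W j') := by
  classical
  obtain ⟨e⟩ : Nonempty (Fin k × Fin m ↪ {x // x ∈ K}) :=
    Function.Embedding.nonempty_of_card_le (by simpa using h)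
  have hinj : ∀ p p', ((e p : Fin n) = e p') → p = p' := fun p p' h => e.injective (Subtype.ext h)
  refine ⟨fun j => Finset.univ.image fun r => (e (j, r) : Fin n), fun j => ?_, fun j x hx => ?_,
    fun j j' hj => ?_⟩
  · rw [Finset.card_image_of_injective]
    · simp
    · intro r r' h
      have := hinj _ _ h
      simpa using this
  · simp only [Finset.mem_image] at hx
    obtain ⟨r, -, rfl⟩ := hx
    exact (e (j, r)).2
  · rw [Finset.disjoint_left]
    intro x hx hx'
    simp only [Finset.mem_image] at hx hx'
    obtain ⟨r, -, rfl⟩ := hx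
    obtain ⟨r', -, h⟩ := hx'
    have := hinj _ _ h
    simp only [Prod.mk.injEq] at this
    exact hj this.1.symm

/-- Sets in different parts of a clique are completely joined; disjointness of the parts excludes a
common vertex, which would not be adjacent to itself. Adjacency also shows that the chosen indices
are distinct. -/
lemma exists_clique_blowGraph {n N k ℓ : ℕ} {G : SimpleGraph (Fin n)} (hℓ : 1 ≤ ℓ)
    {K : Finset (Fin n)} (hK : G.IsClique K) {W : Fin k → Finset (Fin n)} (hWK : ∀ j, W j ⊆ K)
    (hdisj : ∀ j j', j ≠ j' → Disjoint (W j) (W j')) {S : Fin N → Fin n → Bool}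
    (hS : ∀ j, ∃ i, (supp (S i)).card = ℓ ∧ supp (S i) ⊆ W j) :
    ∃ T, (blowGraph G hℓ S).IsNClique k T := by
  classical
  choose i hi hiW using hS
  have hne : ∀ j j', j ≠ j' → (blowGraph G hℓ S).Adj (i j) (i j') := by
    intro j j' hj
    refine blow_iff.2 ⟨hi j, hi j', fun x hx y hy => adj_iff.2 ?_⟩
    refine hK (hWK j (hiW j hx)) (hWK j' (hiW j' hy)) ?_
    rintro rfl
    exact Finset.disjoint_left.1 (hdisj j j' hj) (hiW j hx) (hiW j' hy)
  have hinj : Function.Injective i := by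
    intro j j' h
    by_contra hj
    exact (hne j j' hj).ne h
  refine ⟨Finset.univ.image i, ?_, ?_⟩
  · intro x hx y hy hxy
    simp only [Finset.coe_image, Finset.coe_univ, Set.image_univ, Set.mem_range] at hx hy
    obtain ⟨j, rfl⟩ := hx
    obtain ⟨j', rfl⟩ := hy
    exact hne j j' fun h => hxy (by rw [h])
  · rw [Finset.card_image_of_injective _ hinj]; simp

/-- With suitable parameters an attempt succeeds with constant probability. -/
lemma ninth_le_attempt {P : Cmd} {g : ℕ → ℝ} {f : ℕ → ℕ} {c : ℕ}
    (hP : ApproximatesDkS hasClique P g f c) {n k ℓ lam a m N B Θ : ℕ} {G : SimpleGraph (Fin n)}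
    {K : Finset (Fin n)} (hK : G.IsClique K) (hk : 1 ≤ k) (hℓ : 1 ≤ ℓ) (ha : 1 ≤ a)
    (hn : n ≤ 2 ^ a) (hlam : lam * k ≤ n) (hm : k * m ≤ K.card)
    (hX : 3 * k * (N * n ^ lam * (lam * k) ^ ℓ) ≤ (2 ^ a) ^ ℓ)
    (hN : 12 * k * (2 ^ a) ^ ℓ ≤ N * m.choose ℓ) (hB : 3 * (f k * N ^ c) ≤ B) (hB1 : 1 ≤ B)
    (hγ : g k * Θ ≤ k) (hnum : 4 * (k * ℓ * a + k * k) < (k - 1) * Θ * (lam * lam)) :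
    1 / 9 ≤ attempt P (mat (adj G), k, ℓ, a, 2 ^ a, N, B) true := by
  classical
  obtain ⟨W, hWm, hWK, hdisj⟩ := exists_disjoint_parts hm
  have h1 := expect_not_expanding_le (N := N) hlam hX
  have h2 := expect_missing_le ha hn hN W hWm
  set μ := piP N (piP n (rareBit a)) with hμ
  let good : (Fin N → Fin n → Bool) → ℝ≥0∞ := fun S => if Expanding k ℓ lam S ∧
    ∀ j, ∃ i, (supp (S i)).card = ℓ ∧ supp (S i) ⊆ W j then 1 else 0
  have hgood : 1 / 3 ≤ expect μ good := by
    have hsum : (1 : ℝ≥0∞) ≤ expect μ good + 1 / 3 + 1 / 3 := by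
      calc (1 : ℝ≥0∞) = expect μ fun _ => 1 := (expect_const _ _).symm
        _ ≤ expect μ (fun S => good S + (if Expanding k ℓ lam S then 0 else 1) +
            (if ∀ j, ∃ i, (supp (S i)).card = ℓ ∧ supp (S i) ⊆ W j then 0 else 1)) := by
            refine expect_mono fun S => ?_
            by_cases e1 : Expanding k ℓ lam S
            · by_cases e2 : ∀ j, ∃ i, (supp (S i)).card = ℓ ∧ supp (S i) ⊆ W j
              · simp only [good, if_pos (And.intro e1 e2), if_pos e1, if_pos e2]; simp
              · rw [if_neg e2]; exact le_add_self
            · rw [if_neg e1, add_assoc, add_left_comm]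
              exact le_self_add
        _ ≤ _ := by
            rw [expect_add, expect_add]
            gcongr
    have h3 : (1 : ℝ≥0∞) = 1 / 3 + 1 / 3 + 1 / 3 := by
      rw [ENNReal.div_add_div_same, ENNReal.div_add_div_same]
      norm_num
      exact (ENNReal.div_self (by simp) (by simp)).symm
    have hsum' := h3.symm.le.trans hsum
    exact (ENNReal.add_le_add_iff_right (by simp)).1
      ((ENNReal.add_le_add_iff_right (by simp)).1 hsum')
  rw [attempt_mat]
  calc (1 / 9 : ℝ≥0∞) = 1 / 3 * (1 / 3) := by
        rw [one_div, one_div, ← ENNReal.mul_inv (by simp) (by simp)]; norm_num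
    _ ≤ 1 / 3 * expect μ good := by gcongr
    _ = expect μ (fun S => 1 / 3 * good S) := (expect_mul_left _ _ _).symm
    _ ≤ _ := by
        refine expect_mono fun S => ?_
        by_cases hS : Expanding k ℓ lam S ∧
          ∀ j, ∃ i, (supp (S i)).card = ℓ ∧ supp (S i) ⊆ W j
        · simp only [good, if_pos hS, mul_one]
          obtain ⟨T₀, hT₀⟩ := exists_clique_blowGraph hℓ hK hWK hdisj hS.2
          -- The guarantee of `P` covers only instances with `k ≤ N`; the clique just found supplies
          -- this.
          have hkN : k ≤ N := by
            rw [← hT₀.card_eq]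
            exact (Finset.card_le_univ _).trans (by simp)
          obtain ⟨htime, hout⟩ := hP N k (blowGraph G hℓ S) hk hkN ⟨T₀, hT₀⟩
          have hmain := third_le_of_expectedTime_le htime hout hB hB1
          rw [← enc_instance, adj_blowGraph] at hmain
          refine hmain.trans ?_
          rw [toOuterMeasure_eq_expect]
          refine expect_mono fun cfg => ?_
          by_cases hcfg : cfg ∈ {c : Config | c.1 = [] ∧ c.2 0 ∈
              {v | ∃ S_1, IsApproxSolution (blowGraph G hℓ S) k (g k) S_1 ∧ v = encodeSet S_1}}
          · rw [if_pos hcfg]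
            obtain ⟨hhalt, T, hT, hv⟩ := hcfg
            have hread : readOutput cfg = (true, encodeSet T) := by
              rw [readOutput, if_pos hhalt, hv]
            rw [if_pos]
            rw [hread]
            exact ⟨rfl, hn, isCert_of_approx hℓ hS.1 hk hγ hnum hT₀ hT⟩
          · rw [if_neg hcfg]; exact zero_le
        · simp only [good, if_neg hS, mul_zero]
          exact zero_le

end

end DkS

/-! ### Choice of the parameters -/

namespace DkS

noncomputable section

open Enc (enc sz one_le_sz)
open Filter

/-! ### Choice of the parameters -/

lemma eventually_mul_pow_le_two_pow (C d : ℕ) : ∀ᶠ a : ℕ in atTop, C * (a + 1) ^ d ≤ 2 ^ a := by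
  have h := tendsto_pow_const_div_const_pow_of_one_lt d (show (1 : ℝ) < 2 by norm_num)
  have h1 := (h.comp (tendsto_add_atTop_nat 1)).eventually (gt_mem_nhds
    (show (0 : ℝ) < 1 / (2 * (C + 1)) by positivity))
  filter_upwards [h1] with a ha
  simp only [Function.comp_apply] at ha
  rw [div_lt_div_iff₀ (by positivity) (by positivity), one_mul] at ha
  have h2 : ((C * (a + 1) ^ d : ℕ) : ℝ) ≤ ((2 ^ a : ℕ) : ℝ) := by
    push_cast at ha ⊢
    rw [pow_succ (2 : ℝ) a] at ha
    have h3 : (0 : ℝ) ≤ ((a : ℝ) + 1) ^ d := by positivity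
    nlinarith
  exact_mod_cast h2

lemma tendsto_clog : Tendsto (Nat.clog 2) atTop atTop := by
  refine tendsto_atTop.2 fun a => ?_
  filter_upwards [eventually_ge_atTop (2 ^ a)] with n hn
  calc a = Nat.clog 2 (2 ^ a) := (Nat.clog_pow 2 a (by norm_num)).symm
    _ ≤ Nat.clog 2 n := Nat.clog_mono_right 2 hn

/-- The falling factorial of `m` has `ℓ` factors, each at least `w * ℓ`, and `ℓ! ≤ ℓ ^ ℓ`. -/
lemma pow_le_choose_of_le {m ℓ w : ℕ} (h : (w + 1) * ℓ ≤ m) : w ^ ℓ ≤ m.choose ℓ := by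
  rcases Nat.eq_zero_or_pos ℓ with rfl | hℓ
  · simp
  have h1 : w * ℓ ≤ m + 1 - ℓ := by
    have : w * ℓ + ℓ ≤ m := by linarith [h]
    omega
  have h2 := Nat.pow_sub_le_descFactorial m ℓ
  rw [Nat.descFactorial_eq_factorial_mul_choose] at h2
  have h3 : w ^ ℓ * ℓ ^ ℓ ≤ m.choose ℓ * ℓ ^ ℓ := by
    calc w ^ ℓ * ℓ ^ ℓ = (w * ℓ) ^ ℓ := (mul_pow _ _ _).symm
      _ ≤ (m + 1 - ℓ) ^ ℓ := Nat.pow_le_pow_left h1 ℓ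
      _ ≤ ℓ.factorial * m.choose ℓ := h2
      _ ≤ ℓ ^ ℓ * m.choose ℓ := Nat.mul_le_mul_right _ (Nat.factorial_le_pow ℓ)
      _ = _ := mul_comm _ _
  exact Nat.le_of_mul_le_mul_right h3 (by positivity)

/-- The clique is large enough. -/
lemma choose_bound {q k lam a κ : ℕ} (hq : 1 ≤ q) (hk : 1 ≤ k) (hlam : 1 ≤ lam)
    (hκ : 4 * (8 * q * lam) ^ 2 * k ^ 2 + 48 * k ≤ κ) (ha : 2 ^ a ≤ 2 * κ ^ q) :
    12 * k * (2 ^ a) ^ (8 * q * lam) ≤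
      2 ^ (a * (8 * q - 2) * lam) * (κ / k).choose (8 * q * lam) := by
  set ℓ := 8 * q * lam with hℓ
  set w := Nat.sqrt κ + 1 with hw
  have hℓ1 : 1 ≤ ℓ := Nat.mul_pos (by omega) hlam
  have hwκ : κ ≤ w ^ 2 := by rw [sq]; exact (Nat.lt_succ_sqrt κ).le
  have hsq : 2 * (ℓ * k) ≤ Nat.sqrt κ := by
    rw [Nat.le_sqrt]
    nlinarith
  have h1 : (w + 1) * ℓ ≤ κ / k := by
    rw [Nat.le_div_iff_mul_le (by omega)]
    have hs2 : 2 ≤ Nat.sqrt κ := le_trans (by nlinarith) hsq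
    have hss := Nat.sqrt_le κ
    calc (w + 1) * ℓ * k = (Nat.sqrt κ + 2) * (ℓ * k) := by rw [hw]; ring
      _ ≤ (2 * Nat.sqrt κ) * (ℓ * k) := Nat.mul_le_mul_right _ (by omega)
      _ = Nat.sqrt κ * (2 * (ℓ * k)) := by ring
      _ ≤ Nat.sqrt κ * Nat.sqrt κ := Nat.mul_le_mul_left _ hsq
      _ ≤ κ := hss
  have h2 := pow_le_choose_of_le h1
  have h48 : 48 * k ≤ κ := le_trans (Nat.le_add_left _ _) hκ
  have hκ1 : 1 ≤ κ := by omega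
  -- Here `w` is about `√κ` and `κ ^ q` is at least `2 ^ a / 2`, so `w ^ (8 * q)` is of order `2 ^
  -- (4 * a)` or more. The `lam`-th power of this bound saves the `2 * a * lam` in the exponent that
  -- the number of sets may fall short of `2 ^ (a * ℓ)`.
  have h3 : 12 * k * 2 ^ (2 * a) ≤ w ^ (8 * q) := by
    calc 12 * k * 2 ^ (2 * a) = 12 * k * (2 ^ a) ^ 2 := by rw [← pow_mul]; ring_nf
      _ ≤ 12 * k * (2 * κ ^ q) ^ 2 := by gcongr
      _ = 48 * k * κ ^ (2 * q) := by ring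
      _ ≤ κ * κ ^ (2 * q) := Nat.mul_le_mul_right _ h48
      _ = κ ^ (2 * q + 1) := by ring
      _ ≤ κ ^ (4 * q) := Nat.pow_le_pow_right hκ1 (by omega)
      _ ≤ (w ^ 2) ^ (4 * q) := Nat.pow_le_pow_left hwκ _
      _ = w ^ (8 * q) := by rw [← pow_mul]; ring_nf
  have h4 : 12 * k * 2 ^ (2 * a * lam) ≤ (κ / k).choose ℓ := by
    calc 12 * k * 2 ^ (2 * a * lam) ≤ (12 * k) ^ lam * 2 ^ (2 * a * lam) :=
          Nat.mul_le_mul_right _ (Nat.le_self_pow (by omega) _)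
      _ = (12 * k * 2 ^ (2 * a)) ^ lam := by rw [mul_pow (12 * k), ← pow_mul]
      _ ≤ (w ^ (8 * q)) ^ lam := Nat.pow_le_pow_left h3 _
      _ = w ^ ℓ := by rw [← pow_mul, hℓ]
      _ ≤ _ := h2
  calc 12 * k * (2 ^ a) ^ ℓ = 12 * k * (2 ^ (2 * a * lam) * 2 ^ (a * (8 * q - 2) * lam)) := by
        rw [← pow_add, ← pow_mul]
        congr 2
        obtain ⟨r, hr⟩ : ∃ r, 8 * q = r + 2 := ⟨8 * q - 2, by omega⟩
        rw [hℓ, hr, Nat.add_sub_cancel]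
        ring
    _ = 2 ^ (a * (8 * q - 2) * lam) * (12 * k * 2 ^ (2 * a * lam)) := by ring
    _ ≤ _ := Nat.mul_le_mul_left _ h4

/-- With `2 ^ (a * (8 * q - 2) * lam)` sets the exponent falls short of `a * ℓ` by `2 * a * lam`.
One half of this gap pays for the `n ^ lam` choices of vertices, the other half for `3 * k * (lam *
k) ^ ℓ`, by `hA`. -/
lemma expansion_bound {q k lam a n : ℕ} (hq : 1 ≤ q) (hlam : 1 ≤ lam) (hn : n ≤ 2 ^ a)
    (hA : 3 * k * (lam * k) ^ (8 * q) ≤ 2 ^ a) :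
    3 * k * (2 ^ (a * (8 * q - 2) * lam) * n ^ lam * (lam * k) ^ (8 * q * lam)) ≤
      (2 ^ a) ^ (8 * q * lam) := by
  calc 3 * k * (2 ^ (a * (8 * q - 2) * lam) * n ^ lam * (lam * k) ^ (8 * q * lam))
      ≤ (3 * k) ^ lam * (2 ^ (a * (8 * q - 2) * lam) * (2 ^ a) ^ lam *
          (lam * k) ^ (8 * q * lam)) := by
        gcongr
        exact Nat.le_self_pow (by omega) _
    _ = 2 ^ (a * (8 * q - 2) * lam) * (2 ^ a) ^ lam * (3 * k * (lam * k) ^ (8 * q)) ^ lam := by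
        rw [mul_pow (3 * k), ← pow_mul (lam * k)]; ring
    _ ≤ 2 ^ (a * (8 * q - 2) * lam) * (2 ^ a) ^ lam * (2 ^ a) ^ lam := by gcongr
    _ = _ := by
        rw [← pow_mul, ← pow_mul, ← pow_add, ← pow_add]
        congr 1
        obtain ⟨r, hr⟩ : ∃ r, 8 * q = r + 2 := ⟨8 * q - 2, by omega⟩
        rw [hr, Nat.add_sub_cancel]
        ring

/-- The right parameters are guessed and then the attempt succeeds. Of the constant `9`, five come
from the five guesses and four from `2 ^ (-4) ≤ 1 / 9`. -/
lemma le_trial (P : Cmd) {D : ℕ} (hD : 1 ≤ D) (M : List (List Bool)) (k ℓ a x y : ℕ)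
    (h : 1 / 9 ≤ attempt P (M, k, ℓ, a, 2 ^ a, 2 ^ x, 2 ^ y) true) :
    (2⁻¹ : ℝ≥0∞) ^ (D * (k + ℓ + a + x + y) + 9) ≤ trial P D M true := by
  have hg : (2⁻¹ : ℝ≥0∞) ^ (D * (k + ℓ + a + x + y) + 5) ≤ guesses D (k, ℓ, a, x, y) := by
    have hpair : ∀ {ι κ : Type} (μ : PMF ι) (ν : PMF κ) (i : ι) (j : κ),
        pairP μ ν (i, j) = μ i * ν j := by
      intro ι κ μ ν i j
      classical
      rw [apply_eq_expect, expect_pairP, apply_eq_expect μ i, mul_comm, ← expect_mul_left]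
      congr 1
      funext x
      by_cases hx : x = i
      · simp only [Prod.mk.injEq, hx, true_and, if_true, mul_one]
        rw [← apply_eq_expect]
      · simp [hx]
    simp only [guesses, hpair]
    calc (2⁻¹ : ℝ≥0∞) ^ (D * (k + ℓ + a + x + y) + 5) = 2⁻¹ ^ (D * k + 1) * (2⁻¹ ^ (D * ℓ + 1) *
          (2⁻¹ ^ (D * a + 1) * (2⁻¹ ^ (D * x + 1) * 2⁻¹ ^ (D * y + 1)))) := by
          simp only [← pow_add]; ring_nf
      _ ≤ _ := by gcongr <;> exact le_guess_apply hD _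
  have h16 : (2⁻¹ : ℝ≥0∞) ^ 4 ≤ 1 / 9 := by
    rw [one_div, ← ENNReal.inv_pow]
    exact ENNReal.inv_le_inv.2 (by norm_num)
  rw [trial_true]
  calc (2⁻¹ : ℝ≥0∞) ^ (D * (k + ℓ + a + x + y) + 9)
      = 2⁻¹ ^ (D * (k + ℓ + a + x + y) + 5) * 2⁻¹ ^ 4 := by rw [← pow_add]
    _ ≤ guesses D (k, ℓ, a, x, y) * attempt P (M, k, ℓ, a, 2 ^ a, 2 ^ x, 2 ^ y) true := by
        gcongr
        exact h16.trans h
    _ ≤ _ := ENNReal.le_tsum (f := fun p => guesses D p * attempt P (M, p.1, p.2.1, p.2.2.1,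
        2 ^ p.2.2.1, 2 ^ p.2.2.2.1, 2 ^ p.2.2.2.2) true) (k, ℓ, a, x, y)

/-- On graphs with a large clique, a trial succeeds with probability `2 ^ (-o(log² n))`. -/
theorem eventually_le_trial {P : Cmd} {g : ℕ → ℝ} {f : ℕ → ℕ} {c : ℕ}
    (hP : ApproximatesDkS hasClique P g f c) (hg : g =o[atTop] fun k : ℕ => (k : ℝ)) {q D : ℕ}
    (hq : 1 ≤ q) (hD : 1 ≤ D) {s : ℕ} (hs : 1 ≤ s) :
    ∀ᶠ n : ℕ in atTop, ∀ (G : SimpleGraph (Fin n)) (K : Finset (Fin n)), G.IsClique K →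
      n ≤ K.card ^ q →
        (2⁻¹ : ℝ≥0∞) ^ (Nat.clog 2 n * Nat.clog 2 n / s) ≤ trial P D (mat (adj G)) true := by
  -- Chosen so that the dominant term `D * (c + 1) * 8 * q * a * lam` of the exponent, multiplied by
  -- `2 * s`, is `a * (E * lam)`, which is about `a²`: half of the allowance `a² / s`.
  obtain ⟨E, hE⟩ : ∃ E, E = 16 * s * D * (c + 1) * q := ⟨_, rfl⟩
  have hE1 : 1 ≤ E := by
    have : 0 < E := by rw [hE]; positivity
    exact this
  -- Chosen so that the forced pairs `(k - 1) * Θ * lam ^ 2` number at least `64 * q * k * lam * a`,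
  -- twice the main term `4 * k * ℓ * a` of the description length.
  obtain ⟨Θ, hΘ⟩ : ∃ Θ, Θ = 128 * q * E := ⟨_, rfl⟩
  have hΘ1 : (0 : ℝ) < Θ := by
    have : 0 < Θ := by rw [hΘ]; positivity
    exact_mod_cast this
  -- This is the only use of `g(k) = o(k)`. The value `k` depends on `s` but not on `n`, so `f k` is
  -- a constant.
  obtain ⟨k, hk, hgk⟩ : ∃ k : ℕ, 2 ≤ k ∧ g k * Θ ≤ k := by
    have h1 := (hg.def (show (0 : ℝ) < 1 / Θ by positivity)).and (eventually_ge_atTop 2)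
    obtain ⟨k, h2, hk⟩ := h1.exists
    refine ⟨k, hk, ?_⟩
    rw [Real.norm_eq_abs, Real.norm_of_nonneg (by positivity)] at h2
    calc g k * Θ ≤ |g k| * Θ := by gcongr; exact le_abs_self _
      _ ≤ 1 / Θ * k * Θ := by gcongr
      _ = k := by field_simp
  obtain ⟨F, hF⟩ : ∃ F, 3 * f k ≤ 2 ^ F := ⟨3 * f k, Nat.lt_two_pow_self.le⟩
  obtain ⟨L, hL⟩ : ∃ L, L = E + 2 * s * D * (k + 8 * q + 1 + F) + 18 * s := ⟨_, rfl⟩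
  have hev : ∀ᶠ a : ℕ in atTop, 3 * k * k ^ (8 * q) * (a + 1) ^ (8 * q) ≤ 2 ^ a ∧
      2 * (4 * (8 * q) ^ 2 * k ^ 2 + 48 * k) ^ q * (a + 1) ^ (2 * q) ≤ 2 ^ a ∧
      2 * k * (a + 1) ^ 1 ≤ 2 ^ a ∧ k ≤ a ∧ 2 * L ≤ a := by
    filter_upwards [eventually_mul_pow_le_two_pow (3 * k * k ^ (8 * q)) (8 * q),
      eventually_mul_pow_le_two_pow (2 * (4 * (8 * q) ^ 2 * k ^ 2 + 48 * k) ^ q) (2 * q),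
      eventually_mul_pow_le_two_pow (2 * k) 1, eventually_ge_atTop k,
      eventually_ge_atTop (2 * L)] with a h1 h2 h3 h4 h5 using ⟨h1, h2, h3, h4, h5⟩
  filter_upwards [tendsto_clog.eventually hev, eventually_ge_atTop 2] with n hn hn2 G K hK hKn
  set a := Nat.clog 2 n with ha
  obtain ⟨hA, hB, hC, hka, hLa⟩ := hn
  have hna : n ≤ 2 ^ a := Nat.le_pow_clog (by norm_num) n
  have ha1 : 1 ≤ a := by omega
  have han : 2 ^ a < 2 * n := by
    have h := Nat.pow_pred_clog_lt_self (b := 2) (by norm_num) (x := n) (by omega)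
    rw [← ha] at h
    obtain ⟨b, hb⟩ : ∃ b, a = b + 1 := ⟨a - 1, by omega⟩
    rw [hb, Nat.pred_succ] at h
    rw [hb, pow_succ]
    omega
  -- Rounding up gives `a ≤ E * lam ≤ a + E`: the lower bound serves the certificate, the upper
  -- bound the running time.
  obtain ⟨lam, hlam⟩ : ∃ lam, lam = a / E + 1 := ⟨_, rfl⟩
  have hlam1 : 1 ≤ lam := by rw [hlam]; exact Nat.le_add_left _ _
  have hlama : lam ≤ a + 1 := by
    rw [hlam]
    exact Nat.add_le_add_right (Nat.div_le_self a E) 1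
  have hElam : a ≤ E * lam := by
    rw [hlam]
    exact (Nat.lt_mul_div_succ a hE1).le
  have hElam' : E * lam ≤ a + E := by
    rw [hlam, mul_add, mul_one]
    exact Nat.add_le_add_right (Nat.mul_div_le a E) E
  set κ := K.card with hκ
  -- Otherwise `κ ^ q` would be polylogarithmic in `n`, giving `2 * κ ^ q ≤ 2 ^ a < 2 * n` against
  -- `n ≤ κ ^ q`.
  have hκbig : 4 * (8 * q * lam) ^ 2 * k ^ 2 + 48 * k ≤ κ := by
    by_contra hlt
    push Not at hlt
    have h1 : κ ^ q ≤ (4 * (8 * q * lam) ^ 2 * k ^ 2 + 48 * k) ^ q := Nat.pow_le_pow_left hlt.le q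
    have h2 : 4 * (8 * q * lam) ^ 2 * k ^ 2 + 48 * k ≤
        (4 * (8 * q) ^ 2 * k ^ 2 + 48 * k) * (a + 1) ^ 2 := by
      have : 1 ≤ (a + 1) ^ 2 := Nat.one_le_pow _ _ (by omega)
      calc 4 * (8 * q * lam) ^ 2 * k ^ 2 + 48 * k
          ≤ 4 * (8 * q * (a + 1)) ^ 2 * k ^ 2 + 48 * k * (a + 1) ^ 2 :=
            add_le_add (by gcongr) (Nat.le_mul_of_pos_right _ this)
        _ = _ := by ring
    have h3 : 2 * κ ^ q ≤ 2 ^ a := by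
      refine le_trans ?_ hB
      calc 2 * κ ^ q ≤ 2 * ((4 * (8 * q) ^ 2 * k ^ 2 + 48 * k) * (a + 1) ^ 2) ^ q :=
            Nat.mul_le_mul_left _ (h1.trans (Nat.pow_le_pow_left h2 q))
        _ = _ := by rw [mul_pow, ← pow_mul]; ring
    omega
  obtain ⟨ℓ, hℓ⟩ : ∃ ℓ, ℓ = 8 * q * lam := ⟨_, rfl⟩
  obtain ⟨x, hx⟩ : ∃ x, x = a * (8 * q - 2) * lam := ⟨_, rfl⟩
  -- The time bound `2 ^ y` is `2 ^ F * N ^ c` with `N = 2 ^ x`, at least three times the expected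
  -- time `f k * N ^ c` of `P`.
  obtain ⟨y, hy⟩ : ∃ y, y = F + x * c := ⟨_, rfl⟩
  have hatt : 1 / 9 ≤ attempt P (mat (adj G), k, ℓ, a, 2 ^ a, 2 ^ x, 2 ^ y) true := by
    refine ninth_le_attempt hP (lam := lam) (m := κ / k) (Θ := Θ) hK (by omega)
      (by rw [hℓ]; exact Nat.mul_pos (by omega) hlam1) ha1 hna ?_ (Nat.mul_div_le _ _) ?_ ?_ ?_ Nat.one_le_two_pow hgk ?_
    · have h1 : 2 * (lam * k) ≤ 2 ^ a := by
        refine le_trans ?_ hC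
        rw [pow_one]
        calc 2 * (lam * k) ≤ 2 * ((a + 1) * k) := by gcongr
          _ = _ := by ring
      omega
    · rw [hx, hℓ]
      refine expansion_bound hq hlam1 hna (le_trans ?_ hA)
      calc 3 * k * (lam * k) ^ (8 * q) ≤ 3 * k * ((a + 1) * k) ^ (8 * q) := by gcongr
        _ = _ := by rw [mul_pow]; ring
    · rw [hx, hℓ]
      exact choose_bound hq (by omega) hlam1 hκbig (by omega)
    · calc 3 * (f k * (2 ^ x) ^ c) = 3 * f k * 2 ^ (x * c) := by rw [← pow_mul, mul_assoc]
        _ ≤ 2 ^ F * 2 ^ (x * c) := Nat.mul_le_mul_right _ hF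
        _ = 2 ^ y := by rw [hy, pow_add]
    · have h1 : (k - 1) * Θ * (lam * lam) = 64 * q * (2 * (k - 1)) * lam * (E * lam) := by
        rw [hΘ]; ring
      have h2 : 64 * q * k * lam * a ≤ 64 * q * (2 * (k - 1)) * lam * (E * lam) := by
        gcongr
        omega
      rw [h1]
      refine lt_of_lt_of_le ?_ h2
      rw [hℓ]
      -- The term `4 * k²` of the description length fits into the spare half because `k ≤ a`, as
      -- `k` is fixed while `a` grows.
      have h3 : 4 * (k * k) < 32 * (q * k * lam * a) := by
        have hqlam : 1 ≤ q * lam := Nat.mul_pos hq hlam1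
        calc 4 * (k * k) ≤ 4 * (k * a) := by gcongr
          _ < 32 * (k * a) := by
            have : 0 < k * a := Nat.mul_pos (by omega) ha1
            omega
          _ ≤ 32 * (k * a * (q * lam)) :=
            Nat.mul_le_mul_left _ (Nat.le_mul_of_pos_right _ hqlam)
          _ = _ := by ring
      calc 4 * (k * (8 * q * lam) * a + k * k) = 32 * (q * k * lam * a) + 4 * (k * k) := by ring
        _ < 32 * (q * k * lam * a) + 32 * (q * k * lam * a) := by omega
        _ = _ := by ring
  refine le_trans (pow_le_pow_right_of_le_one' (by simp) ?_) (le_trial P hD _ k ℓ a x y hatt)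
  rw [Nat.le_div_iff_mul_le (by omega)]
  have hxle : x ≤ 8 * q * (a * lam) := by
    rw [hx]
    calc a * (8 * q - 2) * lam ≤ a * (8 * q) * lam := by gcongr; omega
      _ = _ := by ring
  -- Doubled to avoid fractions: one `a * a` bounds the dominant term and the other absorbs
  -- everything linear in `a`, collected in `L`, because `2 * L ≤ a`.
  have hsum : 2 * ((D * (k + ℓ + a + x + y) + 9) * s) ≤ 2 * (a * a) := by
    have e1 : k + ℓ + a + x + y ≤ k + 8 * q * (a + 1) + a + F + (c + 1) * (8 * q * (a * lam)) := by
      calc k + ℓ + a + x + y = k + 8 * q * lam + a + F + (c + 1) * x := by rw [hℓ, hy]; ring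
        _ ≤ _ := by gcongr
    calc 2 * ((D * (k + ℓ + a + x + y) + 9) * s)
        ≤ 2 * ((D * (k + 8 * q * (a + 1) + a + F + (c + 1) * (8 * q * (a * lam))) + 9) * s) := by
          gcongr
      _ = a * (E * lam) + (2 * s * D * (k + 8 * q * (a + 1) + a + F) + 18 * s) := by rw [hE]; ring
      _ ≤ a * (a + E) + (2 * s * D * (k + 8 * q * (a + 1) + a + F) + 18 * s) := by gcongr
      _ ≤ a * a + L * (a + 1) := by
          have e2 : k + 8 * q * (a + 1) + a + F ≤ (k + 8 * q + 1 + F) * (a + 1) := by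
            nlinarith [Nat.zero_le (k * a), Nat.zero_le (F * a)]
          calc a * (a + E) + (2 * s * D * (k + 8 * q * (a + 1) + a + F) + 18 * s)
              ≤ a * (a + E) + (2 * s * D * ((k + 8 * q + 1 + F) * (a + 1)) + 18 * s * (a + 1)) :=
                Nat.add_le_add_left (add_le_add (Nat.mul_le_mul_left _ e2)
                  (Nat.le_mul_of_pos_right _ a.succ_pos)) _
            _ ≤ a * (a + E) + (2 * s * D * ((k + 8 * q + 1 + F) * (a + 1)) + 18 * s * (a + 1)) +
                E := Nat.le_add_right _ _
            _ = _ := by rw [hL]; ring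
      _ ≤ a * a + L * (2 * a) := Nat.add_le_add_left (Nat.mul_le_mul_left _ (by omega)) _
      _ = a * a + 2 * L * a := by ring
      _ ≤ a * a + a * a := Nat.add_le_add_left (Nat.mul_le_mul_right _ hLa) _
      _ = _ := by ring
  omega

end

end DkS

/-! ### The distinguisher -/

namespace DkS

noncomputable section

open Enc (enc sz one_le_sz)
open Filter

/-! ### The distinguisher -/

lemma isClique_sup_cliqueOn {n : ℕ} (G : SimpleGraph (Fin n)) (S : Finset (Fin n)) :
    (G ⊔ cliqueOn S).IsClique S := by
  intro u hu v hv huv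
  exact Or.inr (cliqueOn_adj.2 ⟨huv, hu, hv⟩)

lemma exists_of_mem_support_genP {n κ : ℕ} (hκ : κ ≤ n) {M : List (List Bool)}
    (hM : M ∈ (genP (n, κ)).support) : ∃ G : SimpleGraph (Fin n),
      M = mat (adj (G ⊔ cliqueOn (verticesFrom n (n - κ)))) := by
  classical
  by_contra hne
  push Not at hne
  have h := expect_genP hκ fun M' => if M' = M then 1 else 0
  rw [← apply_eq_expect] at h
  refine (PMF.mem_support_iff _ _).1 hM (h.trans ?_)
  simp [expect, fun G => (hne G).symm]

lemma exists_of_mem_support_plantedClique {n κ : ℕ} (hκ : κ ≤ n) {G : SimpleGraph (Fin n)}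
    (hG : G ∈ (plantedClique n κ).support) : ∃ K : Finset (Fin n), G.IsClique K ∧ K.card = κ := by
  simp only [plantedClique, PMF.mem_support_bind_iff, PMF.support_map, Set.mem_image] at hG
  obtain ⟨G₀, -, S, hS, rfl⟩ := hG
  refine ⟨S, isClique_sup_cliqueOn G₀ S, ?_⟩
  rw [randomSubset, PMF.mem_support_uniformOfFinset_iff, Finset.mem_powersetCard] at hS
  rw [hS.2, min_eq_left hκ]

lemma eventually_trialBound {P : Cmd} {g : ℕ → ℝ} {f : ℕ → ℕ} {c : ℕ}
    (hP : ApproximatesDkS hasClique P g f c) (hg : g =o[atTop] fun k : ℕ => (k : ℝ)) {q D : ℕ}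
    (hq : 1 ≤ q) (hD : 1 ≤ D) {s : ℕ} (hs : 1 ≤ s) :
    ∀ᶠ n : ℕ in atTop, TrialBound P D q n (2⁻¹ ^ (Nat.clog 2 n * Nat.clog 2 n / s)) := by
  filter_upwards [eventually_le_trial hP hg hq hD hs] with n hn κ hκ hκq M hM
  obtain ⟨G, rfl⟩ := exists_of_mem_support_genP hκ hM
  exact hn _ _ (isClique_sup_cliqueOn G _) (by rwa [card_verticesFrom hκ])

lemma clog_mul_log_le {n : ℕ} (hn : 2 ≤ n) : Nat.clog 2 n * Real.log 2 ≤ 2 * Real.log n := by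
  have h := Nat.pow_pred_clog_lt_self (b := 2) (by norm_num) (x := n) (by omega)
  have ha : 0 < Nat.clog 2 n := Nat.clog_pos (by norm_num) (by omega)
  obtain ⟨b, hb⟩ : ∃ b, Nat.clog 2 n = b + 1 := ⟨Nat.clog 2 n - 1, by omega⟩
  rw [hb, Nat.pred_succ] at h
  have h1 : 2 ^ (b + 1) ≤ n ^ 2 := by
    rw [pow_succ, sq]
    exact Nat.mul_le_mul h.le hn
  have h2 : ((2 : ℝ) ^ (b + 1)) ≤ (n : ℝ) ^ 2 := by exact_mod_cast h1
  have h3 := Real.log_le_log (by positivity) h2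
  rw [Real.log_pow, Real.log_pow] at h3
  rw [hb]
  exact_mod_cast h3

/-- `n ^ O(1) * 2 ^ o(log² n)` is `n ^ o(log n)`. -/
lemma runsInSubquasipolyTime_of_le {Q : Cmd} {C : ℕ}
    (h : ∀ s : ℕ, 1 ≤ s → ∀ᶠ n : ℕ in atTop, ∀ G : SimpleGraph (Fin n),
      expectedTime Q (encodeGraph G) ≤
        ((n + 2) ^ C * 2 ^ (Nat.clog 2 n * Nat.clog 2 n / s) : ℕ)) :
    RunsInSubquasipolyTime Q := by
  -- The exponent `log r / log n` is read off from the worst-case time itself, so one function `h`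
  -- works for all `s` at once. The maximum with `1` keeps its logarithm nonnegative.
  let τ : ℕ → ℝ≥0∞ := fun n => ⨆ G : SimpleGraph (Fin n), expectedTime Q (encodeGraph G)
  let r : ℕ → ℝ := fun n => max (τ n).toReal 1
  have hr1 : ∀ n, 1 ≤ r n := fun n => le_max_right _ _
  have hr : ∀ s : ℕ, 1 ≤ s → ∀ᶠ n : ℕ in atTop, τ n ≠ ∞ ∧
      r n ≤ ((n + 2) ^ C * 2 ^ (Nat.clog 2 n * Nat.clog 2 n / s) : ℕ) := by
    intro s hs
    filter_upwards [h s hs] with n hn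
    have h1 : τ n ≤ ((n + 2) ^ C * 2 ^ (Nat.clog 2 n * Nat.clog 2 n / s) : ℕ) := iSup_le hn
    refine ⟨ne_top_of_le_ne_top (ENNReal.natCast_ne_top _) h1, max_le ?_ ?_⟩
    · exact ENNReal.toReal_le_of_le_ofReal (Nat.cast_nonneg _) (by rwa [ENNReal.ofReal_natCast])
    · exact_mod_cast Nat.mul_pos (by positivity) (by positivity)
  refine ⟨fun n => Real.log (r n) / Real.log n, ?_, ?_⟩
  · rw [Asymptotics.isLittleO_iff]
    intro ε hε
    -- `Nat.clog 2 n ^ 2 * log 2 ≤ 8 * log² n`, so `s ≥ 16 / ε` leaves at most half of `ε * log² n`;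
    -- the polynomial factor takes the other half for large `n`.
    obtain ⟨s, hs⟩ := exists_nat_ge (16 / ε)
    have hs0 : (0 : ℝ) < s := lt_of_lt_of_le (by positivity) hs
    have hs1 : 1 ≤ s := by exact_mod_cast hs0
    have hlog := (Real.tendsto_log_atTop.comp (tendsto_natCast_atTop_atTop (R := ℝ))).eventually
      (eventually_ge_atTop (4 * C / ε))
    filter_upwards [hr s hs1, hlog, eventually_ge_atTop 2] with n hn hnl hn2
    simp only [Function.comp_apply] at hnl
    have hn2' : (2 : ℝ) ≤ n := by exact_mod_cast hn2
    have hl : 0 < Real.log n := Real.log_pos (by linarith)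
    have hlr : 0 ≤ Real.log (r n) := Real.log_nonneg (hr1 n)
    rw [Real.norm_of_nonneg (by positivity), Real.norm_of_nonneg hl.le, div_le_iff₀ hl]
    obtain ⟨a, ha⟩ : ∃ a, a = Nat.clog 2 n := ⟨_, rfl⟩
    have hal := clog_mul_log_le hn2
    rw [← ha] at hal hn
    have h1 : Real.log (r n) ≤ C * Real.log (n + 2) + (a * a / s : ℕ) * Real.log 2 := by
      refine (Real.log_le_log (by linarith [hr1 n]) hn.2).trans_eq ?_
      push_cast
      rw [Real.log_mul (by positivity) (by positivity), Real.log_pow, Real.log_pow]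
    have h2 : Real.log (n + 2) ≤ 2 * Real.log n := by
      rw [← Nat.cast_ofNat, ← Real.log_pow]
      refine Real.log_le_log (by positivity) ?_
      push_cast
      nlinarith
    have h3 : ((a * a / s : ℕ) : ℝ) * Real.log 2 ≤ 8 / s * (Real.log n * Real.log n) := by
      have e1 : ((a * a / s : ℕ) : ℝ) ≤ a * a / s := by
        refine Nat.cast_div_le.trans_eq ?_
        push_cast
        rfl
      have e2 := Real.log_two_gt_d9
      have e3 : (a : ℝ) * a * Real.log 2 ≤ 8 * (Real.log n * Real.log n) := by
        have e4 : (a * Real.log 2) * (a * Real.log 2) ≤ (2 * Real.log n) * (2 * Real.log n) :=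
          mul_le_mul hal hal (by positivity) (by positivity)
        have e5 : (a : ℝ) * a * Real.log 2 * 1 ≤ a * a * Real.log 2 * (2 * Real.log 2) := by
          gcongr
          linarith
        linarith
      calc ((a * a / s : ℕ) : ℝ) * Real.log 2 ≤ a * a / s * Real.log 2 := by gcongr
        _ = a * a * Real.log 2 / s := by ring
        _ ≤ 8 * (Real.log n * Real.log n) / s := by gcongr
        _ = _ := by ring
    have h4 : 8 / (s : ℝ) ≤ ε / 2 := by
      rw [div_le_iff₀ hε] at hs
      rw [div_le_iff₀ hs0]
      linarith
    have h5 : 2 * (C : ℝ) ≤ ε / 2 * Real.log n := by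
      rw [div_le_iff₀ hε] at hnl
      linarith
    calc Real.log (r n) ≤ C * (2 * Real.log n) + 8 / s * (Real.log n * Real.log n) := by
          refine h1.trans (add_le_add ?_ h3)
          gcongr
      _ ≤ C * (2 * Real.log n) + ε / 2 * (Real.log n * Real.log n) := by gcongr
      _ = (2 * C) * Real.log n + ε / 2 * Real.log n * Real.log n := by ring
      _ ≤ (ε / 2 * Real.log n) * Real.log n + ε / 2 * Real.log n * Real.log n := by gcongr
      _ = ε * Real.log n * Real.log n := by ring
  · filter_upwards [hr 1 le_rfl, eventually_ge_atTop 2] with n hn hn2 G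
    have hn2' : (2 : ℝ) ≤ n := by exact_mod_cast hn2
    have hl : 0 < Real.log n := Real.log_pos (by linarith)
    rw [Real.rpow_def_of_pos (by linarith), mul_div_cancel₀ _ hl.ne', Real.exp_log
      (by linarith [hr1 n])]
    calc expectedTime Q (encodeGraph G) ≤ τ n :=
          le_iSup (fun G : SimpleGraph (Fin n) => expectedTime Q (encodeGraph G)) G
      _ = ENNReal.ofReal (τ n).toReal := (ENNReal.ofReal_toReal hn.1).symm
      _ ≤ _ := ENNReal.ofReal_le_ofReal (le_max_left _ _)

lemma ceil_rpow_le {δ : ℝ} (hδ : δ ≤ 1) {n : ℕ} (hn : 1 ≤ n) : ⌈(n : ℝ) ^ δ⌉₊ ≤ n := by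
  rw [Nat.ceil_le]
  calc (n : ℝ) ^ δ ≤ (n : ℝ) ^ (1 : ℝ) :=
        Real.rpow_le_rpow_of_exponent_le (by exact_mod_cast hn) hδ
    _ = n := Real.rpow_one _

lemma le_ceil_rpow_pow {δ : ℝ} {q : ℕ} (hq : 1 ≤ δ * q) {n : ℕ} (hn : 1 ≤ n) :
    n ≤ ⌈(n : ℝ) ^ δ⌉₊ ^ q := by
  have h : (n : ℝ) ≤ (⌈(n : ℝ) ^ δ⌉₊ : ℝ) ^ q := by
    calc (n : ℝ) = (n : ℝ) ^ (1 : ℝ) := (Real.rpow_one _).symm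
      _ ≤ (n : ℝ) ^ (δ * q) := Real.rpow_le_rpow_of_exponent_le (by exact_mod_cast hn) hq
      _ = ((n : ℝ) ^ δ) ^ q := by rw [Real.rpow_mul (by positivity), Real.rpow_natCast]
      _ ≤ _ := by gcongr; exact Nat.le_ceil _
  exact_mod_cast h

/-- An approximation algorithm for Densest `k`-Subgraph yields an algorithm that detects planted
cliques of any polynomial size. -/
theorem exists_distinguisher {P : Cmd} {g : ℕ → ℝ} {f : ℕ → ℕ} {c : ℕ}
    (hP : ApproximatesDkS hasClique P g f c) (hg : g =o[atTop] fun k : ℕ => (k : ℝ)) {δ : ℝ}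
    (hδ0 : 0 < δ) (hδ1 : δ ≤ 1) :
    ∃ Q : Cmd, RunsInSubquasipolyTime Q ∧ ∀ᶠ n : ℕ in atTop,
      2 / 3 ≤ acceptProb Q (plantedClique n ⌈(n : ℝ) ^ δ⌉₊) ∧
      acceptProb Q (erdosRenyi n) ≤ 1 / 3 := by
  classical
  -- An integer `q ≥ 1 / δ` ensures `n ≤ κ ^ q` for `κ = ⌈n ^ δ⌉`, so the sweep includes the race
  -- for the true clique size although `δ` may not be computable.
  obtain ⟨q, hq⟩ := exists_nat_ge (1 / δ)
  rw [div_le_iff₀' hδ0] at hq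
  have hq1 : 1 ≤ q := by
    rcases Nat.eq_zero_or_pos q with rfl | h
    · norm_num at hq
    · exact h
  obtain ⟨D, hD, T, hT, C, hC⟩ := RComp.detect P q
  obtain ⟨Q, hQ⟩ := hT.exists_program
  have hTle : ∀ s : ℕ, 1 ≤ s → ∀ᶠ n : ℕ in atTop, ∀ G : SimpleGraph (Fin n),
      T (mat (adj G)) ≤ ((n + 2) ^ C * 2 ^ (Nat.clog 2 n * Nat.clog 2 n / s) : ℕ) := by
    intro s hs
    filter_upwards [eventually_trialBound hP hg hq1 hD hs] with n hn G
    refine (hC n _ _ (isSquare_mat _) hn (by simp) (pow_le_one' (by simp) _)).trans_eq ?_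
    rw [div_eq_mul_inv, ← ENNReal.inv_pow, inv_inv]
    push_cast
    rfl
  refine ⟨Q, runsInSubquasipolyTime_of_le (C := C) fun s hs => ?_, ?_⟩
  · filter_upwards [hTle s hs] with n hn G
    rw [← enc_mat_adj]
    exact (hQ _).1.trans (hn G)
  filter_upwards [hTle 1 le_rfl, eventually_le_trial hP hg hq1 hD le_rfl,
    eventually_ge_atTop 9] with n hn htr hn9
  have hκ : ⌈(n : ℝ) ^ δ⌉₊ ≤ n := ceil_rpow_le hδ1 (by omega)
  have hκq : n ≤ ⌈(n : ℝ) ^ δ⌉₊ ^ q := le_ceil_rpow_pow hq (by omega)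
  generalize ⌈(n : ℝ) ^ δ⌉₊ = κ at hκ hκq
  constructor
  -- Planted case: the input graph and the graph sampled in the race for the true `κ` have waiting
  -- times of the same law, so both sweeps fail with probability at most `1/3`.
  · have h1 := expect_detect_false_le P D q hκ hκq
      ((plantedClique n κ).map fun G => mat (adj G)) ?_ ?_ (planted_waiting P D hκ)
    · rw [expect_map] at h1
      have h2 : expect (plantedClique n κ) (fun G => detect P D q (mat (adj G)) true) ≤
          acceptProb Q (plantedClique n κ) := by
        refine expect_mono fun G => ?_
        rw [← enc_mat_adj]
        exact (hQ _).2.2 (ne_top_of_le_ne_top (ENNReal.natCast_ne_top _) (hn G))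
      refine le_trans ?_ h2
      have h3 : expect (plantedClique n κ) (fun G => detect P D q (mat (adj G)) true) +
          expect (plantedClique n κ) (fun G => detect P D q (mat (adj G)) false) = 1 := by
        rw [← expect_add]
        simp only [bool_add, expect_const]
      have h4 : (2 / 3 : ℝ≥0∞) + 1 / 3 = 1 := by
        rw [ENNReal.div_add_div_same]
        norm_num
        exact ENNReal.div_self (by norm_num) (by norm_num)
      refine ENNReal.le_of_add_le_add_right (a := 1 / 3) (by norm_num) ?_
      exact (h4.trans h3.symm).le.trans (add_le_add_right h1 _)
    · intro M hM
      rw [PMF.support_map] at hM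
      obtain ⟨G, -, rfl⟩ := hM
      exact (isSquare_mat _).1
    · intro M hM
      rw [PMF.support_map] at hM
      obtain ⟨G, hG, rfl⟩ := hM
      obtain ⟨K, hK, hKc⟩ := exists_of_mem_support_plantedClique hκ hG
      exact ne_of_gt (lt_of_lt_of_le (pos_iff_ne_zero.2 (by simp))
        (htr G K hK (by rwa [hKc])))
  -- Uniform case: acceptance requires a certificate, so its probability is at most that of the
  -- existence of one.
  · refine le_trans (expect_mono (W := fun G => if HasCert (adj G) then 1 else 0) fun G => ?_)
      (expect_hasCert_le hn9)
    rw [← enc_mat_adj]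
    refine (hQ _).2.1.trans ?_
    split_ifs with h
    · exact PMF.coe_le_one _ _
    · exact (detect_eq_zero P D q h).le

end

end DkS


theorem mainTheorem1 (hSPCH : DkS.SPCH) :
    (¬ ∃ (P : DkS.Cmd) (g : ℕ → ℝ) (f : ℕ → ℕ) (c : ℕ),
        (g =o[Filter.atTop] fun k : ℕ => (k : ℝ)) ∧
        DkS.ApproximatesDkS DkS.noPromise P g f c) ∧
    (¬ ∃ (P : DkS.Cmd) (g : ℕ → ℝ) (f : ℕ → ℕ) (c : ℕ),
        (g =o[Filter.atTop] fun k : ℕ => (k : ℝ)) ∧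
        DkS.ApproximatesDkS DkS.hasClique P g f c) := by
  have main : ∀ (P : DkS.Cmd) (g : ℕ → ℝ) (f : ℕ → ℕ) (c : ℕ),
      (g =o[Filter.atTop] fun k : ℕ => (k : ℝ)) →
      ¬ DkS.ApproximatesDkS DkS.hasClique P g f c := by
    intro P g f c hg hP
    obtain ⟨δ, hδ0, hδ1, h⟩ := hSPCH
    exact h (DkS.exists_distinguisher hP hg hδ0 (by linarith))
  refine ⟨?_, fun ⟨P, g, f, c, hg, hP⟩ => main P g f c hg hP⟩
  -- A guarantee on all inputs restricts to the inputs that contain a `k`-clique.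
  rintro ⟨P, g, f, c, hg, hP⟩
  exact main P g f c hg fun n k G hk hkn _ => hP n k G hk hkn trivial
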